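/- For $i=0,1$ let $E_i\to B_i$ be a $C^\infty$ real vector bundle of finite rank over a closed (compact, boundaryless) $C^\infty$ manifold $B_i$, identified with the zero section, and let $f_i:E_i\to\mathbb R$ be a $C^\infty$ function that is $2$-homogeneous ($f_i(tx)=t^2f_i(x)$ for $t\ge 0$) and definite ($f_i>0$ on $E_i\setminus B_i$). Put $D_i=f_i^{-1}([0,1))$ and $S_i=f_i^{-1}(1)$. Suppose $S_0\neq\varnothing$ (that is, $B_0\ne\varnothing$ and $E_0$ has positive rank) and let $\psi:S_0\to S_1$ be a $C^\infty$ diffeomorphism. Let $M=D_0\cup_\xi D_1$ be glued by $$\xi:D_0\setminus B_0\to D_1\setminus B_1,\qquad \xi(x)=\sqrt{1-f_0(x)}\;\psi\bigl(x/\sqrt{f_0(x)}\bigr),$$ with the smooth structure for which $D_0$ and $D_1$ are open submanifolds, and let $f:M\to[0,1]$ be equal to $f_0$ on $D_0$ and to $1-f_1$ on $D_1$. Then $M$ is a closed manifold, and $f$ is a well defined surjective $C^\infty$ Morse–Bott function whose critical set is $L_0\cup L_1$, where $L_t=f^{-1}(t)$, $L_0=B_0$, $L_1=B_1$. Let $\mathcal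 D(M)$ and $\mathcal D[0,1]$ be the groups of $C^\infty$ diffeomorphisms with the Whitney $C^\infty$ topologies, and let $\mathcal D^+[0,1]$ be the subgroup preserving orientation. In $\mathcal D(M)$ let $\mathcal D^{fol}$ be the subgroup of all $h$ that send each $L_t$, $t\in[0,1]$, onto some $L_s$; let $\mathcal D^{fol}_+$ be the subgroup of $h\in\mathcal D^{fol}$ with $h(L_0)=L_0$ and $h(L_1)=L_1$; and let $\mathcal D^{lp}$ be the subgroup of all $h$ with $h(L_t)=L_t$ for every $t$. Let $\mathcal S(f)=\{h\in\mathcal D(M): f\circ h^{-1}=f\}$, let $\mathcal S_{LR}(f)$ be the group of pairs $(\phi,h)\in\mathcal D[0,1]\times\mathcal D(M)$ with $\phi\circ f=f\circ h$, and let $\mathcal S_{LR}^+(f)$ be its subgroup of pairs with $\phi\in\mathcal D^+[0,1]$. Write $\iota(h)=(\mathrm{id},h)$, $p(\phi,h)=\phi$, $p_M(\phi,h)=h$. Then $\mathcal S(f)=\mathcal D^{lp}$, and there is a continuous homomorphism $\sigma:\mathcal D^{fol}\to\mathcal D[0,1]$ with $\sigma(h)\circ f=f\circ h$ for all $h\in\mathcal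 D^{fol}$, such that the following holds. 1. $\sigma$ maps $\mathcal D^{fol}_+$ to $\mathcal D^+[0,1]$, and $p_M$ induces an isomorphism of short exact sequences of topological groups and continuous homomorphisms (the first arrows being topological embeddings) $$1\to\mathcal S(f)\xrightarrow{\iota}\mathcal S^+_{LR}(f)\xrightarrow{p}\mathcal D^+[0,1]\to1,\qquad 1\to\mathcal D^{lp}\hookrightarrow\mathcal D^{fol}_+\xrightarrow{\sigma}\mathcal D^+[0,1]\to1,$$ which is the identity on $\mathcal S(f)=\mathcal D^{lp}$ and on $\mathcal D^+[0,1]$; here $p_M:\mathcal S_{LR}^+(f)\to\mathcal D^{fol}_+$ is an isomorphism of topological groups with inverse $h\mapsto(\sigma(h),h)$. The sequences split compatibly: there is a continuous homomorphism $\theta:\mathcal D^+[0,1]\to\mathcal D^{fol}_+$ with $\phi\circ f=f\circ\theta(\phi)$ for all $\phi$, the homomorphism $\hat\theta(\phi)=(\phi,\theta(\phi))$ is a continuous section of $p$, $\theta=p_M\circ\hat\theta$ is a section of $\sigma$. 2. $\mathcal D^{lp}$ is a strong deformation retract of $\mathcal D^{fol}_+$. 3. If $\mathcal D^{fol}_+\ne\mathcal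 D^{fol}$, then $p_M:\mathcal S_{LR}(f)\to\mathcal D^{fol}$ is an isomorphism of topological groups with inverse $h\mapsto(\sigma(h),h)$, and it induces an isomorphism of short exact sequences of continuous homomorphisms $$1\to\mathcal S(f)\xrightarrow{\iota}\mathcal S_{LR}(f)\xrightarrow{p}\mathcal D[0,1]\to1,\qquad 1\to\mathcal D^{lp}\hookrightarrow\mathcal D^{fol}\xrightarrow{\sigma}\mathcal D[0,1]\to1,$$ which is the identity on $\mathcal S(f)=\mathcal D^{lp}$ and on $\mathcal D[0,1]$. -/

import Mathlib

open Set Topology Bundle Module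
open scoped Manifold ContDiff

noncomputable section

namespace FolDiff

/-! ### Groups of diffeomorphisms -/

section DiffGroups

/-- Diffeomorphisms of a manifold form a group under composition: `(g * h) x = g (h x)`. -/
instance diffeoGroup {𝕜 : Type*} [NontriviallyNormedField 𝕜]
    {E : Type*} [NormedAddCommGroup E] [NormedSpace 𝕜 E]
    {H : Type*} [TopologicalSpace H] {I : ModelWithCorners 𝕜 E H}
    {M : Type*} [TopologicalSpace M] [ChartedSpace H M] {n : WithTop ℕ∞} :
    Group (M ≃ₘ^n⟮I, I⟯ M) where
  mul g h := h.trans g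
  one := Diffeomorph.refl I M n
  inv h := h.symm
  mul_assoc _ _ _ := Diffeomorph.ext fun _ => rfl
  one_mul _ := Diffeomorph.ext fun _ => rfl
  mul_one _ := Diffeomorph.ext fun _ => rfl
  inv_mul_cancel h := Diffeomorph.ext fun x => h.symm_apply_apply x

/-- The group of `C^∞` diffeomorphisms of a boundaryless manifold `M` modelled on `E`. -/
abbrev DiffM (E : Type*) [NormedAddCommGroup E] [NormedSpace ℝ E]
    (M : Type*) [TopologicalSpace M] [ChartedSpace E M] : Type _ :=
  M ≃ₘ^∞⟮𝓘(ℝ, E), 𝓘(ℝ, E)⟯ M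

/-- The group of `C^∞` diffeomorphisms of the segment `[0,1]`. -/
abbrev DiffI : Type := unitInterval ≃ₘ^∞⟮𝓡∂ 1, 𝓡∂ 1⟯ unitInterval

variable (E : Type*) [NormedAddCommGroup E] [NormedSpace ℝ E]
  {M : Type*} [TopologicalSpace M] [ChartedSpace E M]

/-- A basic neighbourhood of `h₀` in the `C^∞` topology: for charts `φ`, `χ` of `M`, a compact
`K ⊆ dom φ` with `h₀ K ⊆ dom χ`, an order `r` and `ε > 0`, all `h` with `h K ⊆ dom χ` such that on
`K` the derivatives of order at most `r` of the local representations `χ ∘ h ∘ φ⁻¹` and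
`χ ∘ h₀ ∘ φ⁻¹` are `ε`-close. -/
def cInftyNhd (h₀ : DiffM E M) (φ χ : OpenPartialHomeomorph M E) (K : Set M) (r : ℕ) (ε : ℝ) :
    Set (DiffM E M) :=
  {h | MapsTo h K χ.source ∧ ∀ x ∈ K, ∀ k ≤ r,
    ‖iteratedFDeriv ℝ k (χ ∘ h ∘ φ.symm) (φ x)
      - iteratedFDeriv ℝ k (χ ∘ h₀ ∘ φ.symm) (φ x)‖ < ε}

/-- The Whitney `C^∞` topology on the diffeomorphism group. It is only used for compact `M`, for
which the weak topology generated by the sets above and the strong topology coincide. -/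
instance diffMTopology : TopologicalSpace (DiffM E M) :=
  TopologicalSpace.generateFrom
    {S | ∃ (h₀ : DiffM E M) (φ χ : OpenPartialHomeomorph M E) (K : Set M) (r : ℕ) (ε : ℝ),
      φ ∈ atlas E M ∧ χ ∈ atlas E M ∧ IsCompact K ∧ K ⊆ φ.source ∧ MapsTo h₀ K χ.source ∧
      0 < ε ∧ S = cInftyNhd E h₀ φ χ K r ε}

/-- A diffeomorphism of `[0,1]` as a real function on `ℝ`, constant outside of `[0,1]`. -/
def DiffI.extend (φ : DiffI) (t : ℝ) : ℝ := φ (projIcc 0 1 zero_le_one t)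

/-- The `C^∞` topology on the diffeomorphism group of `[0,1]`: the coarsest topology for which every
derivative depends continuously on the diffeomorphism, in the topology of uniform convergence. -/
instance diffITopology : TopologicalSpace DiffI :=
  ⨅ k : ℕ, TopologicalSpace.induced
    (fun φ : DiffI => UniformFun.ofFun
      fun t : unitInterval => iteratedDerivWithin k φ.extend (Icc 0 1) t) inferInstance

/-- Orientation preserving diffeomorphisms of `[0,1]`. -/
def diffIPlus : Subgroup DiffI where
  carrier := {φ | StrictMono φ}
  mul_mem' {φ χ} hφ hχ := StrictMono.comp (g := φ) (f := χ) hφ hχ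
  one_mem' := strictMono_id
  inv_mem' {φ} hφ s t hst := by
    have hφ' : StrictMono φ := hφ
    rw [← hφ'.lt_iff_lt]
    change φ (φ.symm s) < φ (φ.symm t)
    simpa using hst

end DiffGroups

/-! ### Foliated diffeomorphisms and stabilizers -/

section Stabilizers

variable (E : Type*) [NormedAddCommGroup E] [NormedSpace ℝ E]
  {M : Type*} [TopologicalSpace M] [ChartedSpace E M] (f : M → unitInterval)

/-- The leaf `f⁻¹(t)` of the foliation of `M` by the level sets of `f`. -/
def leaf (t : unitInterval) : Set M := f ⁻¹' {t}

/-- Foliated diffeomorphisms: the image of each leaf is a leaf. -/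
def diffFol : Subgroup (DiffM E M) where
  carrier := {h | ∀ t, ∃ s, h '' leaf f t = leaf f s}
  mul_mem' {g h} hg hh t := by
    obtain ⟨s, hs⟩ := hh t
    obtain ⟨u, hu⟩ := hg s
    refine ⟨u, ?_⟩
    rw [← hu, ← hs, ← image_comp]
    rfl
  one_mem' t := ⟨t, image_id _⟩
  inv_mem' {h} hh t := by
    by_cases hne : ∃ x, f x = t
    · obtain ⟨x, rfl⟩ := hne
      refine ⟨f (h.symm x), ?_⟩
      obtain ⟨s, hs⟩ := hh (f (h.symm x))
      have hx : x ∈ leaf f s := by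
        rw [← hs]
        exact ⟨h.symm x, rfl, h.apply_symm_apply x⟩
      have hx' : f x = s := hx
      rw [hx', ← hs]
      change h.symm '' (h '' _) = _
      rw [← image_comp]
      convert image_id _
      exact funext fun y => h.symm_apply_apply y
    · refine ⟨t, ?_⟩
      have : leaf f t = ∅ := by
        ext x
        simpa [leaf] using fun hx => hne ⟨x, hx⟩
      rw [this, image_empty]

/-- Leaf preserving diffeomorphisms. -/
def diffLp : Subgroup (DiffM E M) where
  carrier := {h | ∀ t, h '' leaf f t = leaf f t}
  mul_mem' {g h} hg hh t := by
    change (g ∘ h) '' _ = _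
    rw [image_comp, hh t, hg t]
  one_mem' t := image_id _
  inv_mem' {h} hh t := by
    change h.symm '' _ = _
    conv_lhs => rw [← hh t]
    rw [← image_comp]
    convert image_id _
    exact funext fun y => h.symm_apply_apply y

/-- Foliated diffeomorphisms leaving invariant each of the leaves `f⁻¹(0)` and `f⁻¹(1)`. -/
def diffFolPlus : Subgroup (DiffM E M) where
  carrier := {h | h ∈ diffFol E f ∧ h '' leaf f 0 = leaf f 0 ∧ h '' leaf f 1 = leaf f 1}
  mul_mem' {g h} hg hh := by
    refine ⟨mul_mem hg.1 hh.1, ?_, ?_⟩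
    · change (g ∘ h) '' _ = _
      rw [image_comp, hh.2.1, hg.2.1]
    · change (g ∘ h) '' _ = _
      rw [image_comp, hh.2.2, hg.2.2]
  one_mem' := ⟨one_mem _, image_id _, image_id _⟩
  inv_mem' {h} hh := by
    have key : ∀ t, h '' leaf f t = leaf f t → h.symm '' leaf f t = leaf f t := by
      intro t ht
      conv_lhs => rw [← ht]
      rw [← image_comp]
      convert image_id _
      exact funext fun y => h.symm_apply_apply y
    exact ⟨inv_mem hh.1, key 0 hh.2.1, key 1 hh.2.2⟩

/-- The stabilizer `S(f)` of `f` for the right action `h · f = f ∘ h⁻¹`. -/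
def stabR : Subgroup (DiffM E M) where
  carrier := {h | f ∘ h.symm = f}
  mul_mem' {g h} hg hh := by
    change (f ∘ h.symm) ∘ g.symm = f
    rw [show f ∘ h.symm = f from hh, show f ∘ g.symm = f from hg]
  one_mem' := rfl
  inv_mem' {h} hh := by
    change f ∘ h = f
    conv_lhs => rw [← show f ∘ h.symm = f from hh]
    exact funext fun x => congrArg f (h.symm_apply_apply x)

/-- The stabilizer of `f : M → [0,1]` for the left-right action: pairs `(φ, h)` of
diffeomorphisms of `[0,1]` and `M` with `φ ∘ f = f ∘ h`. -/
def stabLR : Subgroup (DiffI × DiffM E M) where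
  carrier := {p | p.1 ∘ f = f ∘ p.2}
  mul_mem' {p q} hp hq := by
    change p.1 ∘ (q.1 ∘ f) = (f ∘ p.2) ∘ q.2
    rw [show q.1 ∘ f = f ∘ q.2 from hq, ← show p.1 ∘ f = f ∘ p.2 from hp]
    rfl
  one_mem' := rfl
  inv_mem' {p} hp := by
    funext x
    have h := congrFun (show p.1 ∘ f = f ∘ p.2 from hp) (p.2.symm x)
    change p.1.symm (f x) = f (p.2.symm x)
    simp only [Function.comp_apply, Diffeomorph.apply_symm_apply] at h
    rw [← h, Diffeomorph.symm_apply_apply]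

/-- The pairs of the left-right stabilizer whose first entry preserves the orientation. -/
def stabLRPlus : Subgroup (DiffI × DiffM E M) :=
  stabLR E f ⊓ diffIPlus.comap (MonoidHom.fst DiffI (DiffM E M))

theorem diffFolPlus_le : diffFolPlus E f ≤ diffFol E f := fun _ h => h.1

theorem diffLp_le_plus : diffLp E f ≤ diffFolPlus E f :=
  fun _ h => ⟨fun t => ⟨t, h t⟩, h 0, h 1⟩

theorem diffLp_le : diffLp E f ≤ diffFol E f :=
  (diffLp_le_plus E f).trans (diffFolPlus_le E f)

variable {E f} in
theorem image_leaf_of_mem {p : DiffI × DiffM E M} (hp : p ∈ stabLR E f) (t : unitInterval) :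
    p.2 '' leaf f t = leaf f (p.1 t) := by
  have key : ∀ x, p.1 (f x) = f (p.2 x) := congrFun (show p.1 ∘ f = f ∘ p.2 from hp)
  ext y
  constructor
  · rintro ⟨x, rfl, rfl⟩
    exact (key x).symm
  · intro hy
    refine ⟨p.2.symm y, ?_, p.2.apply_symm_apply y⟩
    have h1 := key (p.2.symm y)
    rw [Diffeomorph.apply_symm_apply, show f y = p.1 t from hy] at h1
    exact p.1.injective h1

/-- The inclusion `h ↦ (id, h)` of `S(f)` into the left-right stabilizer. -/
def stabIncl : stabR E f →* stabLR E f :=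
  ((MonoidHom.inr DiffI (DiffM E M)).comp (stabR E f).subtype).codRestrict _ fun h => by
    change f = f ∘ (h : DiffM E M)
    exact ((stabR E f).inv_mem h.2).symm

/-- The inclusion `h ↦ (id, h)` of `S(f)` into the orientation preserving stabilizer. -/
def stabInclPlus : stabR E f →* stabLRPlus E f :=
  ((stabLR E f).subtype.comp (stabIncl E f)).codRestrict _ fun h =>
    ⟨(stabIncl E f h).2, diffIPlus.one_mem⟩

/-- The projection `(φ, h) ↦ φ`. -/
def projI : stabLR E f →* DiffI := (MonoidHom.fst DiffI (DiffM E M)).comp (stabLR E f).subtype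

/-- The projection `(φ, h) ↦ φ`, orientation preserving version. -/
def projIPlus : stabLRPlus E f →* diffIPlus :=
  ((MonoidHom.fst DiffI (DiffM E M)).comp (stabLRPlus E f).subtype).codRestrict _ fun p => p.2.2

/-- The projection `(φ, h) ↦ h`. -/
def projM : stabLR E f →* diffFol E f :=
  ((MonoidHom.snd DiffI (DiffM E M)).comp (stabLR E f).subtype).codRestrict _ fun p t =>
    ⟨_, image_leaf_of_mem p.2 t⟩

/-- The projection `(φ, h) ↦ h`, orientation preserving version. -/
def projMPlus : stabLRPlus E f →* diffFolPlus E f :=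
  ((MonoidHom.snd DiffI (DiffM E M)).comp (stabLRPlus E f).subtype).codRestrict _ fun p => by
    have hmono : StrictMono p.1.1 := p.2.2
    have h0 : p.1.1 0 = 0 := by
      obtain ⟨s, hs⟩ := p.1.1.surjective 0
      have h := hmono.monotone (unitInterval.nonneg' (t := s))
      exact le_antisymm (h.trans_eq hs) unitInterval.nonneg'
    have h1 : p.1.1 1 = 1 := by
      obtain ⟨s, hs⟩ := p.1.1.surjective 1
      have h := hmono.monotone (unitInterval.le_one' (t := s))
      exact le_antisymm unitInterval.le_one' (hs.symm.trans_le h)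
    refine ⟨fun t => ⟨_, image_leaf_of_mem p.2.1 t⟩, ?_, ?_⟩
    · exact (image_leaf_of_mem p.2.1 0).trans (by rw [h0])
    · exact (image_leaf_of_mem p.2.1 1).trans (by rw [h1])

end Stabilizers

/-! ### Exact sequences, retracts, Morse-Bott functions -/

/-- `1 → A → B → C → 1` is a short exact sequence of continuous homomorphisms in which `A → B` is a
topological embedding. -/
structure IsShortExact {A B C : Type*} [Group A] [Group B] [Group C]
    [TopologicalSpace A] [TopologicalSpace B] [TopologicalSpace C]
    (i : A →* B) (p : B →* C) : Prop where
  isEmbedding : IsEmbedding i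
  continuous : Continuous p
  exact : i.range = p.ker
  surjective : Function.Surjective p

/-- `A` is a strong deformation retract of the space `X`. -/
def IsStrongDeformationRetract {X : Type*} [TopologicalSpace X] (A : Set X) : Prop :=
  ∃ G : C(X × unitInterval, X), (∀ x, G (x, 0) = x) ∧ (∀ x, G (x, 1) ∈ A) ∧
    ∀ a ∈ A, ∀ t, G (a, t) = a

/-- `g : M → ℝ` is a Morse-Bott function: it is `C^∞`, near each critical point some smooth chart
takes the critical set to an affine subspace, and at each critical point the kernel of the Hessian
is the tangent space of the critical set. -/
def IsMorseBott (E : Type*) [NormedAddCommGroup E] [NormedSpace ℝ E]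
    {M : Type*} [TopologicalSpace M] [ChartedSpace E M] (g : M → ℝ) : Prop :=
  ContMDiff 𝓘(ℝ, E) 𝓘(ℝ) ∞ g ∧
  ∀ x, mfderiv 𝓘(ℝ, E) 𝓘(ℝ) g x = 0 →
    ∃ φ ∈ IsManifold.maximalAtlas 𝓘(ℝ, E) ∞ M, x ∈ φ.source ∧ ∃ W : Submodule ℝ E,
      (∀ y ∈ φ.source, mfderiv 𝓘(ℝ, E) 𝓘(ℝ) g y = 0 ↔ φ y - φ x ∈ W) ∧
      ∀ y ∈ φ.source, mfderiv 𝓘(ℝ, E) 𝓘(ℝ) g y = 0 →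
        ∀ v : E, fderiv ℝ (fderiv ℝ (g ∘ φ.symm)) (φ y) v = 0 ↔ v ∈ W

/-! ### Gluing two spaces along a homeomorphism of open subsets -/

section Gluing

variable {X Y : Type*} {U : Set X} {V : Set Y}

/-- The equivalence relation on `X ⊔ Y` generated by `u ∼ e u` for `u ∈ U`. -/
def glueSetoid (e : U ≃ V) : Setoid (X ⊕ Y) where
  r
    | .inl x, .inl x' => x = x'
    | .inr y, .inr y' => y = y'
    | .inl x, .inr y => ∃ u : U, u = x ∧ e u = y
    | .inr y, .inl x => ∃ u : U, u = x ∧ e u = y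
  iseqv :=
    { refl := by rintro (x | y) <;> rfl
      symm := by
        rintro (x | y) (x' | y') h
        · exact Eq.symm h
        · exact h
        · exact h
        · exact Eq.symm h
      trans := by
        rintro (x | y) (x' | y') (x'' | y'') h h'
        · exact Eq.trans h h'
        · obtain rfl : x = x' := h
          exact h'
        · obtain ⟨u, rfl, hu⟩ := h
          obtain ⟨u', rfl, hu'⟩ := h'
          have : u = u' := e.injective (Subtype.ext (hu.trans hu'.symm))
          exact congrArg Subtype.val this
        · obtain rfl : y' = y'' := h'
          exact h
        · obtain rfl : x' = x'' := h'
          exact h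
        · obtain ⟨u, rfl, hu⟩ := h
          obtain ⟨u', hu1, hu'⟩ := h'
          obtain rfl : u' = u := Subtype.ext hu1
          exact hu.symm.trans hu'
        · obtain rfl : y = y' := h
          exact h'
        · exact Eq.trans h h' }

/-- The space `X ∪_e Y` glued from `X` and `Y` by `e : U → V`. -/
def Glue (e : U ≃ V) : Type _ := Quotient (glueSetoid e)

/-- The map of the first piece into the glued space. -/
def glueInl (e : U ≃ V) (x : X) : Glue e := Quotient.mk (glueSetoid e) (.inl x)

/-- The map of the second piece into the glued space. -/
def glueInr (e : U ≃ V) (y : Y) : Glue e := Quotient.mk (glueSetoid e) (.inr y)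

theorem glueInl_injective (e : U ≃ V) : Function.Injective (glueInl e) := fun _ _ h =>
  Quotient.exact h

theorem glueInr_injective (e : U ≃ V) : Function.Injective (glueInr e) := fun _ _ h =>
  Quotient.exact h

theorem glueInl_eq_glueInr (e : U ≃ V) {x : X} {y : Y} :
    glueInl e x = glueInr e y ↔ ∃ u : U, u = x ∧ e u = y :=
  ⟨fun h => Quotient.exact h, fun h => Quotient.sound h⟩

theorem exists_glue (e : U ≃ V) (z : Glue e) : (∃ x, glueInl e x = z) ∨ ∃ y, glueInr e y = z := by
  obtain ⟨x | y, rfl⟩ := Quotient.exists_rep z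
  · exact Or.inl ⟨x, rfl⟩
  · exact Or.inr ⟨y, rfl⟩

variable [TopologicalSpace X] [TopologicalSpace Y]

/-- The quotient topology. -/
instance (e : U ≃ V) : TopologicalSpace (Glue e) :=
  inferInstanceAs (TopologicalSpace (Quotient (glueSetoid e)))

theorem isOpen_glue_iff (e : U ≃ V) {s : Set (Glue e)} :
    IsOpen s ↔ IsOpen (glueInl e ⁻¹' s) ∧ IsOpen (glueInr e ⁻¹' s) :=
  isOpen_coinduced.trans isOpen_sum_iff

theorem isOpenEmbedding_glueInl (e : U ≃ₜ V) (hV : IsOpen V) :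
    IsOpenEmbedding (glueInl e.toEquiv) := by
  refine .of_continuous_injective_isOpenMap ?_ (glueInl_injective _) ?_
  · exact continuous_def.2 fun s hs => ((isOpen_glue_iff _).1 hs).1
  · intro s hs
    refine (isOpen_glue_iff _).2 ⟨?_, ?_⟩
    · rwa [preimage_image_eq _ (glueInl_injective _)]
    · have : glueInr e.toEquiv ⁻¹' (glueInl e.toEquiv '' s)
          = Subtype.val '' (e '' (Subtype.val ⁻¹' s)) := by
        ext y
        simp only [mem_preimage, mem_image, glueInl_eq_glueInr]
        constructor
        · rintro ⟨x, hx, u, rfl, rfl⟩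
          exact ⟨e u, ⟨u, hx, rfl⟩, rfl⟩
        · rintro ⟨_, ⟨u, hu, rfl⟩, rfl⟩
          exact ⟨u, hu, u, rfl, rfl⟩
      rw [this]
      exact hV.isOpenMap_subtype_val _ (e.isOpenMap _ (hs.preimage continuous_subtype_val))

theorem isOpenEmbedding_glueInr (e : U ≃ₜ V) (hU : IsOpen U) :
    IsOpenEmbedding (glueInr e.toEquiv) := by
  refine .of_continuous_injective_isOpenMap ?_ (glueInr_injective _) ?_
  · exact continuous_def.2 fun s hs => ((isOpen_glue_iff _).1 hs).2
  · intro s hs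
    refine (isOpen_glue_iff _).2 ⟨?_, ?_⟩
    · have : glueInl e.toEquiv ⁻¹' (glueInr e.toEquiv '' s)
          = Subtype.val '' (e ⁻¹' (Subtype.val ⁻¹' s)) := by
        ext x
        simp only [mem_preimage, mem_image, eq_comm (b := glueInl _ _), glueInl_eq_glueInr]
        constructor
        · rintro ⟨y, hy, u, rfl, rfl⟩
          exact ⟨u, hy, rfl⟩
        · rintro ⟨u, hu, rfl⟩
          exact ⟨e u, hu, u, rfl, rfl⟩
      rw [this]
      exact hU.isOpenMap_subtype_val _
        ((hs.preimage continuous_subtype_val).preimage e.continuous)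
    · rwa [preimage_image_eq _ (glueInr_injective _)]

/-- The atlas of the glued space: the charts of both pieces. -/
@[reducible]
def glueChartedSpace (H : Type*) [TopologicalSpace H] [Nonempty H]
    (e : U ≃ₜ V) (hU : IsOpen U) (hV : IsOpen V) (cX : ChartedSpace H X) (cY : ChartedSpace H Y) :
    ChartedSpace H (Glue e.toEquiv) where
  atlas :=
    (fun c => c.lift_openEmbedding (isOpenEmbedding_glueInl e hV)) '' cX.atlas ∪
    (fun c => c.lift_openEmbedding (isOpenEmbedding_glueInr e hU)) '' cY.atlas
  chartAt z := open scoped Classical in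
    if h : ∃ x, glueInl e.toEquiv x = z then
      (cX.chartAt h.choose).lift_openEmbedding (isOpenEmbedding_glueInl e hV)
    else
      (cY.chartAt ((exists_glue _ z).resolve_left h).choose).lift_openEmbedding
        (isOpenEmbedding_glueInr e hU)
  mem_chart_source z := by
    split_ifs with h
    · exact ⟨_, cX.mem_chart_source _, h.choose_spec⟩
    · exact ⟨_, cY.mem_chart_source _, ((exists_glue _ z).resolve_left h).choose_spec⟩
  chart_mem_atlas z := by
    split_ifs with h
    · exact Or.inl ⟨_, cX.chart_mem_atlas _, rfl⟩
    · exact Or.inr ⟨_, cY.chart_mem_atlas _, rfl⟩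

/-- Charts with values in `H` turned into charts with values in `H'` by a homeomorphism. -/
@[reducible]
def chartedSpaceTrans {H H' : Type*} [TopologicalSpace H] [TopologicalSpace H'] (L : H ≃ₜ H')
    (c : ChartedSpace H X) : ChartedSpace H' X where
  atlas := (fun φ => φ.trans L.toOpenPartialHomeomorph) '' c.atlas
  chartAt x := (c.chartAt x).trans L.toOpenPartialHomeomorph
  mem_chart_source x := by simp
  chart_mem_atlas x := ⟨_, c.chart_mem_atlas x, rfl⟩

end Gluing

/-! ### Definite 2-homogeneous functions on vector bundles and their disk bundles -/

/-- `u : S → T` between subsets of manifolds is `C^∞`: it locally extends to a `C^∞` map defined on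
an open subset of the ambient manifold. -/
def IsSmoothOnSubset {E E' H H' M N : Type*} [NormedAddCommGroup E] [NormedSpace ℝ E]
    [NormedAddCommGroup E'] [NormedSpace ℝ E'] [TopologicalSpace H] [TopologicalSpace H']
    (I : ModelWithCorners ℝ E H) (J : ModelWithCorners ℝ E' H')
    [TopologicalSpace M] [ChartedSpace H M] [TopologicalSpace N] [ChartedSpace H' N]
    {S : Set M} {T : Set N} (u : S → T) : Prop :=
  ∀ x : S, ∃ (U : Set M) (g : M → N), IsOpen U ∧ (x : M) ∈ U ∧ ContMDiffOn I J ∞ g U ∧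
    ∀ y : S, (y : M) ∈ U → g y = u y

section Scalars

variable {B F : Type*} {W : B → Type*} [∀ b, AddCommGroup (W b)] [∀ b, Module ℝ (W b)]

/-- Fiberwise multiplication by a scalar. -/
def smulTot (c : ℝ) (x : TotalSpace F W) : TotalSpace F W := ⟨x.proj, c • x.2⟩

theorem smulTot_smulTot (c d : ℝ) (x : TotalSpace F W) :
    smulTot c (smulTot d x) = smulTot (c * d) x := by
  simp only [smulTot, mul_smul]
  rfl

theorem smulTot_one (x : TotalSpace F W) : smulTot 1 x = x := by
  simp only [smulTot, one_smul]

end Scalars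

section Bundles

variable {m : ℕ} {B : Type*} [TopologicalSpace B] [ChartedSpace (EuclideanSpace ℝ (Fin m)) B]
  {F : Type*} [NormedAddCommGroup F] [NormedSpace ℝ F]
  {W : B → Type*} [∀ b, AddCommGroup (W b)] [∀ b, Module ℝ (W b)]

variable [∀ b, TopologicalSpace (W b)] [TopologicalSpace (TotalSpace F W)] [FiberBundle F W]

variable (m F W) in
/-- A definite 2-homogeneous `C^∞` function on the total space of a vector bundle. -/
structure DefiniteFun where
  /-- the underlying function -/
  toFun : TotalSpace F W → ℝ
  contMDiff : ContMDiff ((𝓡 m).prod 𝓘(ℝ, F)) 𝓘(ℝ) ∞ toFun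
  homog : ∀ t : ℝ, 0 ≤ t → ∀ x, toFun (smulTot t x) = t ^ 2 * toFun x
  definite : ∀ x : TotalSpace F W, x.2 ≠ 0 → 0 < toFun x

namespace DefiniteFun

variable (q : DefiniteFun m F W)

theorem continuous : Continuous q.toFun := q.contMDiff.continuous

theorem map_zero {x : TotalSpace F W} (hx : x.2 = 0) : q.toFun x = 0 := by
  have h := q.homog 0 le_rfl x
  have hx' : smulTot 0 x = x := by
    obtain ⟨b, v⟩ := x
    simp only at hx
    simp [smulTot, hx]
  rw [hx'] at h
  simpa using h

theorem nonneg (x : TotalSpace F W) : 0 ≤ q.toFun x := by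
  by_cases hx : x.2 = 0
  · exact (q.map_zero hx).ge
  · exact (q.definite x hx).le

/-- The open disk bundle `q⁻¹([0,1))`. -/
def disk : TopologicalSpace.Opens (TotalSpace F W) :=
  ⟨{x | q.toFun x < 1}, isOpen_lt q.continuous continuous_const⟩

/-- The sphere bundle `q⁻¹(1)`. -/
def sphere : Set (TotalSpace F W) := {x | q.toFun x = 1}

/-- The open disk bundle without the zero section. -/
def punctured : Set q.disk := {x | (x : TotalSpace F W).2 ≠ 0}

theorem mem_punctured_iff {x : q.disk} : x ∈ q.punctured ↔ 0 < q.toFun x :=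
  ⟨fun h => q.definite _ h, fun h h0 => h.ne' (q.map_zero h0)⟩

theorem isOpen_punctured : IsOpen q.punctured := by
  have : q.punctured = {x : q.disk | 0 < q.toFun x} := Set.ext fun x => q.mem_punctured_iff
  rw [this]
  exact isOpen_lt continuous_const (q.continuous.comp continuous_subtype_val)

theorem map_normalize {x : TotalSpace F W} (hx : 0 < q.toFun x) :
    q.toFun (smulTot (√(q.toFun x))⁻¹ x) = 1 := by
  rw [q.homog _ (by positivity), inv_pow, Real.sq_sqrt hx.le, inv_mul_cancel₀ hx.ne']

/-- The radial projection `x ↦ x / √(q x)` of the punctured disk bundle to the sphere bundle. -/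
def normalize (x : q.punctured) : q.sphere :=
  ⟨smulTot (√(q.toFun (x : q.disk)))⁻¹ ((x : q.disk) : TotalSpace F W),
    q.map_normalize (q.mem_punctured_iff.1 x.2)⟩

/-- The point `√(1 - s) · y` of the punctured disk bundle, for `y` in the sphere bundle. -/
def rescale (s : ℝ) (hs : 0 < s) (hs1 : s < 1) (y : q.sphere) : q.punctured :=
  have h : q.toFun (smulTot √(1 - s) (y : TotalSpace F W)) = 1 - s := by
    rw [q.homog _ (by positivity), Real.sq_sqrt (by linarith), show q.toFun y = 1 from y.2, mul_one]
  ⟨⟨smulTot √(1 - s) (y : TotalSpace F W), show _ < (1 : ℝ) by rw [h]; linarith⟩,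
    q.mem_punctured_iff.2 (by rw [h]; linarith)⟩

theorem map_rescale (s : ℝ) (hs : 0 < s) (hs1 : s < 1) (y : q.sphere) :
    q.toFun ((q.rescale s hs hs1 y : q.disk) : TotalSpace F W) = 1 - s := by
  change q.toFun (smulTot √(1 - s) (y : TotalSpace F W)) = 1 - s
  rw [q.homog _ (by positivity), Real.sq_sqrt (by linarith), show q.toFun y = 1 from y.2, mul_one]

theorem normalize_rescale (s : ℝ) (hs : 0 < s) (hs1 : s < 1) (y : q.sphere) :
    q.normalize (q.rescale s hs hs1 y) = y := by
  apply Subtype.ext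
  have h := q.map_rescale s hs hs1 y
  change smulTot (√(q.toFun ((q.rescale s hs hs1 y : q.disk) : TotalSpace F W)))⁻¹
    (smulTot √(1 - s) (y : TotalSpace F W)) = y
  have h1 : √(1 - s) ≠ 0 := (Real.sqrt_pos.2 (by linarith)).ne'
  rw [h, smulTot_smulTot, inv_mul_cancel₀ h1, smulTot_one]

theorem rescale_normalize (x : q.punctured) (s : ℝ) (hs : 0 < s) (hs1 : s < 1)
    (h : s = 1 - q.toFun (x : q.disk)) : q.rescale s hs hs1 (q.normalize x) = x := by
  apply Subtype.ext
  apply Subtype.ext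
  change smulTot √(1 - s) (smulTot (√(q.toFun (x : q.disk)))⁻¹ ((x : q.disk) : TotalSpace F W)) = x
  have h0 : 0 < q.toFun (x : q.disk) := q.mem_punctured_iff.1 x.2
  have h1 : √(q.toFun (x : q.disk)) ≠ 0 := (Real.sqrt_pos.2 h0).ne'
  rw [h, sub_sub_cancel, smulTot_smulTot, mul_inv_cancel₀ h1, smulTot_one]

theorem toFun_lt_one (x : q.punctured) : q.toFun (x : q.disk) < 1 := (x : q.disk).2

theorem toFun_pos (x : q.punctured) : 0 < q.toFun (x : q.disk) := q.mem_punctured_iff.1 x.2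

end DefiniteFun

theorem contMDiffAt_smulTot [VectorBundle ℝ F W] {E' H' M' : Type*}
    [NormedAddCommGroup E'] [NormedSpace ℝ E'] [TopologicalSpace H']
    {J : ModelWithCorners ℝ E' H'} [TopologicalSpace M'] [ChartedSpace H' M']
    {c : M' → ℝ} {g : M' → TotalSpace F W} {z : M'} (hc : ContMDiffAt J 𝓘(ℝ) ∞ c z)
    (hg : ContMDiffAt J ((𝓡 m).prod 𝓘(ℝ, F)) ∞ g z) :
    ContMDiffAt J ((𝓡 m).prod 𝓘(ℝ, F)) ∞ (fun w => smulTot (c w) (g w)) z := by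
  rw [contMDiffAt_totalSpace] at hg ⊢
  refine ⟨hg.1, ?_⟩
  refine (hc.smul hg.2).congr_of_eventuallyEq ?_
  have hb : ∀ᶠ w in 𝓝 z, (g w).proj ∈ (trivializationAt F W (g z).proj).baseSet :=
    hg.1.continuousAt.eventually_mem
      ((trivializationAt F W (g z).proj).open_baseSet.mem_nhds
        (FiberBundle.mem_baseSet_trivializationAt' _))
  filter_upwards [hb] with w hw
  exact ((trivializationAt F W (g z).proj).linear ℝ hw).map_smul (c w) (g w).2

end Bundles

/-! ### Gluing two disk bundles -/

section Double

variable {m₀ : ℕ} {B₀ : Type*} [TopologicalSpace B₀] [ChartedSpace (EuclideanSpace ℝ (Fin m₀)) B₀]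
  {F₀ : Type*} [NormedAddCommGroup F₀] [NormedSpace ℝ F₀]
  {W₀ : B₀ → Type*} [∀ b, AddCommGroup (W₀ b)] [∀ b, Module ℝ (W₀ b)]
  [∀ b, TopologicalSpace (W₀ b)] [TopologicalSpace (TotalSpace F₀ W₀)] [FiberBundle F₀ W₀]
  {m₁ : ℕ} {B₁ : Type*} [TopologicalSpace B₁] [ChartedSpace (EuclideanSpace ℝ (Fin m₁)) B₁]
  {F₁ : Type*} [NormedAddCommGroup F₁] [NormedSpace ℝ F₁]
  {W₁ : B₁ → Type*} [∀ b, AddCommGroup (W₁ b)] [∀ b, Module ℝ (W₁ b)]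
  [∀ b, TopologicalSpace (W₁ b)] [TopologicalSpace (TotalSpace F₁ W₁)] [FiberBundle F₁ W₁]

/-- A diffeomorphism between the sphere bundles. -/
structure SphereDiffeo (q₀ : DefiniteFun m₀ F₀ W₀) (q₁ : DefiniteFun m₁ F₁ W₁) where
  /-- the underlying bijection -/
  toEquiv : q₀.sphere ≃ q₁.sphere
  smooth : IsSmoothOnSubset ((𝓡 m₀).prod 𝓘(ℝ, F₀)) ((𝓡 m₁).prod 𝓘(ℝ, F₁)) toEquiv
  smooth_symm : IsSmoothOnSubset ((𝓡 m₁).prod 𝓘(ℝ, F₁)) ((𝓡 m₀).prod 𝓘(ℝ, F₀)) toEquiv.symm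

/-- The map `x ↦ √(1 - q₀ x) · u (x / √(q₀ x))` of the punctured disk bundles. -/
def radialExt (q₀ : DefiniteFun m₀ F₀ W₀) (q₁ : DefiniteFun m₁ F₁ W₁)
    (u : q₀.sphere → q₁.sphere) (x : q₀.punctured) : q₁.punctured :=
  q₁.rescale (q₀.toFun (x : q₀.disk)) (q₀.toFun_pos x) (q₀.toFun_lt_one x) (u (q₀.normalize x))

theorem map_radialExt (q₀ : DefiniteFun m₀ F₀ W₀) (q₁ : DefiniteFun m₁ F₁ W₁)
    (u : q₀.sphere → q₁.sphere) (x : q₀.punctured) :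
    q₁.toFun (radialExt q₀ q₁ u x : q₁.disk) = 1 - q₀.toFun (x : q₀.disk) :=
  q₁.map_rescale _ _ _ _

theorem radialExt_radialExt (q₀ : DefiniteFun m₀ F₀ W₀) (q₁ : DefiniteFun m₁ F₁ W₁)
    (u : q₀.sphere → q₁.sphere) (v : q₁.sphere → q₀.sphere) (h : ∀ y, v (u y) = y)
    (x : q₀.punctured) : radialExt q₁ q₀ v (radialExt q₀ q₁ u x) = x := by
  have h1 : q₁.normalize (radialExt q₀ q₁ u x) = u (q₀.normalize x) :=
    q₁.normalize_rescale _ _ _ _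
  unfold radialExt at h1 ⊢
  simp only [h1, h]
  exact q₀.rescale_normalize x _ _ _ (map_radialExt q₀ q₁ u x)

theorem radialExt_local [VectorBundle ℝ F₀ W₀] [VectorBundle ℝ F₁ W₁]
    (q₀ : DefiniteFun m₀ F₀ W₀) (q₁ : DefiniteFun m₁ F₁ W₁)
    {u : q₀.sphere → q₁.sphere}
    (hu : IsSmoothOnSubset ((𝓡 m₀).prod 𝓘(ℝ, F₀)) ((𝓡 m₁).prod 𝓘(ℝ, F₁)) u) (x : q₀.punctured) :
    ∃ g : TotalSpace F₀ W₀ → TotalSpace F₁ W₁,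
      ContMDiffAt ((𝓡 m₀).prod 𝓘(ℝ, F₀)) ((𝓡 m₁).prod 𝓘(ℝ, F₁)) ∞ g (x : q₀.disk) ∧
      ∀ᶠ y in 𝓝 ((x : q₀.disk) : TotalSpace F₀ W₀), ∀ hy : y ∈ q₀.disk,
        ∀ hy' : (⟨y, hy⟩ : q₀.disk) ∈ q₀.punctured, g y = (radialExt q₀ q₁ u ⟨_, hy'⟩ : q₁.disk) := by
  obtain ⟨U, g, hU, hxU, hg, hgu⟩ := hu (q₀.normalize x)
  have hpos := q₀.toFun_pos x
  have hlt := q₀.toFun_lt_one x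
  have hq : ContMDiffAt ((𝓡 m₀).prod 𝓘(ℝ, F₀)) 𝓘(ℝ) ∞ q₀.toFun (x : q₀.disk) :=
    q₀.contMDiff _
  have hn : ContMDiffAt ((𝓡 m₀).prod 𝓘(ℝ, F₀)) ((𝓡 m₀).prod 𝓘(ℝ, F₀)) ∞
      (fun y => smulTot (√(q₀.toFun y))⁻¹ y) ((x : q₀.disk) : TotalSpace F₀ W₀) := by
    refine contMDiffAt_smulTot ?_ contMDiffAt_id
    have hs : ContDiffAt ℝ ∞ (fun t : ℝ => (√t)⁻¹) (q₀.toFun (x : q₀.disk)) :=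
      (Real.contDiffAt_sqrt hpos.ne').inv (Real.sqrt_pos.2 hpos).ne'
    exact hs.contMDiffAt.comp _ hq
  refine ⟨fun y => smulTot √(1 - q₀.toFun y) (g (smulTot (√(q₀.toFun y))⁻¹ y)), ?_, ?_⟩
  · refine contMDiffAt_smulTot ?_ ?_
    · have hs : ContDiffAt ℝ ∞ (fun t : ℝ => √(1 - t)) (q₀.toFun (x : q₀.disk)) :=
        (contDiffAt_const.sub contDiffAt_id).sqrt (by simp only [id]; linarith)
      exact hs.contMDiffAt.comp _ hq
    · exact ContMDiffAt.comp _ (hg.contMDiffAt (hU.mem_nhds hxU)) hn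
  · filter_upwards [hn.continuousAt.eventually_mem (hU.mem_nhds hxU)] with y hyU hy hy'
    change smulTot _ (g _) = smulTot _ _
    rw [← hgu (q₀.normalize ⟨_, hy'⟩) hyU]
    rfl

theorem continuous_radialExt [VectorBundle ℝ F₀ W₀] [VectorBundle ℝ F₁ W₁]
    (q₀ : DefiniteFun m₀ F₀ W₀) (q₁ : DefiniteFun m₁ F₁ W₁)
    {u : q₀.sphere → q₁.sphere}
    (hu : IsSmoothOnSubset ((𝓡 m₀).prod 𝓘(ℝ, F₀)) ((𝓡 m₁).prod 𝓘(ℝ, F₁)) u) :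
    Continuous (radialExt q₀ q₁ u) := by
  rw [continuous_induced_rng, continuous_induced_rng, continuous_iff_continuousAt]
  intro x
  obtain ⟨g, hg, hgu⟩ := radialExt_local q₀ q₁ hu x
  have hc : ContinuousAt (fun y : q₀.punctured => ((y : q₀.disk) : TotalSpace F₀ W₀)) x :=
    (continuous_subtype_val.comp continuous_subtype_val).continuousAt
  refine (ContinuousAt.comp (f := fun y : q₀.punctured => ((y : q₀.disk) : TotalSpace F₀ W₀))
    hg.continuousAt hc).congr ?_
  filter_upwards [hc.eventually hgu] with y hy
  exact hy _ y.2

theorem radialExt_finrank_le [VectorBundle ℝ F₀ W₀] [VectorBundle ℝ F₁ W₁]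
    [FiniteDimensional ℝ F₀] [FiniteDimensional ℝ F₁]
    (q₀ : DefiniteFun m₀ F₀ W₀) (q₁ : DefiniteFun m₁ F₁ W₁)
    {u : q₀.sphere → q₁.sphere} {v : q₁.sphere → q₀.sphere}
    (hu : IsSmoothOnSubset ((𝓡 m₀).prod 𝓘(ℝ, F₀)) ((𝓡 m₁).prod 𝓘(ℝ, F₁)) u)
    (hv : IsSmoothOnSubset ((𝓡 m₁).prod 𝓘(ℝ, F₁)) ((𝓡 m₀).prod 𝓘(ℝ, F₀)) v)
    (huv : ∀ y, v (u y) = y) (y₀ : q₀.sphere) :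
    m₀ + finrank ℝ F₀ ≤ m₁ + finrank ℝ F₁ := by
  set x₀ : q₀.punctured := q₀.rescale (1 / 2) (by norm_num) (by norm_num) y₀
  obtain ⟨g, hg, hgu⟩ := radialExt_local q₀ q₁ hu x₀
  obtain ⟨g', hg', hgv⟩ := radialExt_local q₁ q₀ hv (radialExt q₀ q₁ u x₀)
  have hgx : g (x₀ : q₀.disk) = (radialExt q₀ q₁ u x₀ : q₁.disk) :=
    hgu.self_of_nhds (x₀ : q₀.disk).2 x₀.2
  rw [← hgx] at hg' hgv
  have hev : (g' ∘ g) =ᶠ[𝓝 ((x₀ : q₀.disk) : TotalSpace F₀ W₀)] id := by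
    have hdisk : ∀ᶠ y in 𝓝 ((x₀ : q₀.disk) : TotalSpace F₀ W₀), y ∈ q₀.disk :=
      q₀.disk.isOpen.mem_nhds (x₀ : q₀.disk).2
    have hpos : ∀ᶠ y in 𝓝 ((x₀ : q₀.disk) : TotalSpace F₀ W₀), 0 < q₀.toFun y :=
      (isOpen_lt continuous_const q₀.continuous).mem_nhds (q₀.toFun_pos x₀)
    filter_upwards [hgu, hg.continuousAt.eventually hgv, hdisk, hpos] with y h1 h2 h3 h4
    have h5 : (⟨y, h3⟩ : q₀.disk) ∈ q₀.punctured := q₀.mem_punctured_iff.2 h4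
    have h6 := h1 h3 h5
    simp only [Function.comp_apply, h6] at h2 ⊢
    rw [h2 (radialExt q₀ q₁ u ⟨_, h5⟩ : q₁.disk).2 (radialExt q₀ q₁ u ⟨_, h5⟩).2]
    exact congrArg (fun z : q₀.punctured => ((z : q₀.disk) : TotalSpace F₀ W₀))
      (radialExt_radialExt q₀ q₁ u v huv ⟨⟨y, h3⟩, h5⟩)
  have hd := mfderiv_comp _ (hg'.mdifferentiableAt (by simp)) (hg.mdifferentiableAt (by simp))
  rw [hev.mfderiv_eq, mfderiv_id] at hd
  have hinj : Function.Injective (mfderiv ((𝓡 m₀).prod 𝓘(ℝ, F₀)) ((𝓡 m₁).prod 𝓘(ℝ, F₁)) g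
      ((x₀ : q₀.disk) : TotalSpace F₀ W₀)) := by
    intro a b hab
    have ha := DFunLike.congr_fun hd a
    have hb := DFunLike.congr_fun hd b
    simp only [ContinuousLinearMap.comp_apply, hab] at ha hb
    exact ha.trans hb.symm
  have aux : ∀ T : (EuclideanSpace ℝ (Fin m₀) × F₀) →L[ℝ] (EuclideanSpace ℝ (Fin m₁) × F₁),
      Function.Injective T → m₀ + finrank ℝ F₀ ≤ m₁ + finrank ℝ F₁ := fun T hT => by
    simpa using LinearMap.finrank_le_finrank_of_injective (f := T.toLinearMap) hT
  exact aux _ hinj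

namespace SphereDiffeo

variable [VectorBundle ℝ F₀ W₀] [VectorBundle ℝ F₁ W₁]
  {q₀ : DefiniteFun m₀ F₀ W₀} {q₁ : DefiniteFun m₁ F₁ W₁} (ψ : SphereDiffeo q₀ q₁)

/-- The gluing map `ξ(x) = √(1 - q₀ x) · ψ(x / √(q₀ x))` of the punctured open disk bundles. -/
def gluingMap : q₀.punctured ≃ₜ q₁.punctured where
  toFun := radialExt q₀ q₁ ψ.toEquiv
  invFun := radialExt q₁ q₀ ψ.toEquiv.symm
  left_inv := radialExt_radialExt q₀ q₁ _ _ ψ.toEquiv.symm_apply_apply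
  right_inv := radialExt_radialExt q₁ q₀ _ _ ψ.toEquiv.apply_symm_apply
  continuous_toFun := continuous_radialExt q₀ q₁ ψ.smooth
  continuous_invFun := continuous_radialExt q₁ q₀ ψ.smooth_symm

/-- The space glued from the open disk bundles by the gluing map. -/
def Glued : Type _ := Glue ψ.gluingMap.toEquiv

instance : TopologicalSpace ψ.Glued := inferInstanceAs (TopologicalSpace (Glue _))

/-- The first open disk bundle in the glued space. -/
def inl : q₀.disk → ψ.Glued := glueInl _

/-- The second open disk bundle in the glued space. -/
def inr : q₁.disk → ψ.Glued := glueInr _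

/-- The function on the glued space equal to `q₀` on the first and to `1 - q₁` on the second open
disk bundle. -/
def fn : ψ.Glued → unitInterval :=
  Quotient.lift
    (Sum.elim (fun x : q₀.disk => ⟨q₀.toFun x, q₀.nonneg _, (le_of_lt x.2 : q₀.toFun x ≤ 1)⟩)
      (fun y : q₁.disk => ⟨1 - q₁.toFun y, sub_nonneg.2 (le_of_lt y.2 : q₁.toFun y ≤ 1),
        sub_le_self _ (q₁.nonneg _)⟩))
    (by
      have key : ∀ u : q₀.punctured,
          q₀.toFun (u : q₀.disk) = 1 - q₁.toFun (ψ.gluingMap u : q₁.disk) := fun u => by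
        have h := map_radialExt q₀ q₁ ψ.toEquiv u
        change _ = 1 - q₁.toFun (radialExt q₀ q₁ ψ.toEquiv u : q₁.disk)
        rw [h, sub_sub_cancel]
      rintro (x | y) (x' | y') h
      · obtain rfl : x = x' := h
        rfl
      · obtain ⟨u, rfl, rfl⟩ := h
        exact Subtype.ext (key u)
      · obtain ⟨u, rfl, rfl⟩ := h
        exact Subtype.ext (key u).symm
      · obtain rfl : y = y' := h
        rfl)

theorem finrank_eq [FiniteDimensional ℝ F₀] [FiniteDimensional ℝ F₁]
    (ψ : SphereDiffeo q₀ q₁) (hne : q₀.sphere.Nonempty) :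
    m₁ + finrank ℝ F₁ = m₀ + finrank ℝ F₀ := by
  obtain ⟨y, hy⟩ := hne
  exact le_antisymm
    (radialExt_finrank_le q₁ q₀ ψ.smooth_symm ψ.smooth ψ.toEquiv.apply_symm_apply
      (ψ.toEquiv ⟨y, hy⟩))
    (radialExt_finrank_le q₀ q₁ ψ.smooth ψ.smooth_symm ψ.toEquiv.symm_apply_apply ⟨y, hy⟩)

/-- An identification of the local models of the second and of the first disk bundle: both have the
same dimension. -/
def modelEquiv [FiniteDimensional ℝ F₀] [FiniteDimensional ℝ F₁] (ψ : SphereDiffeo q₀ q₁)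
    (hne : q₀.sphere.Nonempty) :
    (EuclideanSpace ℝ (Fin m₁) × F₁) ≃L[ℝ] EuclideanSpace ℝ (Fin (m₀ + finrank ℝ F₀)) :=
  ContinuousLinearEquiv.ofFinrankEq (by simpa using ψ.finrank_eq hne)

/-- The local model of the glued space: the Euclidean space of dimension `dim B₀ + rank F₀`. -/
abbrev E (_ψ : SphereDiffeo q₀ q₁) : Type := EuclideanSpace ℝ (Fin (m₀ + finrank ℝ F₀))

/-- The smooth structure of the glued space: its charts are those
of the two open disk bundles, with the values moved to `ℝ^d` by linear isomorphisms. -/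
instance [FiniteDimensional ℝ F₀] [FiniteDimensional ℝ F₁] [Nonempty q₀.sphere] :
    ChartedSpace ψ.E ψ.Glued :=
  glueChartedSpace _ ψ.gluingMap q₀.isOpen_punctured q₁.isOpen_punctured
    (chartedSpaceTrans (H := ModelProd (EuclideanSpace ℝ (Fin m₀)) F₀)
      (ContinuousLinearEquiv.ofFinrankEq (𝕜 := ℝ) (E := EuclideanSpace ℝ (Fin m₀) × F₀)
        (by simp)).toHomeomorph inferInstance)
    (chartedSpaceTrans (H := ModelProd (EuclideanSpace ℝ (Fin m₁)) F₁)
      (ψ.modelEquiv Set.Nonempty.of_subtype).toHomeomorph inferInstance)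

end SphereDiffeo

end Double

end FolDiff

end

open FolDiff

noncomputable section

namespace FolDiff

/-! ### Families of maps with jointly continuous derivatives -/

section Slices

variable {T E : Type*} [TopologicalSpace T] [TopologicalSpace E]

/-! The proof rests on two explicit passages between foliated diffeomorphisms of `M` and
diffeomorphisms of `[0,1]`; the exact sequences, their splitting and the retraction then follow
formally.

From `M` to `[0,1]`. Since `f` is onto, a foliated `h` induces a unique bijection `σ(h)` with `σ(h)
∘ f = f ∘ h`. What needs proof is that `σ(h)` is smooth, above all at 0 and 1, and depends
continuously on `h`. Let `v` lie in the sphere bundle of `E₀`. Homogeneity extends to negative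
scalars (`DefiniteFun.map_smulTot`), so `f(sv) = s²` for `|s| < 1`, and `σ(h)(s²) = f(h(sv))` is a
smooth even function of `s`. By Whitney's theorem such a function is a smooth function of `s²` up to
the boundary; it is obtained by iterating Hadamard's lemma (`IsJets.comp_sqrt`). A diameter of `D₁`,
along which `f = 1 - s²`, handles the other end (`jetContOn_leafMap`).

From `[0,1]` to `M`. For increasing `φ` one has `φ(s) = s ∫ φ'(xs) dx` with a positive integral, so
the radial factor `√(φ(s)/s)` is smooth and positive on all of `[0,1]`. Multiplying `x ∈ D₀` by the
factor at `s = f(x)` moves the level `s` to `φ(s)`; on `D₁` the conjugate of `φ` by `s ↦ 1 - s` is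
used. The gluing map sends rays to rays, and a point of a ray is determined by its level (`Ray.eq`).
Hence both recipes agree on the overlap, and the lifts compose as the `φ` do (`lift_eq`,
`famAt_lift`).

Topology. Continuity of a map into either diffeomorphism group amounts to joint continuity, in the
parameter and the point, of all derivatives in charts (`continuous_diffI_iff`,
`continuous_diffM_iff`). This property, `JetCont`, is stable under composition, averaging, even
functions of a square root, and inversion. Running both constructions with parameters therefore
proves smoothness and continuity at the same time.

The formal part. The pair `(σ(h), h)` is the inverse of the projection to `h`. If `Λ` is the
straight segment from the identity to a given increasing diffeomorphism, then `h · θ(Λ(σ(h)⁻¹, t))`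
deforms an orientation preserving foliated `h` into the kernel of `σ`. One foliated `h` outside
`D^fol_+` induces a decreasing `σ(h)`, which together with the lifts makes `σ` onto all of `D[0,1]`.

The geometry of `M`. Compactness comes from the two compact pieces `fᵢ ≤ 1/2`. For the Morse–Bott
property, in a chart linear along the fibres `f` is, up to an affine change of values, 2-homogeneous
in the fibre coordinate. Euler's identity locates the critical points, and `f` restricted to a fibre
ray is `A t²` with `A > 0`, which determines the kernel of the Hessian. -/

theorem eventually_slice {s : Set E} {t₀ : T} {x₀ : E} {P : T × E → Prop}
    (h : ∀ᶠ p in 𝓝[univ ×ˢ s] (t₀, x₀), P p) :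
    ∀ᶠ p in 𝓝[univ ×ˢ s] (t₀, x₀), ∀ᶠ y in 𝓝[s] p.2, P (p.1, y) := by
  filter_upwards [eventually_eventually_nhdsWithin.2 h] with p hp
  have : Filter.Tendsto (fun y => (p.1, y)) (𝓝[s] p.2) (𝓝[univ ×ˢ s] p) :=
    tendsto_nhdsWithin_iff.2
      ⟨(Continuous.prodMk_right p.1).continuousAt.continuousWithinAt,
        eventually_mem_nhdsWithin.mono fun y hy => ⟨mem_univ _, hy⟩⟩
  exact this.eventually hp

theorem eventually_mem_slice {s : Set E} {t₀ : T} {x₀ : E} :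
    ∀ᶠ p in 𝓝[univ ×ˢ s] (t₀, x₀), p.2 ∈ s :=
  eventually_mem_nhdsWithin.mono fun _ hp => hp.2

end Slices

/-! ### Stability of jointly continuous jets under the operations of calculus -/

section JetCont

variable {T T' E F G : Type*} [TopologicalSpace T] [TopologicalSpace T']
  [NormedAddCommGroup E] [NormedSpace ℝ E] [NormedAddCommGroup F] [NormedSpace ℝ F]
  [NormedAddCommGroup G] [NormedSpace ℝ G]

/-- The maps `u t`, smooth on `s`, have derivatives that depend continuously on `(t, x)` at the
point `(t₀, x₀)`. -/
structure JetCont (u : T → E → F) (s : Set E) (t₀ : T) (x₀ : E) : Prop where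
  contDiff : ∀ n : ℕ, ∀ᶠ p in 𝓝[univ ×ˢ s] (t₀, x₀), ContDiffWithinAt ℝ n (u p.1) s p.2
  cont : ∀ k : ℕ, ContinuousWithinAt
    (fun p : T × E => iteratedFDerivWithin ℝ k (u p.1) s p.2) (univ ×ˢ s) (t₀, x₀)

namespace JetCont

variable {u : T → E → F} {s : Set E} {t₀ : T} {x₀ : E}

theorem continuousWithinAt (h : JetCont u s t₀ x₀) :
    ContinuousWithinAt (fun p : T × E => u p.1 p.2) (univ ×ˢ s) (t₀, x₀) := by
  have := (continuousMultilinearCurryFin0 ℝ E F).continuous.continuousAt.comp_continuousWithinAt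
    (h.cont 0)
  refine this.congr (fun p _ => ?_) ?_ <;> simp

theorem congr {v : T → E → F} (h : JetCont u s t₀ x₀) (hx : x₀ ∈ s)
    (huv : ∀ᶠ p in 𝓝[univ ×ˢ s] (t₀, x₀), v p.1 p.2 = u p.1 p.2) : JetCont v s t₀ x₀ := by
  have h1 := eventually_slice huv
  have h2 := eventually_mem_slice (T := T) (s := s) (t₀ := t₀) (x₀ := x₀)
  refine ⟨fun n => ?_, fun k => ?_⟩
  · filter_upwards [h.contDiff n, huv, h1, h2] with p hp hp0 hp1 hp2
    exact hp.congr_of_eventuallyEq hp1 hp0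
  · have h3 : ∀ᶠ p in 𝓝[univ ×ˢ s] (t₀, x₀),
        iteratedFDerivWithin ℝ k (v p.1) s p.2 = iteratedFDerivWithin ℝ k (u p.1) s p.2 := by
      filter_upwards [huv, h1, h2] with p hp0 hp1 hp2
      exact Filter.EventuallyEq.iteratedFDerivWithin_eq hp1 hp0 k
    exact (h.cont k).congr_of_eventuallyEq h3 (h3.self_of_nhdsWithin ⟨mem_univ _, hx⟩)

/-- Derivatives within a set see only its germ. This is what allows a statement on a shorter segment
`[0, a²]` to be used on `[0,1]` away from the new endpoint. -/
theorem congr_set {s' : Set E} (h : JetCont u s t₀ x₀) (hs : s =ᶠ[𝓝 x₀] s') :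
    JetCont u s' t₀ x₀ := by
  have h1 : ∀ᶠ p : T × E in 𝓝 (t₀, x₀), s =ᶠ[𝓝 p.2] s' :=
    (continuousAt_snd : ContinuousAt Prod.snd (t₀, x₀)).eventually
      (p := fun y => s =ᶠ[𝓝 y] s') hs.eventuallyEq_nhds
  have h2 : 𝓝[univ ×ˢ s'] (t₀, x₀) = 𝓝[univ ×ˢ s] (t₀, x₀) := by
    rw [nhdsWithin_prod_eq, nhdsWithin_prod_eq, nhdsWithin_eq_iff_eventuallyEq.2 hs]
  refine ⟨fun n => ?_, fun k => ?_⟩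
  · rw [h2]
    filter_upwards [h.contDiff n, mem_nhdsWithin_of_mem_nhds h1] with p hp hp1
    exact hp.congr_set hp1
  · have h3 := h.cont k
    unfold ContinuousWithinAt at h3 ⊢
    rw [h2]
    simp only [← iteratedFDerivWithin_congr_set hs] at h3 ⊢
    refine h3.congr' ?_
    filter_upwards [mem_nhdsWithin_of_mem_nhds h1] with p hp
    exact iteratedFDerivWithin_congr_set hp k

theorem comp_param (h : JetCont u s t₀ x₀) {a : T' → T} {t' : T'} (ha : ContinuousAt a t')
    (hat : a t' = t₀) : JetCont (fun t => u (a t)) s t' x₀ := by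
  subst hat
  have : Filter.Tendsto (fun p : T' × E => (a p.1, p.2)) (𝓝[univ ×ˢ s] (t', x₀))
      (𝓝[univ ×ˢ s] (a t', x₀)) := by
    refine tendsto_nhdsWithin_iff.2 ⟨?_, eventually_mem_nhdsWithin.mono fun y hy => hy⟩
    exact ((ha.comp continuousAt_fst).prodMk continuousAt_snd).continuousWithinAt
  exact ⟨fun n => this.eventually (h.contDiff n), fun k => (h.cont k).tendsto.comp this⟩

theorem of_contDiffWithinAt {f : E → F} (hs : UniqueDiffOn ℝ s) (hx : x₀ ∈ s)
    (hf : ContDiffWithinAt ℝ ∞ f s x₀) : JetCont (fun _ : T => f) s t₀ x₀ := by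
  have : Filter.Tendsto (fun p : T × E => p.2) (𝓝[univ ×ˢ s] (t₀, x₀)) (𝓝[s] x₀) := by
    rw [nhdsWithin_prod_eq]
    exact Filter.tendsto_snd
  refine ⟨fun n => ?_, fun k => ?_⟩
  · have h1 : ∀ᶠ y in 𝓝[s] x₀, ContDiffWithinAt ℝ n f s y := by
      have := (hf.of_le (m := n) (by exact_mod_cast le_top)).eventually (by simp)
      rwa [insert_eq_of_mem hx] at this
    exact this.eventually h1
  · exact (hf.continuousWithinAt_iteratedFDerivWithin hs
      (by exact_mod_cast le_top) hx).tendsto.comp this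

theorem of_continuousAt {a : T → F} (ha : ContinuousAt a t₀) :
    JetCont (fun t _ => a t) s t₀ x₀ := by
  refine ⟨fun n => Filter.Eventually.of_forall fun p => contDiffWithinAt_const, fun k => ?_⟩
  rcases k with _ | k
  · have : ContinuousAt (fun p : T × E => a p.1) (t₀, x₀) := ha.comp continuousAt_fst
    have h := ((continuousMultilinearCurryFin0 ℝ E F).symm.continuous.continuousAt.comp this)
    refine h.continuousWithinAt.congr (fun p _ => ?_) ?_ <;> ext <;> simp
  · simp only [iteratedFDerivWithin_succ_const]
    exact continuousWithinAt_const

theorem prodMk {v : T → E → G} (hu : JetCont u s t₀ x₀) (hv : JetCont v s t₀ x₀)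
    (hs : UniqueDiffOn ℝ s) (hx : x₀ ∈ s) : JetCont (fun t x => (u t x, v t x)) s t₀ x₀ := by
  have h2 := eventually_mem_slice (T := T) (s := s) (t₀ := t₀) (x₀ := x₀)
  refine ⟨fun n => ?_, fun k => ?_⟩
  · filter_upwards [hu.contDiff n, hv.contDiff n] with p h1 h2 using h1.prodMk h2
  · have h3 : ∀ᶠ p in 𝓝[univ ×ˢ s] (t₀, x₀),
        iteratedFDerivWithin ℝ k (fun x => (u p.1 x, v p.1 x)) s p.2 =
          (iteratedFDerivWithin ℝ k (u p.1) s p.2).prod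
            (iteratedFDerivWithin ℝ k (v p.1) s p.2) := by
      filter_upwards [hu.contDiff k, hv.contDiff k, h2] with p h1 h2 h3
      exact iteratedFDerivWithin_prodMk h1 h2 hs h3 le_rfl
    have h4 := (ContinuousMultilinearMap.prodL ℝ (fun _ : Fin k => E) F G).continuous.continuousAt
      |>.comp_continuousWithinAt ((hu.cont k).prodMk (hv.cont k))
    exact h4.congr_of_eventuallyEq h3 (h3.self_of_nhdsWithin ⟨mem_univ _, hx⟩)

/-- By the formula of Faà di Bruno, the `k`-th derivative of the composite is a finite sum over
ordered partitions. Each summand is a continuous multilinear expression in the derivatives of `v t`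
at `u t x` and those of `u t` at `x`. The differentiability clause of `JetCont` is what makes the
formula valid at all nearby parameters and points. -/
theorem comp {v : T → F → G} {s' : Set F} (hv : JetCont v s' t₀ (u t₀ x₀))
    (hu : JetCont u s t₀ x₀) (hs : UniqueDiffOn ℝ s) (hs' : UniqueDiffOn ℝ s') (hx : x₀ ∈ s)
    (hm : ∀ᶠ p in 𝓝[univ ×ˢ s] (t₀, x₀), u p.1 p.2 ∈ s') :
    JetCont (fun t x => v t (u t x)) s t₀ x₀ := by
  have h2 := eventually_mem_slice (T := T) (s := s) (t₀ := t₀) (x₀ := x₀)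
  have hm' := eventually_slice hm
  have htend : Filter.Tendsto (fun p : T × E => (p.1, u p.1 p.2)) (𝓝[univ ×ˢ s] (t₀, x₀))
      (𝓝[univ ×ˢ s'] (t₀, u t₀ x₀)) :=
    tendsto_nhdsWithin_iff.2
      ⟨continuousAt_fst.continuousWithinAt.prodMk hu.continuousWithinAt,
        hm.mono fun p hp => ⟨mem_univ _, hp⟩⟩
  refine ⟨fun n => ?_, fun k => ?_⟩
  · filter_upwards [hu.contDiff n, htend.eventually (hv.contDiff n), hm', h2] with p h1 h2 h3 h4
    exact h2.comp_of_preimage_mem_nhdsWithin p.2 h1 h3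
  · have h3 : ∀ᶠ p in 𝓝[univ ×ˢ s] (t₀, x₀),
        iteratedFDerivWithin ℝ k (fun x => v p.1 (u p.1 x)) s p.2 =
          (ftaylorSeriesWithin ℝ (v p.1) s' (u p.1 p.2)).taylorComp
            (ftaylorSeriesWithin ℝ (u p.1) s p.2) k := by
      filter_upwards [hu.contDiff k, htend.eventually (hv.contDiff k), hm', h2] with p h1 h2 h3 h4
      exact iteratedFDerivWithin_comp_of_eventually_mem h2 h1 hs' hs h4 h3 le_rfl
    refine ContinuousWithinAt.congr_of_eventuallyEq ?_ h3
      (h3.self_of_nhdsWithin ⟨mem_univ _, hx⟩)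
    unfold FormalMultilinearSeries.taylorComp
    refine tendsto_finsetSum _ fun c _ => ?_
    have e1 : ContinuousWithinAt (fun p : T × E =>
        c.compAlongOrderedFinpartitionL ℝ E F G
          (iteratedFDerivWithin ℝ c.length (v p.1) s' (u p.1 p.2))) (univ ×ˢ s) (t₀, x₀) :=
      (c.compAlongOrderedFinpartitionL ℝ E F G).continuous.continuousAt.comp_continuousWithinAt
        (Filter.Tendsto.comp (hv.cont c.length) htend)
    have e2 : ContinuousWithinAt (fun p : T × E => fun m =>
        iteratedFDerivWithin ℝ (c.partSize m) (u p.1) s p.2) (univ ×ˢ s) (t₀, x₀) :=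
      continuousWithinAt_pi.2 fun m => hu.cont _
    exact e1.eval e2

theorem contDiffWithinAt (h : JetCont u s t₀ x₀) (hx : x₀ ∈ s) :
    ContDiffWithinAt ℝ ∞ (u t₀) s x₀ :=
  contDiffWithinAt_infty.2 fun n => (h.contDiff n).self_of_nhdsWithin ⟨mem_univ _, hx⟩

/-- Composition with a smooth map. -/
theorem comp_left {g : F → G} {s' : Set F}
    (hu : JetCont u s t₀ x₀) (hg : ContDiffWithinAt ℝ ∞ g s' (u t₀ x₀))
    (hs : UniqueDiffOn ℝ s) (hs' : UniqueDiffOn ℝ s') (hx : x₀ ∈ s)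
    (hm : ∀ᶠ p in 𝓝[univ ×ˢ s] (t₀, x₀), u p.1 p.2 ∈ s') :
    JetCont (fun t x => g (u t x)) s t₀ x₀ :=
  JetCont.comp (v := fun _ => g)
    (of_contDiffWithinAt hs' (hm.self_of_nhdsWithin ⟨mem_univ _, hx⟩) hg) hu hs hs' hx hm

theorem comp_contDiffAt {g : F → G} (hu : JetCont u s t₀ x₀) (hg : ContDiffAt ℝ ∞ g (u t₀ x₀))
    (hs : UniqueDiffOn ℝ s) (hx : x₀ ∈ s) :
    JetCont (fun t x => g (u t x)) s t₀ x₀ :=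
  hu.comp_left (s' := univ) hg.contDiffWithinAt hs uniqueDiffOn_univ hx (by simp)

theorem smul {c : T → E → ℝ} (hc : JetCont c s t₀ x₀) (hu : JetCont u s t₀ x₀)
    (hs : UniqueDiffOn ℝ s) (hx : x₀ ∈ s) : JetCont (fun t x => c t x • u t x) s t₀ x₀ :=
  (hc.prodMk hu hs hx).comp_contDiffAt (g := fun p : ℝ × F => p.1 • p.2)
    (contDiff_fst.smul contDiff_snd).contDiffAt hs hx

theorem add {v : T → E → F} (hu : JetCont u s t₀ x₀) (hv : JetCont v s t₀ x₀)
    (hs : UniqueDiffOn ℝ s) (hx : x₀ ∈ s) : JetCont (fun t x => u t x + v t x) s t₀ x₀ :=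
  (hu.prodMk hv hs hx).comp_contDiffAt (g := fun p : F × F => p.1 + p.2)
    (contDiff_fst.add contDiff_snd).contDiffAt hs hx

end JetCont

end JetCont


/-! ### Families of functions on a segment -/

section Jets

variable {T : Type*} [TopologicalSpace T]

/-- `w k t` is the `k`-th derivative of `w 0 t` on `[0,a]` and depends continuously on `t`. -/
structure IsJets (a : ℝ) (w : ℕ → T → ℝ → ℝ) : Prop where
  deriv : ∀ k t, ∀ s ∈ Icc 0 a, HasDerivWithinAt (w k t) (w (k + 1) t s) (Icc 0 a) s
  cont : ∀ k, ContinuousOn (fun p : T × ℝ => w k p.1 p.2) (univ ×ˢ Icc 0 a)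

/-- `JetCont` at all points. -/
def JetContOn {E F : Type*} [NormedAddCommGroup E] [NormedSpace ℝ E] [NormedAddCommGroup F]
    [NormedSpace ℝ F] (u : T → E → F) (s : Set E) : Prop :=
  ∀ t₀, ∀ x₀ ∈ s, JetCont u s t₀ x₀

theorem IsJets.continuousOn_apply {a : ℝ} {w : ℕ → T → ℝ → ℝ} (h : IsJets a w) (k : ℕ) (t : T) :
    ContinuousOn (w k t) (Icc 0 a) := fun s hs => (h.deriv k t s hs).continuousWithinAt

theorem IsJets.iteratedDerivWithin_eq {a : ℝ} (ha : 0 < a) {w : ℕ → T → ℝ → ℝ} (h : IsJets a w)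
    (k : ℕ) (t : T) {s : ℝ} (hs : s ∈ Icc 0 a) :
    iteratedDerivWithin k (w 0 t) (Icc 0 a) s = w k t s := by
  induction k generalizing s with
  | zero => simp
  | succ k ih =>
    rw [iteratedDerivWithin_succ, derivWithin_congr (fun y hy => ih hy) (ih hs)]
    exact (h.deriv k t s hs).derivWithin (uniqueDiffOn_Icc ha s hs)

theorem IsJets.contDiffOn {a : ℝ} (ha : 0 < a) {w : ℕ → T → ℝ → ℝ} (h : IsJets a w) (t : T) :
    ContDiffOn ℝ ∞ (w 0 t) (Icc 0 a) := by
  refine contDiffOn_of_differentiableOn_deriv fun m _ => ?_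
  intro s hs
  exact ((h.deriv m t s hs).differentiableWithinAt).congr
    (fun y hy => h.iteratedDerivWithin_eq ha m t hy) (h.iteratedDerivWithin_eq ha m t hs)

/-- A `k`-linear form on the line is a single number, so a tower of one-variable derivatives
contains the full jet. Families on segments are thus treated by exhibiting explicit candidates for
all derivatives. -/
theorem IsJets.jetContOn {a : ℝ} (ha : 0 < a) {w : ℕ → T → ℝ → ℝ} (h : IsJets a w) :
    JetContOn (w 0) (Icc 0 a) := by
  intro t₀ s₀ hs₀
  refine ⟨fun n => ?_, fun k => ?_⟩
  · filter_upwards [eventually_mem_slice] with p hp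
    exact (h.contDiffOn ha p.1 p.2 hp).of_le (by exact_mod_cast le_top)
  · have h1 := (ContinuousMultilinearMap.piFieldEquiv ℝ (Fin k) ℝ).continuous.continuousAt
      |>.comp_continuousWithinAt (h.cont k (t₀, s₀) ⟨mem_univ _, hs₀⟩)
    have h2 : ∀ p : T × ℝ, p.2 ∈ Icc 0 a → iteratedFDerivWithin ℝ k (w 0 p.1) (Icc 0 a) p.2 =
        ContinuousMultilinearMap.piFieldEquiv ℝ (Fin k) ℝ (w k p.1 p.2) := fun p hp => by
      rw [iteratedFDerivWithin_eq_equiv_comp, Function.comp_apply,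
        h.iteratedDerivWithin_eq ha k p.1 hp]
    exact h1.congr (fun p hp => h2 p hp.2) (h2 _ hs₀)

theorem JetContOn.continuousOn {E F : Type*} [NormedAddCommGroup E] [NormedSpace ℝ E]
    [NormedAddCommGroup F] [NormedSpace ℝ F] {u : T → E → F} {s : Set E} (h : JetContOn u s) :
    ContinuousOn (fun p : T × E => u p.1 p.2) (univ ×ˢ s) :=
  fun p hp => (h p.1 p.2 hp.2).continuousWithinAt

theorem JetContOn.contDiffOn {E F : Type*} [NormedAddCommGroup E] [NormedSpace ℝ E]
    [NormedAddCommGroup F] [NormedSpace ℝ F] {u : T → E → F} {s : Set E} (h : JetContOn u s)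
    (t : T) : ContDiffOn ℝ ∞ (u t) s :=
  fun x hx => (h t x hx).contDiffWithinAt hx

theorem JetContOn.continuousOn_iteratedDerivWithin {u : T → ℝ → ℝ} {s : Set ℝ}
    (h : JetContOn u s) (k : ℕ) :
    ContinuousOn (fun p : T × ℝ => iteratedDerivWithin k (u p.1) s p.2) (univ ×ˢ s) := by
  intro p hp
  have h1 := (ContinuousMultilinearMap.piFieldEquiv ℝ (Fin k) ℝ).symm.continuous.continuousAt
    |>.comp_continuousWithinAt ((h p.1 p.2 hp.2).cont k)
  refine h1.congr (fun p hp => ?_) ?_ <;> rw [iteratedDerivWithin_eq_equiv_comp] <;> rfl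

theorem JetContOn.isJets {a : ℝ} (ha : 0 < a) {u : T → ℝ → ℝ} (h : JetContOn u (Icc 0 a)) :
    IsJets a (fun k t => iteratedDerivWithin k (u t) (Icc 0 a)) := by
  refine ⟨fun k t s hs => ?_, h.continuousOn_iteratedDerivWithin⟩
  rw [iteratedDerivWithin_succ]
  refine DifferentiableWithinAt.hasDerivWithinAt ?_
  exact (h.contDiffOn t).differentiableOn_iteratedDerivWithin (by exact_mod_cast ENat.natCast_lt_top k)
    (uniqueDiffOn_Icc ha) s hs

theorem IsJets.tail {a : ℝ} {w : ℕ → T → ℝ → ℝ} (h : IsJets a w) (m : ℕ) :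
    IsJets a (fun k => w (k + m)) :=
  ⟨fun k t s hs => by
    have := h.deriv (k + m) t s hs
    rwa [show k + m + 1 = k + 1 + m by ring] at this, fun k => h.cont _⟩

theorem JetContOn.derivWithin {a : ℝ} (ha : 0 < a) {u : T → ℝ → ℝ} (h : JetContOn u (Icc 0 a)) :
    JetContOn (fun t => derivWithin (u t) (Icc 0 a)) (Icc 0 a) := by
  have := ((h.isJets ha).tail 1).jetContOn ha
  simpa only [zero_add, iteratedDerivWithin_one] using this

theorem JetContOn.congr {E F : Type*} [NormedAddCommGroup E] [NormedSpace ℝ E]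
    [NormedAddCommGroup F] [NormedSpace ℝ F] {u v : T → E → F} {s : Set E} (h : JetContOn u s)
    (huv : ∀ t, ∀ x ∈ s, v t x = u t x) : JetContOn v s := fun t x hx =>
  (h t x hx).congr hx (eventually_mem_slice.mono fun p hp => huv p.1 p.2 hp)

theorem JetContOn.hasDerivWithinAt {a : ℝ} {u : T → ℝ → ℝ}
    (h : JetContOn u (Icc 0 a)) (t : T) {s : ℝ} (hs : s ∈ Icc 0 a) :
    HasDerivWithinAt (u t) (_root_.derivWithin (u t) (Icc 0 a) s) (Icc 0 a) s :=
  (((h.contDiffOn t).differentiableOn (by simp)) s hs).hasDerivWithinAt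

/-! ### Averages along segments -/

/-- A primitive on the line of the extension by constants of a continuous derivative. -/
theorem exists_hasDerivAt_extension {a : ℝ} (ha : 0 ≤ a) {w w' : ℝ → ℝ}
    (hw : ∀ s ∈ Icc 0 a, HasDerivWithinAt w (w' s) (Icc 0 a) s) (hc : ContinuousOn w' (Icc 0 a)) :
    ∃ v v' : ℝ → ℝ, Continuous v' ∧ (∃ C, ∀ s, |v' s| ≤ C) ∧ (∀ s, HasDerivAt v (v' s) s) ∧
      ∀ s ∈ Icc 0 a, v s = w s ∧ v' s = w' s := by
  set v' : ℝ → ℝ := fun s => w' (projIcc 0 a ha s) with hv'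
  have hcont : Continuous v' :=
    hc.comp_continuous (continuous_subtype_val.comp continuous_projIcc) fun s => (projIcc 0 a ha s).2
  have heq : ∀ s ∈ Icc 0 a, v' s = w' s := fun s hs => by rw [hv']; simp [projIcc_of_mem ha hs]
  have hd : ∀ s, HasDerivAt (fun s => w 0 + ∫ r in (0 : ℝ)..s, v' r) (v' s) s := fun s =>
    (intervalIntegral.integral_hasDerivAt_right (hcont.intervalIntegrable _ _)
      (hcont.stronglyMeasurableAtFilter _ _) hcont.continuousAt).const_add _
  refine ⟨_, v', hcont, ?_, hd, fun s hs => ⟨?_, heq s hs⟩⟩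
  · obtain ⟨C, hC⟩ := isCompact_Icc.exists_bound_of_continuousOn hc
    exact ⟨C, fun s => hC _ (projIcc 0 a ha s).2⟩
  · have h0 : ∫ r in (0 : ℝ)..s, v' r = w s - w 0 := by
      refine intervalIntegral.integral_eq_sub_of_hasDerivAt_of_le hs.1 ?_ ?_
        (hcont.intervalIntegrable _ _)
      · exact fun x hx => ((hw x ⟨hx.1, hx.2.trans hs.2⟩).continuousWithinAt).mono
          (Icc_subset_Icc_right hs.2)
      · intro x hx
        have hx' : x ∈ Icc 0 a := ⟨hx.1.le, (hx.2.trans_le hs.2).le⟩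
        rw [heq x hx']
        exact (hw x hx').hasDerivAt (Icc_mem_nhds hx.1 (hx.2.trans_le hs.2))
    simp [h0]

theorem scale_mem_Icc {a s u : ℝ} (hs : s ∈ Icc 0 a) (hu : u ∈ Icc (0 : ℝ) 1) :
    u * s ∈ Icc 0 a :=
  ⟨mul_nonneg hu.1 hs.1, (mul_le_of_le_one_left hs.1 hu.2).trans hs.2⟩

/-- Differentiation under the integral sign. Replacing `w` by a function differentiable on the whole
line with bounded continuous derivative removes the special role of the endpoints, and the bound is
the dominating constant. -/
theorem hasDerivWithinAt_integral_scale {a : ℝ} (ha : 0 ≤ a) {w w' : ℝ → ℝ}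
    (hw : ∀ s ∈ Icc 0 a, HasDerivWithinAt w (w' s) (Icc 0 a) s) (hc : ContinuousOn w' (Icc 0 a))
    (k : ℕ) {s : ℝ} (hs : s ∈ Icc 0 a) :
    HasDerivWithinAt (fun s => ∫ u in (0 : ℝ)..1, u ^ k * w (u * s))
      (∫ u in (0 : ℝ)..1, u ^ (k + 1) * w' (u * s)) (Icc 0 a) s := by
  obtain ⟨v, v', hv'c, ⟨C, hC⟩, hd, heq⟩ := exists_hasDerivAt_extension ha hw hc
  have hvc : Continuous v := continuous_iff_continuousAt.2 fun s => (hd s).continuousAt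
  have key := (intervalIntegral.hasDerivAt_integral_of_dominated_loc_of_deriv_le
    (μ := MeasureTheory.volume) (a := 0) (b := 1) (F := fun x u : ℝ => u ^ k * v (u * x))
    (F' := fun x u : ℝ => u ^ k * (v' (u * x) * u)) (x₀ := s) (bound := fun _ => C)
    (s := univ) Filter.univ_mem
    (Filter.Eventually.of_forall fun x => (by fun_prop : Continuous _).aestronglyMeasurable)
    ((by fun_prop : Continuous _).intervalIntegrable _ _)
    ((by fun_prop : Continuous _).aestronglyMeasurable) ?_ (by simp) ?_).2
  · have e1 : (∫ u in (0 : ℝ)..1, u ^ k * (v' (u * s) * u)) =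
        ∫ u in (0 : ℝ)..1, u ^ (k + 1) * w' (u * s) := by
      refine intervalIntegral.integral_congr fun u hu => ?_
      rw [uIcc_of_le zero_le_one] at hu
      simp only [(heq _ (scale_mem_Icc hs hu)).2]
      ring
    have e2 : ∀ x ∈ Icc 0 a, (∫ u in (0 : ℝ)..1, u ^ k * w (u * x)) =
        ∫ u in (0 : ℝ)..1, u ^ k * v (u * x) := fun x hx => by
      refine intervalIntegral.integral_congr fun u hu => ?_
      rw [uIcc_of_le zero_le_one] at hu
      simp only [(heq _ (scale_mem_Icc hx hu)).1]
    rw [e1] at key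
    exact key.hasDerivWithinAt.congr e2 (e2 s hs)
  · refine Filter.Eventually.of_forall fun u hu x _ => ?_
    rw [uIoc_of_le zero_le_one] at hu
    have hu1 : |u| ≤ 1 := by rw [abs_of_pos hu.1]; exact hu.2
    rw [norm_mul, norm_mul, norm_pow, Real.norm_eq_abs, Real.norm_eq_abs]
    have h1 : |u| ^ k ≤ 1 := pow_le_one₀ (abs_nonneg _) hu1
    have h2 := hC (u * x)
    have h3 := abs_nonneg (v' (u * x))
    calc |u| ^ k * (|v' (u * x)| * |u|) ≤ 1 * (|v' (u * x)| * 1) := by gcongr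
      _ ≤ C := by simpa using h2
  · refine Filter.Eventually.of_forall fun u _ x _ => ?_
    have := (hd (u * x)).comp x ((hasDerivAt_id x).const_mul u)
    simpa using this.const_mul (u ^ k)

/-- Hadamard's lemma: `s w'(us)` is the derivative of `w(us)` in `u`, and the fundamental theorem
applies on `[0,1]`. -/
theorem mul_integral_scale {a : ℝ} (ha : 0 ≤ a) {w w' : ℝ → ℝ}
    (hw : ∀ s ∈ Icc 0 a, HasDerivWithinAt w (w' s) (Icc 0 a) s) (hc : ContinuousOn w' (Icc 0 a))
    {s : ℝ} (hs : s ∈ Icc 0 a) : s * ∫ u in (0 : ℝ)..1, w' (u * s) = w s - w 0 := by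
  obtain ⟨v, v', hv'c, -, hd, heq⟩ := exists_hasDerivAt_extension ha hw hc
  have e1 : (∫ u in (0 : ℝ)..1, w' (u * s)) = ∫ u in (0 : ℝ)..1, v' (u * s) := by
    refine intervalIntegral.integral_congr fun u hu => ?_
    rw [uIcc_of_le zero_le_one] at hu
    exact ((heq _ (scale_mem_Icc hs hu)).2).symm
  have e2 : ∫ u in (0 : ℝ)..1, v' (u * s) * s = v (1 * s) - v (0 * s) := by
    refine intervalIntegral.integral_eq_sub_of_hasDerivAt (f := fun u => v (u * s)) (fun u _ => ?_)
      ((by fun_prop : Continuous _).intervalIntegrable _ _)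
    have := (hd (u * s)).comp u ((hasDerivAt_id u).mul_const s)
    rw [one_mul] at this
    exact this
  rw [e1, mul_comm, ← intervalIntegral.integral_mul_const, e2, one_mul, zero_mul,
    (heq s hs).1, (heq 0 ⟨le_rfl, ha⟩).1]

/-- Each differentiation in `s` under the integral produces one factor `u`, whence `u ^ k` at order
`k`. -/
theorem IsJets.integral {a : ℝ} (ha : 0 ≤ a) {w : ℕ → T → ℝ → ℝ} (h : IsJets a w) :
    IsJets a (fun k t s => ∫ u in (0 : ℝ)..1, u ^ k * w k t (u * s)) := by
  refine ⟨fun k t s hs => hasDerivWithinAt_integral_scale ha (h.deriv k t)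
    (h.continuousOn_apply (k + 1) t) k hs, fun k => ?_⟩
  rw [continuousOn_iff_continuous_domRestrict]
  -- Clamping `u` to `[0,1]` keeps the argument in the domain for every real `u`, so the integrand
  -- becomes jointly continuous for all `u`. The integral over `[0,1]` is unchanged.
  have hX : ∀ (x : ↥((univ : Set T) ×ˢ Icc (0 : ℝ) a)) (u : ℝ), (x.1.1, (projIcc (0 : ℝ) 1 zero_le_one u : ℝ) * x.1.2) ∈
      (univ : Set T) ×ˢ Icc (0 : ℝ) a := fun x u =>
    ⟨mem_univ _, scale_mem_Icc x.2.2 (projIcc (0 : ℝ) 1 zero_le_one u).2⟩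
  have hc : Continuous (Function.uncurry fun (x : ↥((univ : Set T) ×ˢ Icc (0 : ℝ) a)) (u : ℝ) =>
      u ^ k * w k x.1.1 ((projIcc (0 : ℝ) 1 zero_le_one u : ℝ) * x.1.2)) := by
    refine Continuous.mul (by fun_prop) ?_
    refine (h.cont k).comp_continuous (f := fun p : ↥((univ : Set T) ×ˢ Icc (0 : ℝ) a) × ℝ =>
      (p.1.1.1, (projIcc (0 : ℝ) 1 zero_le_one p.2 : ℝ) * p.1.1.2)) ?_ fun p => hX p.1 p.2
    have : Continuous fun p : ↥((univ : Set T) ×ˢ Icc (0 : ℝ) a) × ℝ => (projIcc (0 : ℝ) 1 zero_le_one p.2 : ℝ) :=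
      continuous_subtype_val.comp (continuous_projIcc.comp continuous_snd)
    fun_prop
  have := intervalIntegral.continuous_parametric_intervalIntegral_of_continuous'
    (μ := MeasureTheory.volume) hc 0 1
  refine this.congr fun x => ?_
  refine intervalIntegral.integral_congr fun u hu => ?_
  rw [uIcc_of_le zero_le_one] at hu
  simp [projIcc_of_mem zero_le_one hu]

/-! ### Even functions are smooth functions of the square -/

/-- The operator that maps the derivatives of `g` to those of `s ↦ g'(s) / 2s`, for even `g`. -/
def sqOp (w : ℕ → T → ℝ → ℝ) : ℕ → T → ℝ → ℝ :=
  fun k t s => (1 / 2) * ∫ u in (0 : ℝ)..1, u ^ k * w (k + 2) t (u * s)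

theorem IsJets.sqOp {a : ℝ} (ha : 0 ≤ a) {w : ℕ → T → ℝ → ℝ} (h : IsJets a w) :
    IsJets a (sqOp w) := by
  have h1 := (h.tail 2).integral ha
  exact ⟨fun k t s hs => (h1.deriv k t s hs).const_mul _, fun k => (h1.cont k).const_smul (1 / 2 : ℝ)⟩

/-- The operator shifts orders by two, which preserves parity; the hypothesis on odd derivatives
therefore survives iteration. -/
theorem sqOp_odd {T : Type*} {w : ℕ → T → ℝ → ℝ} (hodd : ∀ k, Odd k → ∀ t, w k t 0 = 0) :
    ∀ k, Odd k → ∀ t, sqOp w k t 0 = 0 := fun k hk t => by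
  simp [sqOp, hodd (k + 2) (hk.add_even even_two) t]

/-- Hadamard's lemma applied to the first derivative, which vanishes at 0 because its order is odd.
-/
theorem IsJets.two_mul_sqOp {a : ℝ} (ha : 0 ≤ a) {w : ℕ → T → ℝ → ℝ} (h : IsJets a w)
    (hodd : ∀ k, Odd k → ∀ t, w k t 0 = 0) (t : T) {s : ℝ} (hs : s ∈ Icc 0 a) :
    2 * s * FolDiff.sqOp w 0 t s = w 1 t s := by
  have := mul_integral_scale ha (h.deriv 1 t) (h.continuousOn_apply 2 t) hs
  rw [hodd 1 odd_one t, sub_zero] at this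
  rw [← this]
  simp only [FolDiff.sqOp, pow_zero, one_mul]
  ring

theorem sqrt_mem_Icc {a τ : ℝ} (ha : 0 ≤ a) (hτ : τ ∈ Icc 0 (a ^ 2)) : √τ ∈ Icc 0 a :=
  ⟨Real.sqrt_nonneg _, Real.sqrt_le_iff.2 ⟨ha, hτ.2⟩⟩

theorem IsJets.hasDerivWithinAt_sqrt {a : ℝ} (ha : 0 < a) {w : ℕ → T → ℝ → ℝ} (h : IsJets a w)
    (hodd : ∀ k, Odd k → ∀ t, w k t 0 = 0) (t : T) {τ : ℝ} (hτ : τ ∈ Icc 0 (a ^ 2)) :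
    HasDerivWithinAt (fun τ => w 0 t √τ) (FolDiff.sqOp w 0 t √τ) (Icc 0 (a ^ 2)) τ := by
  have hmaps : MapsTo Real.sqrt (Icc 0 (a ^ 2)) (Icc 0 a) := fun x hx => sqrt_mem_Icc ha.le hx
  have pos : ∀ x ∈ Icc 0 (a ^ 2), 0 < x →
      HasDerivWithinAt (fun τ => w 0 t √τ) (FolDiff.sqOp w 0 t √x) (Icc 0 (a ^ 2)) x := by
    intro x hx hx0
    have h1 := (h.deriv 0 t _ (hmaps hx)).comp x
      (Real.hasDerivAt_sqrt hx0.ne').hasDerivWithinAt hmaps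
    have h2 := h.two_mul_sqOp ha.le hodd t (hmaps hx)
    refine h1.congr_deriv ?_
    have h3 : √x ≠ 0 := (Real.sqrt_pos.2 hx0).ne'
    rw [zero_add, ← h2]
    field_simp
  -- The chain rule fails at `τ = 0`, where the square root is not differentiable. There the
  -- derivative computed for `τ > 0` has a limit, and a continuous function whose derivative has a
  -- one-sided limit is differentiable from that side with this value.
  rcases hτ.1.eq_or_lt with h0 | h0
  · subst h0
    have hsub : Ioo 0 (a ^ 2) ⊆ Icc 0 (a ^ 2) := Ioo_subset_Icc_self
    have hnhds : Ioo 0 (a ^ 2) ∈ 𝓝[>] (0 : ℝ) := Ioo_mem_nhdsGT (by positivity)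
    have hd : ∀ x ∈ Ioo 0 (a ^ 2), HasDerivAt (fun τ => w 0 t √τ) (FolDiff.sqOp w 0 t √x) x :=
      fun x hx => (pos x (hsub hx) hx.1).hasDerivAt (Icc_mem_nhds hx.1 hx.2)
    have hA : ContinuousWithinAt (fun x => FolDiff.sqOp w 0 t √x) (Icc 0 (a ^ 2)) 0 := by
      refine ContinuousWithinAt.comp (g := FolDiff.sqOp w 0 t) (t := Icc 0 a) ?_
        Real.continuous_sqrt.continuousWithinAt hmaps
      exact (h.sqOp ha.le).continuousOn_apply 0 t _ (hmaps hτ)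
    refine (hasDerivWithinAt_Ici_of_tendsto_deriv (s := Ioo 0 (a ^ 2)) ?_ ?_ hnhds ?_).mono
      Icc_subset_Ici_self
    · exact fun x hx => (hd x hx).differentiableAt.differentiableWithinAt
    · refine ContinuousWithinAt.mono (t := Icc 0 (a ^ 2)) ?_ hsub
      refine ContinuousWithinAt.comp (t := Icc 0 a) ?_ Real.continuous_sqrt.continuousWithinAt hmaps
      exact h.continuousOn_apply 0 t _ (hmaps hτ)
    · refine Filter.Tendsto.congr' (f₁ := fun x => FolDiff.sqOp w 0 t √x) ?_ ?_
      · filter_upwards [hnhds] with x hx using (hd x hx).deriv.symm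
      · refine hA.tendsto.mono_left ?_
        rw [← nhdsWithin_Ioo_eq_nhdsGT (show (0 : ℝ) < a ^ 2 by positivity)]
        exact nhdsWithin_mono _ hsub
  · exact pos τ hτ h0

/-- Whitney's theorem on even functions, with parameters. The derivative of `g ∘ √` is `(g'(s)/2s) ∘
√`, and `g'(s)/2s` again has vanishing odd derivatives at 0. The `k`-th derivative is therefore the
`k`-th iterate of `sqOp` taken at `√τ`. -/
theorem IsJets.comp_sqrt {a : ℝ} (ha : 0 < a) {w : ℕ → T → ℝ → ℝ} (h : IsJets a w)
    (hodd : ∀ k, Odd k → ∀ t, w k t 0 = 0) :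
    IsJets (a ^ 2) (fun k t τ => (FolDiff.sqOp^[k] w) 0 t √τ) := by
  have hk : ∀ k, IsJets a (FolDiff.sqOp^[k] w) ∧
      ∀ j, Odd j → ∀ t, (FolDiff.sqOp^[k] w) j t 0 = 0 := by
    intro k
    induction k with
    | zero => exact ⟨h, hodd⟩
    | succ k ih =>
      rw [Function.iterate_succ_apply']
      exact ⟨ih.1.sqOp ha.le, sqOp_odd ih.2⟩
  refine ⟨fun k t τ hτ => ?_, fun k => ?_⟩
  · rw [Function.iterate_succ_apply']
    exact (hk k).1.hasDerivWithinAt_sqrt ha (hk k).2 t hτ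
  · refine ((hk k).1.cont 0).comp (f := fun p : T × ℝ => (p.1, √p.2)) (by fun_prop) ?_
    exact fun p hp => ⟨mem_univ _, sqrt_mem_Icc ha.le hp.2⟩

/-! ### Inverse functions -/

/-- With `R = 1/u'` the inverse satisfies `ι' = R ∘ ι`, so the derivative of `F ∘ ι` is `(F' R) ∘
ι`. Starting from `F = id`, this recursion writes every derivative of `ι` as a known jointly
continuous function evaluated at `ι`; joint continuity of `ι` itself is all that is needed as input.
-/
theorem jetContOn_inverse {a : ℝ} (ha : 0 < a) {u ι : T → ℝ → ℝ} (hu : JetContOn u (Icc 0 a))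
    (hu' : ∀ t, ∀ s ∈ Icc 0 a, derivWithin (u t) (Icc 0 a) s ≠ 0)
    (hι : ∀ t, MapsTo (ι t) (Icc 0 a) (Icc 0 a)) (hinv : ∀ t, ∀ s ∈ Icc 0 a, u t (ι t s) = s)
    (hc : ContinuousOn (fun p : T × ℝ => ι p.1 p.2) (univ ×ˢ Icc 0 a)) :
    JetContOn ι (Icc 0 a) := by
  have hud := uniqueDiffOn_Icc ha
  let R : T → ℝ → ℝ := fun t s => (derivWithin (u t) (Icc 0 a) s)⁻¹
  have hR : JetContOn R (Icc 0 a) := fun t s hs =>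
    (hu.derivWithin ha t s hs).comp_contDiffAt (g := fun x : ℝ => x⁻¹)
      (contDiffAt_inv ℝ (hu' t s hs)) hud hs
  let Fs : ℕ → T → ℝ → ℝ := fun k => Nat.rec (fun _ x => x)
    (fun _ v t x => derivWithin (v t) (Icc 0 a) x * R t x) k
  have hFs : ∀ k, JetContOn (Fs k) (Icc 0 a) := by
    intro k
    induction k with
    | zero => exact fun t s hs => JetCont.of_contDiffWithinAt hud hs contDiffWithinAt_id
    | succ k ih => exact fun t s hs => (ih.derivWithin ha t s hs).smul (hR t s hs) hud hs
  have hιd : ∀ t, ∀ s ∈ Icc 0 a, HasDerivWithinAt (ι t) (R t (ι t s)) (Icc 0 a) s := by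
    intro t s hs
    have hct : ContinuousWithinAt (ι t) (Icc 0 a) s :=
      ContinuousWithinAt.comp (f := fun s => (t, s)) (hc (t, s) ⟨mem_univ _, hs⟩)
        (by fun_prop) fun y hy => ⟨mem_univ _, hy⟩
    refine HasFDerivWithinAt.of_local_left_inverse (t := Icc 0 a) (f := u t)
      (f' := ContinuousLinearEquiv.unitsEquivAut ℝ (Units.mk0 _ (hu' t _ (hι t hs))))
      (tendsto_nhdsWithin_iff.2 ⟨hct, eventually_mem_nhdsWithin.mono fun y hy => hι t hy⟩)
      (hu.hasDerivWithinAt t (hι t hs)) hs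
      (eventually_mem_nhdsWithin.mono fun y hy => hinv t y hy)
  have hjets : IsJets a (fun k t s => Fs k t (ι t s)) := by
    refine ⟨fun k t s hs => ?_, fun k => ?_⟩
    · exact ((hFs k).hasDerivWithinAt t (hι t hs)).comp s (hιd t s hs) (hι t)
    · exact (hFs k).continuousOn.comp (f := fun p : T × ℝ => (p.1, ι p.1 p.2))
        (continuousOn_fst.prodMk hc) fun p hp => ⟨mem_univ _, hι p.1 hp.2⟩
  exact hjets.jetContOn ha

end Jets


/-! ### Diffeomorphisms of the segment -/

section DiffI

theorem DiffI.extend_coe (φ : DiffI) (s : unitInterval) : φ.extend s = φ s := by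
  simp [DiffI.extend]

theorem DiffI.extend_of_mem (φ : DiffI) {s : ℝ} (hs : s ∈ Icc (0 : ℝ) 1) :
    φ.extend s = φ ⟨s, hs⟩ := by
  simp [DiffI.extend, projIcc_of_mem zero_le_one hs]

theorem DiffI.extend_mem (φ : DiffI) (s : ℝ) : φ.extend s ∈ Icc (0 : ℝ) 1 := (φ _).2

theorem DiffI.extend_mul (φ χ : DiffI) (s : ℝ) : (φ * χ).extend s = φ.extend (χ.extend s) := by
  simp only [DiffI.extend, projIcc_val]
  rfl

theorem DiffI.extend_one {s : ℝ} (hs : s ∈ Icc (0 : ℝ) 1) : (1 : DiffI).extend s = s := by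
  rw [DiffI.extend_of_mem _ hs]
  rfl

theorem DiffI.extend_inv_extend (φ : DiffI) {s : ℝ} (hs : s ∈ Icc (0 : ℝ) 1) :
    φ⁻¹.extend (φ.extend s) = s := by
  rw [← DiffI.extend_mul, inv_mul_cancel, DiffI.extend_one hs]

theorem DiffI.extend_extend_inv (φ : DiffI) {s : ℝ} (hs : s ∈ Icc (0 : ℝ) 1) :
    φ.extend (φ⁻¹.extend s) = s := by
  rw [← DiffI.extend_mul, mul_inv_cancel, DiffI.extend_one hs]

theorem contDiffOn_comp_projIcc_iff {g : unitInterval → ℝ} :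
    ContDiffOn ℝ ∞ (g ∘ projIcc (0 : ℝ) 1 zero_le_one) (Icc 0 1) ↔ ContMDiff (𝓡∂ 1) 𝓘(ℝ) ∞ g := by
  rw [← contMDiffOn_iff_contDiffOn]
  exact contMDiffOn_comp_projIcc_iff

theorem contMDiff_unitInterval_iff {g : unitInterval → unitInterval} :
    ContMDiff (𝓡∂ 1) (𝓡∂ 1) ∞ g ↔
      ContDiffOn ℝ ∞ (fun s => (g (projIcc (0 : ℝ) 1 zero_le_one s) : ℝ)) (Icc 0 1) := by
  have h := contDiffOn_comp_projIcc_iff (g := fun s => (g s : ℝ))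
  rw [show (fun s => (g (projIcc (0 : ℝ) 1 zero_le_one s) : ℝ)) =
    (fun s => (g s : ℝ)) ∘ projIcc (0 : ℝ) 1 zero_le_one from rfl, h]
  constructor
  · intro hg
    exact (contMDiff_subtypeVal_Icc (x := (0 : ℝ)) (y := 1)).comp hg
  · intro hg
    refine (contMDiff_iff_comp_subtypeVal_Icc (x := (0 : ℝ)) (y := 1)).2 ⟨?_, hg⟩
    exact continuous_induced_rng.2 hg.continuous

theorem DiffI.contDiffOn_extend (φ : DiffI) : ContDiffOn ℝ ∞ φ.extend (Icc 0 1) :=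
  contMDiff_unitInterval_iff.1 φ.contMDiff

theorem DiffI.derivWithin_ne_zero (φ : DiffI) {s : ℝ} (hs : s ∈ Icc (0 : ℝ) 1) :
    derivWithin φ.extend (Icc 0 1) s ≠ 0 := by
  intro h0
  have hd : ∀ (χ : DiffI) {s : ℝ}, s ∈ Icc (0 : ℝ) 1 →
      HasDerivWithinAt χ.extend (derivWithin χ.extend (Icc 0 1) s) (Icc 0 1) s := fun χ s hs =>
    ((χ.contDiffOn_extend.differentiableOn (by simp)) s hs).hasDerivWithinAt
  have h1 := (hd φ⁻¹ (φ.extend_mem s)).comp s (hd φ hs) fun x _ => φ.extend_mem x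
  rw [h0, mul_zero] at h1
  have h2 : HasDerivWithinAt (fun x : ℝ => x) 1 (Icc 0 1) s := hasDerivWithinAt_id _ _
  have h3 : HasDerivWithinAt (fun x : ℝ => x) 0 (Icc 0 1) s :=
    h1.congr (fun x hx => (φ.extend_inv_extend hx).symm) (φ.extend_inv_extend hs).symm
  exact zero_ne_one ((uniqueDiffOn_Icc zero_lt_one s hs).eq_deriv _ h3 h2)

theorem DiffI.derivWithin_pos {φ : DiffI} (hφ : φ ∈ diffIPlus) {s : ℝ} (hs : s ∈ Icc (0 : ℝ) 1) :
    0 < derivWithin φ.extend (Icc 0 1) s := by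
  refine lt_of_le_of_ne ?_ (φ.derivWithin_ne_zero hs).symm
  refine MonotoneOn.derivWithin_nonneg fun x hx y hy hxy => ?_
  rw [φ.extend_of_mem hx, φ.extend_of_mem hy]
  exact (show StrictMono φ from hφ).monotone (show (⟨x, hx⟩ : unitInterval) ≤ ⟨y, hy⟩ from hxy)

theorem diffIPlus_zero {φ : DiffI} (hφ : φ ∈ diffIPlus) : φ 0 = 0 := by
  obtain ⟨s, hs⟩ := φ.surjective 0
  exact le_antisymm (((show StrictMono φ from hφ).monotone unitInterval.nonneg').trans_eq hs)
    unitInterval.nonneg'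

theorem diffIPlus_one {φ : DiffI} (hφ : φ ∈ diffIPlus) : φ 1 = 1 := by
  obtain ⟨s, hs⟩ := φ.surjective 1
  exact le_antisymm unitInterval.le_one'
    (hs.symm.trans_le ((show StrictMono φ from hφ).monotone unitInterval.le_one'))

theorem DiffI.strictMono_or_strictAnti (φ : DiffI) : StrictMono φ ∨ StrictAnti φ :=
  Continuous.strictMono_of_inj_boundedOrder' φ.continuous φ.injective

theorem mem_diffIPlus_iff {φ : DiffI} : φ ∈ diffIPlus ↔ φ 0 = 0 := by
  refine ⟨diffIPlus_zero, fun h0 => ?_⟩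
  refine φ.strictMono_or_strictAnti.resolve_right fun h => ?_
  have := h (show (0 : unitInterval) < 1 from zero_lt_one)
  rw [h0] at this
  exact absurd this (not_lt.2 unitInterval.nonneg')

theorem diffI_apply_one_of_not_mem {φ : DiffI} (h : φ ∉ diffIPlus) : φ 1 = 0 := by
  have h1 := φ.strictMono_or_strictAnti.resolve_left h
  obtain ⟨s, hs⟩ := φ.surjective 0
  exact le_antisymm ((h1.antitone unitInterval.le_one').trans_eq hs) unitInterval.nonneg'

/-- The diffeomorphism of the segment given by two inverse smooth functions. -/
def diffIMk (u v : unitInterval → unitInterval) (h1 : Function.LeftInverse v u)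
    (h2 : Function.RightInverse v u)
    (hu : ContDiffOn ℝ ∞ (fun s => (u (projIcc (0 : ℝ) 1 zero_le_one s) : ℝ)) (Icc 0 1))
    (hv : ContDiffOn ℝ ∞ (fun s => (v (projIcc (0 : ℝ) 1 zero_le_one s) : ℝ)) (Icc 0 1)) :
    DiffI where
  toFun := u
  invFun := v
  left_inv := h1
  right_inv := h2
  contMDiff_toFun := contMDiff_unitInterval_iff.2 hu
  contMDiff_invFun := contMDiff_unitInterval_iff.2 hv

/-- The function is a continuous bijection of a compact Hausdorff space, so its inverse is
continuous. Smoothness of the inverse up to the endpoints is `jetContOn_inverse` for a one-point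
parameter space. -/
theorem exists_diffI_of_deriv_pos {u : ℝ → ℝ} (hu : ContDiffOn ℝ ∞ u (Icc 0 1)) (h0 : u 0 = 0)
    (h1 : u 1 = 1) (hpos : ∀ s ∈ Icc (0 : ℝ) 1, 0 < derivWithin u (Icc 0 1) s) :
    ∃ φ : diffIPlus, ∀ s ∈ Icc (0 : ℝ) 1, φ.1.extend s = u s := by
  have hmono : StrictMonoOn u (Icc 0 1) := by
    refine strictMonoOn_of_deriv_pos (convex_Icc 0 1) hu.continuousOn fun s hs => ?_
    rw [interior_Icc] at hs
    rw [← derivWithin_of_mem_nhds (Icc_mem_nhds hs.1 hs.2)]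
    exact hpos s (Ioo_subset_Icc_self hs)
  have hmaps : ∀ s ∈ Icc (0 : ℝ) 1, u s ∈ Icc (0 : ℝ) 1 := fun s hs => by
    constructor
    · exact h0.symm.trans_le (hmono.monotoneOn ⟨le_rfl, zero_le_one⟩ hs hs.1)
    · exact (hmono.monotoneOn hs ⟨zero_le_one, le_rfl⟩ hs.2).trans_eq h1
  let U : unitInterval → unitInterval := fun s => ⟨u s, hmaps s s.2⟩
  have hU : Function.Bijective U := by
    constructor
    · intro s t hst
      exact Subtype.ext (hmono.injOn s.2 t.2 (congrArg Subtype.val hst))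
    · intro t
      have := intermediate_value_Icc zero_le_one hu.continuousOn
      rw [h0, h1] at this
      obtain ⟨s, hs, hst⟩ := this t.2
      exact ⟨⟨s, hs⟩, Subtype.ext hst⟩
  have hUc : Continuous U := Continuous.subtype_mk
    (continuousOn_iff_continuous_domRestrict.1 hu.continuousOn) _
  let e : unitInterval ≃ₜ unitInterval :=
    Continuous.homeoOfEquivCompactToT2 (f := Equiv.ofBijective U hU) hUc
  have hUe : ∀ s, U (e.symm s) = s := e.apply_symm_apply
  have hjet : JetContOn (fun _ : Unit => u) (Icc 0 1) := fun _ s hs =>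
    JetCont.of_contDiffWithinAt (uniqueDiffOn_Icc zero_lt_one) hs (hu s hs)
  have hinv := jetContOn_inverse (T := Unit) zero_lt_one hjet
    (ι := fun _ s => (e.symm (projIcc (0 : ℝ) 1 zero_le_one s) : ℝ))
    (fun _ s hs => (hpos s hs).ne') (fun _ s _ => (e.symm _).2)
    (fun _ s hs => by
      have := congrArg Subtype.val (hUe (projIcc (0 : ℝ) 1 zero_le_one s))
      simpa [U, projIcc_of_mem zero_le_one hs] using this)
    (Continuous.continuousOn (continuous_subtype_val.comp (e.symm.continuous.comp
      (continuous_projIcc.comp continuous_snd))))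
  refine ⟨⟨diffIMk U e.symm e.symm_apply_apply hUe ?_ (hinv.contDiffOn ()), ?_⟩, fun s hs => ?_⟩
  · refine hu.congr fun s hs => ?_
    simp [U, projIcc_of_mem zero_le_one hs]
  · exact fun s t hst => hmono s.2 t.2 hst
  · rw [DiffI.extend_of_mem _ hs]
    rfl

theorem diffI_ext_extend {φ χ : DiffI} (h : ∀ s ∈ Icc (0 : ℝ) 1, φ.extend s = χ.extend s) :
    φ = χ := by
  refine Diffeomorph.ext fun s => Subtype.ext ?_
  rw [← φ.extend_coe, ← χ.extend_coe]
  exact h s s.2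

variable {T : Type*} [TopologicalSpace T]

theorem jetContOn_of_iteratedDerivWithin {a : ℝ} (ha : 0 < a) {u : T → ℝ → ℝ}
    (hu : ∀ t, ContDiffOn ℝ ∞ (u t) (Icc 0 a))
    (hc : ∀ k, ContinuousOn (fun p : T × ℝ => iteratedDerivWithin k (u p.1) (Icc 0 a) p.2)
      (univ ×ˢ Icc 0 a)) : JetContOn u (Icc 0 a) := by
  have : IsJets a (fun k t => iteratedDerivWithin k (u t) (Icc 0 a)) := by
    refine ⟨fun k t s hs => ?_, hc⟩
    rw [iteratedDerivWithin_succ]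
    exact ((hu t).differentiableOn_iteratedDerivWithin (by exact_mod_cast ENat.natCast_lt_top k)
      (uniqueDiffOn_Icc ha) s hs).hasDerivWithinAt
  simpa using this.jetContOn ha

/-- Continuity of a map to the diffeomorphism group of the segment. -/
theorem continuous_diffI_iff {H : T → DiffI} :
    Continuous H ↔ JetContOn (fun t => (H t).extend) (Icc 0 1) := by
  have h1 : Continuous H ↔ ∀ k, Continuous fun t => UniformFun.ofFun
      fun s : unitInterval => iteratedDerivWithin k (H t).extend (Icc 0 1) s := by
    rw [continuous_iInf_rng]
    exact forall_congr' fun k => continuous_induced_rng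
  rw [h1]
  constructor
  · intro h
    refine jetContOn_of_iteratedDerivWithin zero_lt_one (fun t => (H t).contDiffOn_extend)
      fun k => ?_
    have hk : ∀ t, Continuous fun s : unitInterval =>
        iteratedDerivWithin k (H t).extend (Icc 0 1) s := fun t =>
      continuousOn_iff_continuous_domRestrict.1 ((H t).contDiffOn_extend.continuousOn_iteratedDerivWithin
        (by exact_mod_cast le_top) (uniqueDiffOn_Icc zero_lt_one))
    -- Uniform convergence in `s` as `t → t₀`, together with continuity of the limit in `s`, gives
    -- joint continuity.
    have hj : Continuous fun p : T × unitInterval =>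
        iteratedDerivWithin k (H p.1).extend (Icc 0 1) p.2 := by
      rw [continuous_iff_continuousAt]
      rintro ⟨t₀, s₀⟩
      have h2 := (h k).tendsto t₀
      rw [UniformFun.tendsto_iff_tendstoUniformly] at h2
      refine tendsto_comp_of_locally_uniform_limit (F := fun p : T × unitInterval =>
        fun s : unitInterval => iteratedDerivWithin k (H p.1).extend (Icc 0 1) s)
        (f := fun s : unitInterval => iteratedDerivWithin k (H t₀).extend (Icc 0 1) s)
        (g := Prod.snd) (x := s₀) (hk t₀).continuousAt continuousAt_snd fun V hV => ?_
      refine ⟨univ, Filter.univ_mem, ?_⟩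
      have h3 := (continuousAt_fst (p := (t₀, s₀))).eventually (h2 V hV)
      filter_upwards [h3] with p hp y _ using hp y
    intro p hp
    have h4 : ContinuousOn (fun p : T × ℝ => (p.1, projIcc (0 : ℝ) 1 zero_le_one p.2))
        (univ ×ˢ Icc 0 1) :=
      (continuous_fst.prodMk (continuous_projIcc.comp continuous_snd)).continuousOn
    refine (hj.comp_continuousOn h4 p hp).congr (fun q hq => ?_) ?_
    · simp [projIcc_of_mem zero_le_one hq.2]
    · simp [projIcc_of_mem zero_le_one hp.2]
  · intro h k
    have hj : Continuous fun p : T × unitInterval =>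
        iteratedDerivWithin k (H p.1).extend (Icc 0 1) p.2 :=
      (h.continuousOn_iteratedDerivWithin k).comp_continuous
        (f := fun p : T × unitInterval => (p.1, (p.2 : ℝ))) (by fun_prop)
        fun p => ⟨mem_univ _, p.2.2⟩
    rw [continuous_iff_continuousAt]
    intro t₀
    -- Conversely, a jointly continuous function on `T × [0,1]` curries to a continuous map into
    -- `C([0,1])`, and compactness of `[0,1]` makes this uniform convergence.
    have h2 := (ContinuousMap.curry ⟨_, hj⟩).continuous.tendsto t₀
    rw [ContinuousMap.tendsto_iff_tendstoUniformly] at h2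
    exact UniformFun.tendsto_iff_tendstoUniformly.2 h2

/-- The preimage of a closed `C` is the projection of the closed set `{H t x = y, x ∈ C}` along the
compact factor `X`, and such projections are closed maps. -/
theorem continuous_symm_of_uncurry {X Y : Type*} [TopologicalSpace X] [TopologicalSpace Y]
    [CompactSpace X] [T2Space Y] {H : T → X ≃ Y} (hH : Continuous fun p : T × X => H p.1 p.2) :
    Continuous fun p : T × Y => (H p.1).symm p.2 := by
  rw [continuous_iff_isClosed]
  intro C hC
  have h1 : IsClosed {z : (T × Y) × X | H z.1.1 z.2 = z.1.2 ∧ z.2 ∈ C} :=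
    (isClosed_eq (hH.comp (f := fun z : (T × Y) × X => (z.1.1, z.2)) (by fun_prop))
      (by fun_prop)).inter (hC.preimage continuous_snd)
  convert isClosedMap_fst_of_compactSpace _ h1 using 1
  ext p
  simp only [mem_preimage, mem_image, mem_ofPred_eq, Prod.exists, exists_and_right, exists_eq_right]
  constructor
  · exact fun hp => ⟨_, (H p.1).apply_symm_apply _, hp⟩
  · rintro ⟨x, hx, hxC⟩
    have : (H p.1).symm p.2 = x := (H p.1).symm_apply_eq.2 hx.symm
    rwa [this]

theorem continuous_diffI_inv : Continuous fun φ : DiffI => φ⁻¹ := by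
  have hid : JetContOn (fun φ : DiffI => φ.extend) (Icc 0 1) := continuous_diffI_iff.1 continuous_id
  rw [continuous_diffI_iff]
  have hev : Continuous fun p : DiffI × unitInterval => p.1 p.2 := by
    refine continuous_induced_rng.2 ?_
    refine (hid.continuousOn.comp_continuous
      (f := fun p : DiffI × unitInterval => (p.1, (p.2 : ℝ))) (by fun_prop)
        fun p => ⟨mem_univ _, p.2.2⟩).congr fun p => ?_
    exact p.1.extend_coe p.2
  have hinv := continuous_symm_of_uncurry (H := fun φ : DiffI => φ.toEquiv) hev
  refine jetContOn_inverse zero_lt_one hid (fun φ s hs => φ.derivWithin_ne_zero hs)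
    (fun φ s _ => φ⁻¹.extend_mem s) (fun φ s hs => φ.extend_extend_inv hs) ?_
  refine Continuous.continuousOn (continuous_subtype_val.comp (hinv.comp
    (f := fun p : DiffI × ℝ => (p.1, projIcc (0 : ℝ) 1 zero_le_one p.2)) ?_))
  exact continuous_fst.prodMk (continuous_projIcc.comp continuous_snd)

/-- The segment from the identity to an orientation preserving diffeomorphism. -/
theorem exists_diffI_segment : ∃ Λ : diffIPlus × unitInterval → diffIPlus, Continuous Λ ∧
    (∀ φ, Λ (φ, 0) = 1) ∧ (∀ φ, Λ (φ, 1) = φ) ∧ ∀ t, Λ (1, t) = 1 := by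
  -- The endpoint conditions `u 0 = 0`, `u 1 = 1` and positivity of the derivative are convex, so
  -- the straight segment stays inside the group.
  let u : diffIPlus × unitInterval → ℝ → ℝ := fun p s => (1 - p.2 : ℝ) * s + p.2 * p.1.1.extend s
  have hud := uniqueDiffOn_Icc (zero_lt_one (α := ℝ))
  have hjet : JetContOn u (Icc 0 1) := by
    intro p s hs
    have h1 : JetCont (fun p : diffIPlus × unitInterval => p.1.1.extend) (Icc 0 1) p s :=
      continuous_diffI_iff.1 (continuous_subtype_val.comp continuous_fst) p s hs
    have h2 : JetCont (fun (_ : diffIPlus × unitInterval) (s : ℝ) => s) (Icc 0 1) p s :=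
      JetCont.of_contDiffWithinAt hud hs contDiffWithinAt_id
    have h3 : JetCont (fun (p : diffIPlus × unitInterval) (_ : ℝ) => (1 - p.2 : ℝ)) (Icc 0 1) p s :=
      JetCont.of_continuousAt (Continuous.continuousAt (by fun_prop))
    have h4 : JetCont (fun (p : diffIPlus × unitInterval) (_ : ℝ) => (p.2 : ℝ)) (Icc 0 1) p s :=
      JetCont.of_continuousAt (Continuous.continuousAt (by fun_prop))
    exact (h3.smul h2 hud hs).add (h4.smul h1 hud hs) hud hs
  have hex : ∀ p, ∃ φ : diffIPlus, ∀ s ∈ Icc (0 : ℝ) 1, φ.1.extend s = u p s := by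
    intro p
    refine exists_diffI_of_deriv_pos (hjet.contDiffOn p) ?_ ?_ fun s hs => ?_
    · have h0 := p.1.1.extend_coe 0
      rw [diffIPlus_zero p.1.2] at h0
      simp only [Icc.coe_zero] at h0
      simp [u, h0]
    · have h0 := p.1.1.extend_coe 1
      rw [diffIPlus_one p.1.2] at h0
      simp only [Icc.coe_one] at h0
      simp [u, h0]
    · have hd : HasDerivWithinAt (u p)
          ((1 - p.2 : ℝ) * 1 + p.2 * derivWithin p.1.1.extend (Icc 0 1) s) (Icc 0 1) s :=
        ((hasDerivWithinAt_id _ _).const_mul _).add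
          (((p.1.1.contDiffOn_extend.differentiableOn (by simp)) s hs).hasDerivWithinAt.const_mul _)
      rw [hd.derivWithin (hud s hs)]
      have h1 := DiffI.derivWithin_pos p.1.2 hs
      rcases eq_or_lt_of_le p.2.2.1 with h2 | h2
      · rw [← h2]; norm_num
      · have h3 := p.2.2.2
        have := mul_pos h2 h1
        linarith
  choose Λ hΛ using hex
  refine ⟨Λ, ?_, fun φ => ?_, fun φ => ?_, fun t => ?_⟩
  · rw [continuous_induced_rng, continuous_diffI_iff]
    exact hjet.congr fun p s hs => hΛ p s hs
  · refine Subtype.ext (diffI_ext_extend fun s hs => ?_)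
    rw [hΛ _ s hs, show ((1 : diffIPlus) : DiffI) = 1 from rfl, DiffI.extend_one hs]
    simp [u]
  · refine Subtype.ext (diffI_ext_extend fun s hs => ?_)
    rw [hΛ _ s hs]
    simp [u]
  · refine Subtype.ext (diffI_ext_extend fun s hs => ?_)
    rw [hΛ _ s hs, show ((1 : diffIPlus) : DiffI) = 1 from rfl, DiffI.extend_one hs]
    simp only [u, show ((1 : diffIPlus) : DiffI) = 1 from rfl, DiffI.extend_one hs]
    ring

end DiffI


/-! ### Families of maps between manifolds -/

section FamAt

variable {T T' : Type*} [TopologicalSpace T] [TopologicalSpace T']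
  {E : Type*} [NormedAddCommGroup E] [NormedSpace ℝ E]
  {M : Type*} [TopologicalSpace M] [ChartedSpace E M]
  {E' : Type*} [NormedAddCommGroup E'] [NormedSpace ℝ E']
  {N : Type*} [TopologicalSpace N] [ChartedSpace E' N]
  {E'' : Type*} [NormedAddCommGroup E''] [NormedSpace ℝ E'']
  {P : Type*} [TopologicalSpace P] [ChartedSpace E'' P]

theorem jetCont_univ_iff {F : Type*} [NormedAddCommGroup F] [NormedSpace ℝ F] {u : T → E → F}
    {t₀ : T} {x₀ : E} : JetCont u univ t₀ x₀ ↔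
      (∀ n : ℕ, ∀ᶠ p in 𝓝 (t₀, x₀), ContDiffAt ℝ n (u p.1) p.2) ∧
      ∀ k, ContinuousAt (fun p : T × E => iteratedFDeriv ℝ k (u p.1) p.2) (t₀, x₀) := by
  constructor
  · rintro ⟨h1, h2⟩
    simp only [univ_prod_univ, nhdsWithin_univ, contDiffWithinAt_univ, iteratedFDerivWithin_univ,
      continuousWithinAt_univ] at h1 h2
    exact ⟨h1, h2⟩
  · rintro ⟨h1, h2⟩
    refine ⟨?_, ?_⟩ <;>
    simpa only [univ_prod_univ, nhdsWithin_univ, contDiffWithinAt_univ, iteratedFDerivWithin_univ,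
      continuousWithinAt_univ]

theorem JetCont.congr_univ {F : Type*} [NormedAddCommGroup F] [NormedSpace ℝ F] {u v : T → E → F}
    {t₀ : T} {x₀ : E} (h : JetCont u univ t₀ x₀)
    (huv : ∀ᶠ p in 𝓝 (t₀, x₀), v p.1 p.2 = u p.1 p.2) : JetCont v univ t₀ x₀ :=
  h.congr (mem_univ _) (mem_nhdsWithin_of_mem_nhds huv)

theorem JetCont.comp_univ {F G : Type*} [NormedAddCommGroup F] [NormedSpace ℝ F]
    [NormedAddCommGroup G] [NormedSpace ℝ G] {v : T → F → G} {u : T → E → F}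
    {t₀ : T} {x₀ : E} (hv : JetCont v univ t₀ (u t₀ x₀)) (hu : JetCont u univ t₀ x₀) :
    JetCont (fun t x => v t (u t x)) univ t₀ x₀ :=
  hv.comp hu uniqueDiffOn_univ uniqueDiffOn_univ (mem_univ _) (by simp)

theorem JetCont.of_contDiffAt {F : Type*} [NormedAddCommGroup F] [NormedSpace ℝ F] {g : E → F}
    {t₀ : T} {x₀ : E} (hg : ContDiffAt ℝ ∞ g x₀) : JetCont (fun _ : T => g) univ t₀ x₀ :=
  .of_contDiffWithinAt uniqueDiffOn_univ (mem_univ _) hg.contDiffWithinAt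

theorem continuousAt_comp_snd {X Y Z : Type*} [TopologicalSpace X] [TopologicalSpace Y]
    [TopologicalSpace Z] {f : Y → Z} {x : X} {y : Y} (h : ContinuousAt f y) :
    ContinuousAt (fun p : X × Y => f p.2) (x, y) :=
  ContinuousAt.comp (f := Prod.snd) h continuousAt_snd

theorem continuousAt_curry_comp {W X Y Z : Type*} [TopologicalSpace W] [TopologicalSpace X]
    [TopologicalSpace Y] [TopologicalSpace Z] {H : X → Y → Z} {a : W → X} {b : W → Y} {w : W}
    (hH : ContinuousAt (fun p : X × Y => H p.1 p.2) (a w, b w)) (ha : ContinuousAt a w)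
    (hb : ContinuousAt b w) : ContinuousAt (fun w => H (a w) (b w)) w :=
  ContinuousAt.comp (f := fun w => (a w, b w)) hH (ha.prodMk hb)

/-- The maps `H t` are smooth at `x₀` and their derivatives in charts depend continuously on the
parameter at `(t₀, x₀)`. -/
def FamAt (E E' : Type*) [NormedAddCommGroup E] [NormedSpace ℝ E] [NormedAddCommGroup E']
    [NormedSpace ℝ E'] [ChartedSpace E M] [ChartedSpace E' N]
    (H : T → M → N) (t₀ : T) (x₀ : M) : Prop :=
  ContinuousAt (fun p : T × M => H p.1 p.2) (t₀, x₀) ∧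
    JetCont (fun t y => chartAt E' (H t₀ x₀) (H t ((chartAt E x₀).symm y))) univ t₀
      (chartAt E x₀ x₀)

theorem contDiffAt_coord_change {φ φ' : OpenPartialHomeomorph M E}
    (hφ : φ ∈ IsManifold.maximalAtlas 𝓘(ℝ, E) ∞ M) (hφ' : φ' ∈ IsManifold.maximalAtlas 𝓘(ℝ, E) ∞ M)
    {x : M} (hx : x ∈ φ.source) (hx' : x ∈ φ'.source) :
    ContDiffAt ℝ ∞ (fun y => φ' (φ.symm y)) (φ x) := by
  have h := ModelWithCorners.contDiffOn_extendCoordChange hφ hφ'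
  refine ContDiffOn.contDiffAt (s := (φ.symm ≫ₕ φ').source) (by
    simpa [ModelWithCorners.extendCoordChange, Function.comp_def] using h) ?_
  have h2 : φ x ∈ (φ.symm ≫ₕ φ').source := by simp [hx, hx']
  exact (φ.symm ≫ₕ φ').open_source.mem_nhds h2

/-- A change of charts composes the local representation with transition maps on both sides. The
resulting identity holds only where the intermediate points lie in the old chart domains; continuity
of `H` at `(t₀, x₀)` makes that a neighbourhood. -/
theorem jetCont_coord_change {H : T → M → N} {t₀ : T} {x₀ : M}
    (hc : ContinuousAt (fun p : T × M => H p.1 p.2) (t₀, x₀))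
    {φ φ' : OpenPartialHomeomorph M E} {χ χ' : OpenPartialHomeomorph N E'}
    (hφ : φ ∈ IsManifold.maximalAtlas 𝓘(ℝ, E) ∞ M) (hφ' : φ' ∈ IsManifold.maximalAtlas 𝓘(ℝ, E) ∞ M)
    (hχ : χ ∈ IsManifold.maximalAtlas 𝓘(ℝ, E') ∞ N)
    (hχ' : χ' ∈ IsManifold.maximalAtlas 𝓘(ℝ, E') ∞ N)
    (hx : x₀ ∈ φ.source) (hx' : x₀ ∈ φ'.source) (hy : H t₀ x₀ ∈ χ.source)
    (hy' : H t₀ x₀ ∈ χ'.source)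
    (h : JetCont (fun t y => χ (H t (φ.symm y))) univ t₀ (φ x₀)) :
    JetCont (fun t y => χ' (H t (φ'.symm y))) univ t₀ (φ' x₀) := by
  have h1 : JetCont (fun (_ : T) y => φ (φ'.symm y)) univ t₀ (φ' x₀) :=
    .of_contDiffAt (contDiffAt_coord_change hφ' hφ hx' hx)
  have h2 : JetCont (fun t y => χ (H t (φ.symm (φ (φ'.symm y))))) univ t₀ (φ' x₀) := by
    refine JetCont.comp_univ (v := fun t y => χ (H t (φ.symm y))) ?_ h1
    simpa [hx'] using h
  have h3 : ContDiffAt ℝ ∞ (fun z => χ' (χ.symm z))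
      (χ (H t₀ (φ.symm (φ (φ'.symm (φ' x₀)))))) := by
    simpa [hx, hx'] using contDiffAt_coord_change hχ hχ' hy hy'
  refine (h2.comp_contDiffAt h3 uniqueDiffOn_univ (mem_univ _)).congr_univ ?_
  have hs : ContinuousAt (fun p : T × E => φ'.symm p.2) (t₀, φ' x₀) :=
    continuousAt_comp_snd (φ'.continuousAt_symm (φ'.map_source hx'))
  have e1 : ∀ᶠ p : T × E in 𝓝 (t₀, φ' x₀), φ'.symm p.2 ∈ φ.source :=
    hs.eventually_mem (φ.open_source.mem_nhds (by simpa [hx'] using hx))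
  have e2 : ∀ᶠ p : T × E in 𝓝 (t₀, φ' x₀), H p.1 (φ'.symm p.2) ∈ χ.source :=
    (continuousAt_curry_comp (by simpa [hx'] using hc) continuousAt_fst hs).eventually_mem
      (χ.open_source.mem_nhds (by simpa [hx'] using hy))
  filter_upwards [e1, e2] with p hp1 hp2
  rw [φ.left_inv hp1, χ.left_inv hp2]

variable [IsManifold 𝓘(ℝ, E) ∞ M] [IsManifold 𝓘(ℝ, E') ∞ N] [IsManifold 𝓘(ℝ, E'') ∞ P]

/-- Frees `FamAt` from the preferred charts of its definition. It is needed for the arbitrary atlas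
charts in the topology of the diffeomorphism group and for the charts linear along the fibres of a
disk bundle. -/
theorem famAt_iff {H : T → M → N} {t₀ : T} {x₀ : M} {φ : OpenPartialHomeomorph M E}
    {χ : OpenPartialHomeomorph N E'}
    (hφ : φ ∈ IsManifold.maximalAtlas 𝓘(ℝ, E) ∞ M)
    (hχ : χ ∈ IsManifold.maximalAtlas 𝓘(ℝ, E') ∞ N)
    (hx : x₀ ∈ φ.source) (hy : H t₀ x₀ ∈ χ.source) :
    FamAt E E' H t₀ x₀ ↔ ContinuousAt (fun p : T × M => H p.1 p.2) (t₀, x₀) ∧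
      JetCont (fun t y => χ (H t (φ.symm y))) univ t₀ (φ x₀) := by
  refine and_congr_right fun hc => ⟨fun h => ?_, fun h => ?_⟩
  · exact jetCont_coord_change hc (IsManifold.chart_mem_maximalAtlas _) hφ
      (IsManifold.chart_mem_maximalAtlas _) hχ (mem_chart_source _ _) hx (mem_chart_source _ _) hy h
  · exact jetCont_coord_change hc hφ (IsManifold.chart_mem_maximalAtlas _) hχ
      (IsManifold.chart_mem_maximalAtlas _) hx (mem_chart_source _ _) hy (mem_chart_source _ _) h

namespace FamAt

variable {H : T → M → N} {t₀ : T} {x₀ : M}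

omit [IsManifold 𝓘(ℝ, E) ∞ M] [IsManifold 𝓘(ℝ, E') ∞ N] [IsManifold 𝓘(ℝ, E'') ∞ P] in
theorem comp {K : T → N → P} (hK : FamAt E' E'' K t₀ (H t₀ x₀)) (hH : FamAt E E' H t₀ x₀) :
    FamAt E E'' (fun t x => K t (H t x)) t₀ x₀ := by
  refine ⟨continuousAt_curry_comp hK.1 continuousAt_fst hH.1, ?_⟩
  have hx : (chartAt E x₀).symm (chartAt E x₀ x₀) = x₀ :=
    (chartAt E x₀).left_inv (mem_chart_source _ _)
  have h1 : JetCont (fun t y => chartAt E'' (K t₀ (H t₀ x₀)) (K t ((chartAt E' (H t₀ x₀)).symm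
      (chartAt E' (H t₀ x₀) (H t ((chartAt E x₀).symm y)))))) univ t₀ (chartAt E x₀ x₀) := by
    refine JetCont.comp_univ (v := fun t z => chartAt E'' (K t₀ (H t₀ x₀))
      (K t ((chartAt E' (H t₀ x₀)).symm z))) ?_ hH.2
    rw [hx]
    exact hK.2
  refine h1.congr_univ ?_
  have hs : ContinuousAt (fun p : T × E => (chartAt E x₀).symm p.2) (t₀, chartAt E x₀ x₀) :=
    continuousAt_comp_snd ((chartAt E x₀).continuousAt_symm (mem_chart_target _ _))
  have e2 : ∀ᶠ p : T × E in 𝓝 (t₀, chartAt E x₀ x₀),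
      H p.1 ((chartAt E x₀).symm p.2) ∈ (chartAt E' (H t₀ x₀)).source :=
    (continuousAt_curry_comp (by rw [hx]; exact hH.1) continuousAt_fst hs).eventually_mem
      ((chartAt E' (H t₀ x₀)).open_source.mem_nhds (by rw [hx]; exact mem_chart_source _ _))
  filter_upwards [e2] with p hp2
  rw [(chartAt E' (H t₀ x₀)).left_inv hp2]

omit [IsManifold 𝓘(ℝ, E) ∞ M] [IsManifold 𝓘(ℝ, E') ∞ N] in
theorem comp_param (h : FamAt E E' H t₀ x₀) {a : T' → T} {t' : T'} (ha : ContinuousAt a t')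
    (hat : a t' = t₀) : FamAt E E' (fun t => H (a t)) t' x₀ := by
  subst hat
  refine ⟨?_, h.2.comp_param ha rfl⟩
  exact continuousAt_curry_comp (a := fun p : T' × M => a p.1) h.1
    (ContinuousAt.comp (f := Prod.fst) ha continuousAt_fst) continuousAt_snd

omit [IsManifold 𝓘(ℝ, E) ∞ M] [IsManifold 𝓘(ℝ, E') ∞ N] in
theorem of_contMDiffAt {g : M → N} (hg : ContMDiffAt 𝓘(ℝ, E) 𝓘(ℝ, E') ∞ g x₀) :
    FamAt E E' (fun _ : T => g) t₀ x₀ := by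
  rw [contMDiffAt_iff] at hg
  refine ⟨ContinuousAt.comp (f := Prod.snd) hg.1 continuousAt_snd, .of_contDiffAt ?_⟩
  have := hg.2
  simpa [Function.comp_def, contDiffWithinAt_univ] using this

omit [IsManifold 𝓘(ℝ, E) ∞ M] [IsManifold 𝓘(ℝ, E') ∞ N] in
theorem contMDiffAt (h : FamAt E E' H t₀ x₀) : ContMDiffAt 𝓘(ℝ, E) 𝓘(ℝ, E') ∞ (H t₀) x₀ := by
  rw [contMDiffAt_iff]
  refine ⟨ContinuousAt.comp (f := fun x => (t₀, x)) h.1 (by fun_prop), ?_⟩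
  have := h.2.contDiffWithinAt (mem_univ _)
  simpa [Function.comp_def, contDiffWithinAt_univ] using this

end FamAt

omit [IsManifold 𝓘(ℝ, E) ∞ M] [IsManifold 𝓘(ℝ, E') ∞ N] in
theorem famAt_self_iff {u : T → E → E'} {t₀ : T} {x₀ : E} :
    FamAt E E' u t₀ x₀ ↔ JetCont u univ t₀ x₀ := by
  simp only [FamAt, chartAt_self_eq, OpenPartialHomeomorph.refl_apply,
    OpenPartialHomeomorph.refl_symm]
  refine ⟨fun h => h.2, fun h => ⟨?_, h⟩⟩
  simpa [continuousWithinAt_univ] using h.continuousWithinAt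

/-! ### The topology of the diffeomorphism group -/

theorem contDiffAt_rep {φ χ : OpenPartialHomeomorph M E}
    (hφ : φ ∈ IsManifold.maximalAtlas 𝓘(ℝ, E) ∞ M) (hχ : χ ∈ IsManifold.maximalAtlas 𝓘(ℝ, E) ∞ M)
    (h : DiffM E M) {y : E} (hy : y ∈ φ.target) (hy' : h (φ.symm y) ∈ χ.source) :
    ContDiffAt ℝ ∞ (χ ∘ h ∘ φ.symm) y := by
  have h1 : FamAt E E (fun (_ : Unit) x => h x) () (φ.symm y) :=
    FamAt.of_contMDiffAt (h.contMDiff _)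
  have h2 := ((famAt_iff (H := fun (_ : Unit) x => h x) hφ hχ (φ.map_target hy) hy').1 h1).2
  rw [φ.right_inv hy] at h2
  simpa [contDiffWithinAt_univ, Function.comp_def] using h2.contDiffWithinAt (mem_univ _)

omit [IsManifold 𝓘(ℝ, E) ∞ M] in
theorem mem_nhds_cInftyNhd {h₀ : DiffM E M} {φ χ : OpenPartialHomeomorph M E} {K : Set M} {r : ℕ}
    {ε : ℝ} (hφ : φ ∈ atlas E M) (hχ : χ ∈ atlas E M) (hK : IsCompact K) (hKφ : K ⊆ φ.source)
    (hKχ : MapsTo h₀ K χ.source) (hε : 0 < ε) : cInftyNhd E h₀ φ χ K r ε ∈ 𝓝 h₀ :=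
  IsOpen.mem_nhds (TopologicalSpace.isOpen_generateFrom_of_mem
    ⟨h₀, φ, χ, K, r, ε, hφ, hχ, hK, hKφ, hKχ, hε, rfl⟩) ⟨hKχ, fun x _ k _ => by simpa using hε⟩

/-- Evaluation is the universal family: every continuous family is a pullback of it. A compact
neighbourhood `K` of `x₀` gives a basic neighbourhood of `h₀` on which the jets of `h` are uniformly
close to those of `h₀` over `K`; continuity of the jets of the fixed `h₀` does the rest. -/
theorem famAt_diffM_apply [FiniteDimensional ℝ E] (h₀ : DiffM E M) (x₀ : M) :
    FamAt E E (fun (h : DiffM E M) x => h x) h₀ x₀ := by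
  have : LocallyCompactSpace M := ChartedSpace.locallyCompactSpace E M
  set φ := chartAt E x₀ with hφ
  set χ := chartAt E (h₀ x₀) with hχ
  have hφa : φ ∈ atlas E M := chart_mem_atlas _ _
  have hχa : χ ∈ atlas E M := chart_mem_atlas _ _
  have hφm : φ ∈ IsManifold.maximalAtlas 𝓘(ℝ, E) ∞ M := IsManifold.chart_mem_maximalAtlas _
  have hχm : χ ∈ IsManifold.maximalAtlas 𝓘(ℝ, E) ∞ M := IsManifold.chart_mem_maximalAtlas _
  have hx : x₀ ∈ φ.source := mem_chart_source _ _
  have hhx : h₀ x₀ ∈ χ.source := mem_chart_source _ _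
  have hhc : Continuous h₀ := h₀.continuous
  obtain ⟨K, hKn, hKs, hK⟩ := local_compact_nhds (x := x₀)
    (Filter.inter_mem (φ.open_source.mem_nhds hx)
      ((χ.open_source.preimage hhc).mem_nhds hhx))
  have hKφ : K ⊆ φ.source := fun y hy => (hKs hy).1
  have hKχ : MapsTo h₀ K χ.source := fun y hy => (hKs hy).2
  have hS : ∀ (r : ℕ) (ε : ℝ), 0 < ε → ∀ᶠ h in 𝓝 h₀, h ∈ cInftyNhd E h₀ φ χ K r ε :=
    fun r ε hε => mem_nhds_cInftyNhd hφa hχa hK hKφ hKχ hε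
  have hyK : ∀ᶠ y in 𝓝 (φ x₀), y ∈ φ.target ∧ φ.symm y ∈ K := by
    refine Filter.Eventually.and (φ.open_target.mem_nhds (φ.map_source hx)) ?_
    exact (φ.continuousAt_symm (φ.map_source hx)).eventually_mem (by rwa [φ.left_inv hx])
  have hy₀ : ∀ k : ℕ, ContinuousAt (iteratedFDeriv ℝ k (χ ∘ h₀ ∘ φ.symm)) (φ x₀) := fun k =>
    (contDiffAt_rep hφm hχm h₀ (φ.map_source hx) (by rwa [φ.left_inv hx])).continuousAt_iteratedFDeriv
      (by exact_mod_cast le_top)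
  have hjet : ∀ k, ContinuousAt
      (fun p : DiffM E M × E => iteratedFDeriv ℝ k (χ ∘ p.1 ∘ φ.symm) p.2) (h₀, φ x₀) := by
    intro k
    rw [ContinuousAt, Metric.tendsto_nhds]
    intro ε hε
    have e1 := (continuousAt_fst (p := (h₀, φ x₀))).eventually (hS k (ε / 2) (half_pos hε))
    have e2 := (continuousAt_snd (p := (h₀, φ x₀))).eventually hyK
    have e3 := (continuousAt_snd (p := (h₀, φ x₀))).eventually
      (Metric.tendsto_nhds.1 (hy₀ k) (ε / 2) (half_pos hε))
    filter_upwards [e1, e2, e3] with p h1 h2 h3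
    have h4 := h1.2 _ h2.2 k le_rfl
    rw [φ.right_inv h2.1, ← dist_eq_norm] at h4
    calc _ ≤ _ := dist_triangle _ _ _
      _ < ε / 2 + ε / 2 := add_lt_add h4 h3
      _ = ε := add_halves ε
  -- The jet of order 0 gives continuity of the chart representation, and `χ.symm` brings it back to
  -- `M`. The basic neighbourhood with `r = 0`, `ε = 1` serves only for its condition that `h` maps
  -- `K` into the domain of `χ`.
  have hcont : ContinuousAt (fun p : DiffM E M × M => p.1 p.2) (h₀, x₀) := by
    have h1 := (continuousMultilinearCurryFin0 ℝ E E).continuous.continuousAt.comp (hjet 0)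
    have h2 := ContinuousAt.comp (f := fun p : DiffM E M × M => (p.1, φ p.2)) (x := (h₀, x₀)) h1
      (continuousAt_fst.prodMk (continuousAt_comp_snd (φ.continuousAt hx)))
    have h3 : ContinuousAt χ.symm (χ (h₀ x₀)) := χ.continuousAt_symm (χ.map_source hhx)
    have h4 : ContinuousAt (fun p : DiffM E M × M => χ.symm (χ (p.1 (φ.symm (φ p.2))))) (h₀, x₀) := by
      refine ContinuousAt.comp (g := χ.symm)
        (f := fun p : DiffM E M × M => χ (p.1 (φ.symm (φ p.2)))) ?_ ?_
      · rw [φ.left_inv hx]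
        exact h3
      · refine h2.congr (Filter.Eventually.of_forall fun p => ?_)
        simp
    refine h4.congr ?_
    filter_upwards [(continuousAt_fst (p := (h₀, x₀))).eventually (hS 0 1 one_pos),
      (continuousAt_snd (p := (h₀, x₀))).eventually_mem hKn] with p h5 h6
    rw [φ.left_inv (hKφ h6), χ.left_inv (h5.1 h6)]
  refine ⟨hcont, jetCont_univ_iff.2 ⟨fun n => ?_, hjet⟩⟩
  filter_upwards [(continuousAt_fst (p := (h₀, φ x₀))).eventually (hS 0 1 one_pos),
    (continuousAt_snd (p := (h₀, φ x₀))).eventually hyK] with p h1 h2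
  exact (contDiffAt_rep hφm hχm p.1 h2.1 (h1.1 h2.2)).of_le (by exact_mod_cast le_top)

/-- Continuity of a map to the diffeomorphism group of a manifold. -/
theorem continuous_diffM_iff [FiniteDimensional ℝ E] {H : T → DiffM E M} :
    Continuous H ↔ ∀ t₀ x₀, FamAt E E (fun t x => H t x) t₀ x₀ := by
  refine ⟨fun h t₀ x₀ => (famAt_diffM_apply (H t₀) x₀).comp_param h.continuousAt rfl, fun h => ?_⟩
  refine continuous_generateFrom_iff.2 ?_
  rintro _ ⟨h₀, φ, χ, K, r, ε, hφa, hχa, hK, hKφ, hKχ, hε, rfl⟩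
  have hφm := IsManifold.subset_maximalAtlas (n := ∞) (I := 𝓘(ℝ, E)) hφa
  have hχm := IsManifold.subset_maximalAtlas (n := ∞) (I := 𝓘(ℝ, E)) hχa
  rw [isOpen_iff_mem_nhds]
  rintro t₀ ⟨ht1, ht2⟩
  -- Compactness of `K` turns conditions that hold near each `(t₀, x)` into conditions on `t` alone,
  -- valid for all `x ∈ K`.
  have e1 : ∀ᶠ t in 𝓝 t₀, ∀ x ∈ K, H t x ∈ χ.source :=
    hK.eventually_forall_of_forall_eventually fun x hx =>
      (h t₀ x).1.eventually_mem (χ.open_source.mem_nhds (ht1 hx))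
  have e2 : ∀ k, ∀ᶠ t in 𝓝 t₀, k ≤ r → ∀ x ∈ K, ‖iteratedFDeriv ℝ k (χ ∘ H t ∘ φ.symm) (φ x)
      - iteratedFDeriv ℝ k (χ ∘ h₀ ∘ φ.symm) (φ x)‖ < ε := by
    intro k
    by_cases hk : k ≤ r
    · simp only [hk, forall_true_left]
      refine hK.eventually_forall_of_forall_eventually fun x hx => ?_
      have h1 := (jetCont_univ_iff.1 ((famAt_iff (H := fun t x => H t x) hφm hχm (hKφ hx)
        (ht1 hx)).1 (h t₀ x)).2).2 k
      have hc : ContinuousAt (fun p : T × M => φ p.2) (t₀, x) :=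
        continuousAt_comp_snd (φ.continuousAt (hKφ hx))
      have h2 := ContinuousAt.comp (f := fun p : T × M => (p.1, φ p.2)) (x := (t₀, x)) h1
        (continuousAt_fst.prodMk hc)
      have h3 : ContinuousAt (iteratedFDeriv ℝ k (χ ∘ h₀ ∘ φ.symm)) (φ x) :=
        (contDiffAt_rep hφm hχm h₀ (φ.map_source (hKφ hx))
          (by rw [φ.left_inv (hKφ hx)]; exact hKχ hx)).continuousAt_iteratedFDeriv
          (by exact_mod_cast le_top)
      have h4 : ContinuousAt (fun p : T × M => iteratedFDeriv ℝ k (χ ∘ h₀ ∘ φ.symm) (φ p.2))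
          (t₀, x) := ContinuousAt.comp (f := fun p : T × M => φ p.2) (x := (t₀, x)) h3 hc
      -- The centre `h₀` need not be `H t₀`. The strict inequality at `t₀` persists nearby because
      -- the norm of the difference of jets is jointly continuous.
      exact (h2.sub h4).norm.eventually_lt_const (ht2 x hx k hk)
    · simp [hk]
  have e3 : ∀ᶠ t in 𝓝 t₀, ∀ k ∈ Finset.range (r + 1), k ≤ r → ∀ x ∈ K,
      ‖iteratedFDeriv ℝ k (χ ∘ H t ∘ φ.symm) (φ x)
        - iteratedFDeriv ℝ k (χ ∘ h₀ ∘ φ.symm) (φ x)‖ < ε :=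
    (Filter.eventually_all_finset _).2 fun k _ => e2 k
  filter_upwards [e1, e3] with t h1 h2
  exact ⟨h1, fun x hx k hk => h2 k (Finset.mem_range.2 (Nat.lt_succ_of_le hk)) hk x hx⟩

end FamAt


/-! ### Charts of a space transported along open embeddings -/

section PieceChart

variable {E G H X : Type*} [TopologicalSpace E] [Nonempty E] [TopologicalSpace G]
  [TopologicalSpace H]
  [TopologicalSpace X]

/-- A chart of an open piece as a chart of the whole space. -/
def pieceChart {j : X → G} (hj : IsOpenEmbedding j) (L : H ≃ₜ E) (c : OpenPartialHomeomorph X H) :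
    OpenPartialHomeomorph G E :=
  (c.trans L.toOpenPartialHomeomorph).lift_openEmbedding hj

variable {j : X → G}
  (hj : IsOpenEmbedding j) (L : H ≃ₜ E) (c : OpenPartialHomeomorph X H)

theorem pieceChart_apply (x : X) : pieceChart hj L c (j x) = L (c x) :=
  OpenPartialHomeomorph.lift_openEmbedding_apply _ hj

theorem pieceChart_symm_apply (z : E) : (pieceChart hj L c).symm z = j (c.symm (L.symm z)) := rfl

theorem pieceChart_source : (pieceChart hj L c).source = j '' c.source := by
  simp [pieceChart]

theorem mem_pieceChart_source {x : X} : j x ∈ (pieceChart hj L c).source ↔ x ∈ c.source := by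
  rw [pieceChart_source, hj.injective.mem_set_image]

theorem mem_pieceChart_target {z : E} : z ∈ (pieceChart hj L c).target ↔ L.symm z ∈ c.target := by
  simp [pieceChart]

end PieceChart

section Pieces

variable {E : Type*} [NormedAddCommGroup E] [NormedSpace ℝ E]
  {G : Type*} [TopologicalSpace G]
  {E₁ : Type*} [NormedAddCommGroup E₁] [NormedSpace ℝ E₁] {H₁ : Type*} [TopologicalSpace H₁]
  {I₁ : ModelWithCorners ℝ E₁ H₁} {X : Type*} [TopologicalSpace X] [ChartedSpace H₁ X]
  [IsManifold I₁ ∞ X]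
  {E₂ : Type*} [NormedAddCommGroup E₂] [NormedSpace ℝ E₂] {H₂ : Type*} [TopologicalSpace H₂]
  {I₂ : ModelWithCorners ℝ E₂ H₂} {Y : Type*} [TopologicalSpace Y] [ChartedSpace H₂ Y]
  [IsManifold I₂ ∞ Y]

/-- Near `z` the transition map is `L₂ ∘ c₂ ∘ g ∘ c₁⁻¹ ∘ L₁⁻¹`, where `g` is the germ of the passage
from one piece to the other. Stating compatibility by germs also covers two charts of the same
piece, with `g = id`. -/
theorem contDiffAt_pieceChart {j₁ : X → G} {j₂ : Y → G} (h₁ : IsOpenEmbedding j₁)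
    (h₂ : IsOpenEmbedding j₂) {L₁ : H₁ ≃ₜ E} {L₂ : H₂ ≃ₜ E}
    (hL₁ : ContMDiff 𝓘(ℝ, E) I₁ ∞ L₁.symm) (hL₂ : ContMDiff I₂ 𝓘(ℝ, E) ∞ L₂)
    (hcompat : ∀ x y, j₁ x = j₂ y → ∃ g : X → Y, ContMDiffAt I₁ I₂ ∞ g x ∧
      ∀ᶠ x' in 𝓝 x, j₂ (g x') = j₁ x')
    {c₁ : OpenPartialHomeomorph X H₁} {c₂ : OpenPartialHomeomorph Y H₂}
    (hc₁ : c₁ ∈ atlas H₁ X) (hc₂ : c₂ ∈ atlas H₂ Y) {z : E}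
    (hz : z ∈ ((pieceChart h₁ L₁ c₁).symm ≫ₕ pieceChart h₂ L₂ c₂).source) :
    ContDiffAt ℝ ∞ (pieceChart h₂ L₂ c₂ ∘ (pieceChart h₁ L₁ c₁).symm) z := by
  rw [OpenPartialHomeomorph.trans_source, OpenPartialHomeomorph.symm_source, mem_inter_iff,
    mem_preimage, mem_pieceChart_target, pieceChart_symm_apply, pieceChart_source] at hz
  obtain ⟨hz1, y, hy, hyx⟩ := hz
  set x := c₁.symm (L₁.symm z) with hx
  obtain ⟨g, hg, hgj⟩ := hcompat x y hyx.symm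
  have hgx : g x = y := h₂.injective (hgj.self_of_nhds.trans hyx.symm)
  have s1 : ContMDiffAt 𝓘(ℝ, E) I₁ ∞ (fun z => c₁.symm (L₁.symm z)) z :=
    ContMDiffAt.comp z (contMDiffAt_symm_of_mem_maximalAtlas
      (IsManifold.subset_maximalAtlas hc₁) hz1) (hL₁ z)
  have s2 : ContMDiffAt 𝓘(ℝ, E) I₂ ∞ (fun z => g (c₁.symm (L₁.symm z))) z :=
    ContMDiffAt.comp z hg s1
  have s3 : ContMDiffAt 𝓘(ℝ, E) I₂ ∞ (fun z => c₂ (g (c₁.symm (L₁.symm z)))) z :=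
    ContMDiffAt.comp z (contMDiffAt_of_mem_maximalAtlas
      (IsManifold.subset_maximalAtlas hc₂) (by rw [← hx, hgx]; exact hy)) s2
  have s4 : ContMDiffAt 𝓘(ℝ, E) 𝓘(ℝ, E) ∞ (fun z => L₂ (c₂ (g (c₁.symm (L₁.symm z))))) z :=
    ContMDiffAt.comp z (hL₂ _) s3
  refine s4.contDiffAt.congr_of_eventuallyEq ?_
  filter_upwards [s1.continuousAt.eventually hgj] with w hw
  rw [Function.comp_apply, pieceChart_symm_apply, ← hw, pieceChart_apply]

/-- A space covered by two manifolds with smooth transition maps is a manifold. -/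
theorem isManifold_of_pieces [ChartedSpace E G] {j₁ : X → G} {j₂ : Y → G}
    (h₁ : IsOpenEmbedding j₁) (h₂ : IsOpenEmbedding j₂) {L₁ : H₁ ≃ₜ E} {L₂ : H₂ ≃ₜ E}
    (hL₁ : ContMDiff I₁ 𝓘(ℝ, E) ∞ L₁) (hL₁' : ContMDiff 𝓘(ℝ, E) I₁ ∞ L₁.symm)
    (hL₂ : ContMDiff I₂ 𝓘(ℝ, E) ∞ L₂) (hL₂' : ContMDiff 𝓘(ℝ, E) I₂ ∞ L₂.symm)
    (h12 : ∀ x y, j₁ x = j₂ y → ∃ g : X → Y, ContMDiffAt I₁ I₂ ∞ g x ∧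
      ∀ᶠ x' in 𝓝 x, j₂ (g x') = j₁ x')
    (h21 : ∀ y x, j₂ y = j₁ x → ∃ g : Y → X, ContMDiffAt I₂ I₁ ∞ g y ∧
      ∀ᶠ y' in 𝓝 y, j₁ (g y') = j₂ y')
    (hatlas : ∀ e ∈ atlas E G, (∃ c ∈ atlas H₁ X, e = pieceChart h₁ L₁ c) ∨
      ∃ c ∈ atlas H₂ Y, e = pieceChart h₂ L₂ c) : IsManifold 𝓘(ℝ, E) ∞ G := by
  have h11 : ∀ x y : X, j₁ x = j₁ y → ∃ g : X → X, ContMDiffAt I₁ I₁ ∞ g x ∧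
      ∀ᶠ x' in 𝓝 x, j₁ (g x') = j₁ x' := fun x y _ =>
    ⟨id, contMDiffAt_id, Filter.Eventually.of_forall fun _ => rfl⟩
  have h22 : ∀ x y : Y, j₂ x = j₂ y → ∃ g : Y → Y, ContMDiffAt I₂ I₂ ∞ g x ∧
      ∀ᶠ x' in 𝓝 x, j₂ (g x') = j₂ x' := fun x y _ =>
    ⟨id, contMDiffAt_id, Filter.Eventually.of_forall fun _ => rfl⟩
  refine isManifold_of_contDiffOn 𝓘(ℝ, E) ∞ G fun e e' he he' => ?_
  simp only [modelWithCornersSelf_coe, modelWithCornersSelf_coe_symm, Function.comp_id,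
    Function.id_comp, range_id, inter_univ, preimage_id]
  intro z hz
  refine ContDiffAt.contDiffWithinAt ?_
  rcases hatlas e he with ⟨c, hc, rfl⟩ | ⟨c, hc, rfl⟩ <;>
  rcases hatlas e' he' with ⟨c', hc', rfl⟩ | ⟨c', hc', rfl⟩
  · exact contDiffAt_pieceChart h₁ h₁ hL₁' hL₁ h11 hc hc' hz
  · exact contDiffAt_pieceChart h₁ h₂ hL₁' hL₂ h12 hc hc' hz
  · exact contDiffAt_pieceChart h₂ h₁ hL₂' hL₁ h21 hc hc' hz
  · exact contDiffAt_pieceChart h₂ h₂ hL₂' hL₂ h22 hc hc' hz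

/-- In the charts `c` and `e = pieceChart hj L c` the embedding reads as `L`. As `L` is smooth in
both directions, `c⁻¹ ∘ L⁻¹ ∘ e` is a smooth local inverse. -/
theorem isLocalDiffeomorph_of_pieceChart [ChartedSpace E G] [IsManifold 𝓘(ℝ, E) ∞ G] {j : X → G}
    (hj : IsOpenEmbedding j) {L : H₁ ≃ₜ E} (hL : ContMDiff I₁ 𝓘(ℝ, E) ∞ L)
    (hL' : ContMDiff 𝓘(ℝ, E) I₁ ∞ L.symm)
    (hatlas : ∀ x : X, pieceChart hj L (chartAt H₁ x) ∈ atlas E G) :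
    IsLocalDiffeomorph I₁ 𝓘(ℝ, E) ∞ j := by
  intro x
  set c := chartAt H₁ x with hc
  set e := pieceChart hj L c with he
  have hem : e ∈ IsManifold.maximalAtlas 𝓘(ℝ, E) ∞ G := IsManifold.subset_maximalAtlas (hatlas x)
  have hinv : ∀ y ∈ c.source, c.symm (L.symm (e (j y))) = y := fun y hy => by
    rw [he, pieceChart_apply, L.symm_apply_apply, c.left_inv hy]
  have hsrc : e.source = j '' c.source := pieceChart_source hj L c
  refine ⟨⟨⟨j, fun y => c.symm (L.symm (e y)), c.source, e.source, ?_, ?_, ?_, ?_⟩, c.open_source,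
    e.open_source, ?_, ?_⟩, mem_chart_source H₁ x, fun y _ => rfl⟩
  · exact fun y hy => (mem_pieceChart_source hj L c).2 hy
  · intro y hy
    rw [hsrc] at hy
    obtain ⟨y, hy, rfl⟩ := hy
    rwa [hinv y hy]
  · exact hinv
  · intro y hy
    rw [hsrc] at hy
    obtain ⟨y, hy, rfl⟩ := hy
    rw [hinv y hy]
  · intro y hy
    refine ContMDiffAt.contMDiffWithinAt ?_
    have s1 : ContMDiffAt I₁ I₁ ∞ c y :=
      contMDiffAt_of_mem_maximalAtlas (IsManifold.chart_mem_maximalAtlas x) hy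
    have s2 : ContMDiffAt I₁ 𝓘(ℝ, E) ∞ (fun y => L (c y)) y := ContMDiffAt.comp y (hL _) s1
    have s3 : ContMDiffAt I₁ 𝓘(ℝ, E) ∞ (fun y => e.symm (L (c y))) y := by
      refine ContMDiffAt.comp y (contMDiffAt_symm_of_mem_maximalAtlas hem ?_) s2
      rw [he, mem_pieceChart_target, L.symm_apply_apply]
      exact c.map_source hy
    refine s3.congr_of_eventuallyEq ?_
    filter_upwards [c.open_source.mem_nhds hy] with w hw
    rw [he, pieceChart_symm_apply, L.symm_apply_apply, c.left_inv hw]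
  · intro y hy
    refine ContMDiffAt.contMDiffWithinAt ?_
    have s1 : ContMDiffAt 𝓘(ℝ, E) 𝓘(ℝ, E) ∞ e y := contMDiffAt_of_mem_maximalAtlas hem hy
    have s2 : ContMDiffAt 𝓘(ℝ, E) I₁ ∞ (fun y => L.symm (e y)) y := ContMDiffAt.comp y (hL' _) s1
    have s3 : ContMDiffAt I₁ I₁ ∞ c.symm (L.symm (e y)) :=
      contMDiffAt_symm_of_mem_maximalAtlas (IsManifold.chart_mem_maximalAtlas x)
        ((mem_pieceChart_target hj L c).1 (e.map_source hy))
    exact ContMDiffAt.comp (g := c.symm) y s3 s2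

end Pieces

/-! ### Second order behaviour of functions homogeneous along a projection -/

section Homogeneous

variable {E : Type*} [NormedAddCommGroup E] [NormedSpace ℝ E] {Q : E → ℝ} {Ω : Set E}
  {P : E →L[ℝ] E}

/-- Here `P z` plays the role of the fibre coordinate. Euler's identity: differentiating `Q(z +
(c-1) P z) = c² Q(z)` at `c = 1` shows that the derivative of `Q` along `P z` is `2 Q(z)`, which is
positive if `P z ≠ 0`. Points with `P z = 0` are minima. -/
theorem fderiv_eq_zero_iff_of_homogeneous (hΩ : IsOpen Ω) (hQ : ContDiffOn ℝ ∞ Q Ω)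
    (hhom : ∀ z ∈ Ω, ∀ c ∈ Icc (0 : ℝ) 1, Q (z + (c - 1) • P z) = c ^ 2 * Q z)
    (hpos : ∀ z ∈ Ω, P z ≠ 0 → 0 < Q z) {z : E} (hz : z ∈ Ω) : fderiv ℝ Q z = 0 ↔ P z = 0 := by
  have hzero : ∀ z ∈ Ω, P z = 0 → Q z = 0 := fun z hz h0 => by
    have := hhom z hz 0 ⟨le_rfl, zero_le_one⟩
    simpa [h0] using this
  have hd : DifferentiableAt ℝ Q z := (hQ.contDiffAt (hΩ.mem_nhds hz)).differentiableAt (by simp)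
  constructor
  · intro h
    by_contra h0
    have h1 : HasDerivAt (fun c : ℝ => z + (c - 1) • P z) ((1 : ℝ) • P z) 1 :=
      (((hasDerivAt_id (1 : ℝ)).sub_const 1).smul_const (P z)).const_add z
    have h2 : HasDerivAt (fun c : ℝ => Q (z + (c - 1) • P z)) 0 1 := by
      have hd' : HasFDerivAt Q (0 : E →L[ℝ] ℝ) (z + ((1 : ℝ) - 1) • P z) := by
        rw [sub_self, zero_smul, add_zero, ← h]
        exact hd.hasFDerivAt
      exact hd'.comp_hasDerivAt (1 : ℝ) h1
    -- Homogeneity is available only for `c ≤ 1`, so the two derivatives at `c = 1` are compared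
    -- within `[0,1]`.
    have h3 : HasDerivWithinAt (fun c : ℝ => c ^ 2 * Q z) 0 (Icc 0 1) 1 :=
      h2.hasDerivWithinAt.congr (fun c hc => (hhom z hz c hc).symm)
        (hhom z hz 1 ⟨zero_le_one, le_rfl⟩).symm
    have h4 : HasDerivWithinAt (fun c : ℝ => c ^ 2 * Q z) (2 * Q z) (Icc 0 1) 1 := by
      simpa using ((hasDerivAt_pow 2 (1 : ℝ)).mul_const (Q z)).hasDerivWithinAt
    have := (uniqueDiffOn_Icc (zero_lt_one (α := ℝ)) 1 ⟨zero_le_one, le_rfl⟩).eq_deriv _ h3 h4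
    linarith [hpos z hz h0]
  · intro h0
    refine IsLocalMin.fderiv_eq_zero ?_
    filter_upwards [hΩ.mem_nhds hz] with w hw
    rw [hzero z hz h0]
    by_cases hw0 : P w = 0
    · exact (hzero w hw hw0).ge
    · exact (hpos w hw hw0).le

/-- Along `ker P` the derivative of `Q` vanishes identically, so `ker P` lies in the kernel of the
Hessian. Subtracting `v - P v ∈ ker P` reduces the converse to `w = P v`. If `w ≠ 0`, then `Q(z + t
w) = A t²` with `A > 0` for small `t ≥ 0`, and the second derivative along `w` is `2A ≠ 0`. -/
theorem fderiv_fderiv_eq_zero_iff_of_homogeneous (hΩ : IsOpen Ω) (hQ : ContDiffOn ℝ ∞ Q Ω)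
    (hP : ∀ z, P (P z) = P z)
    (hhom : ∀ z ∈ Ω, ∀ c ∈ Icc (0 : ℝ) 1, Q (z + (c - 1) • P z) = c ^ 2 * Q z)
    (hpos : ∀ z ∈ Ω, P z ≠ 0 → 0 < Q z) {z : E} (hz : z ∈ Ω) (hz0 : P z = 0) (v : E) :
    fderiv ℝ (fderiv ℝ Q) z v = 0 ↔ P v = 0 := by
  have hd : ∀ z ∈ Ω, DifferentiableAt ℝ Q z := fun z hz =>
    (hQ.contDiffAt (hΩ.mem_nhds hz)).differentiableAt (by simp)
  have hd2 : DifferentiableAt ℝ (fderiv ℝ Q) z :=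
    ((hQ.contDiffAt (hΩ.mem_nhds hz)).fderiv_right (m := ∞) (by norm_num)).differentiableAt
      (by simp)
  have hline : ∀ u : E, HasDerivAt (fun t : ℝ => z + t • u) u 0 := fun u => by
    simpa using ((hasDerivAt_id (0 : ℝ)).smul_const u).const_add z
  have hcline : ∀ u : E, ∀ᶠ t : ℝ in 𝓝 0, z + t • u ∈ Ω := fun u =>
    (hline u).continuousAt.eventually_mem (hΩ.mem_nhds (by simpa using hz))
  have hD : ∀ u : E, HasDerivAt (fun t : ℝ => fderiv ℝ Q (z + t • u))
      (fderiv ℝ (fderiv ℝ Q) z u) 0 := fun u => by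
    have h1 : HasFDerivAt (fderiv ℝ Q) (fderiv ℝ (fderiv ℝ Q) z) (z + (0 : ℝ) • u) := by
      simpa using hd2.hasFDerivAt
    exact h1.comp_hasDerivAt (0 : ℝ) (hline u)
  have hker : ∀ u, P u = 0 → fderiv ℝ (fderiv ℝ Q) z u = 0 := by
    intro u hu
    refine (hD u).unique ((hasDerivAt_const (0 : ℝ) (0 : E →L[ℝ] ℝ)).congr_of_eventuallyEq ?_)
    filter_upwards [hcline u] with t ht
    exact (fderiv_eq_zero_iff_of_homogeneous hΩ hQ hhom hpos ht).2 (by simp [hz0, hu])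
  refine ⟨fun h => ?_, hker v⟩
  by_contra hw
  set w := P v with hwdef
  have hPw : P w = w := hP v
  have hDw : fderiv ℝ (fderiv ℝ Q) z w = 0 := by
    have h1 := hker (v - w) (by rw [map_sub, hPw, ← hwdef, sub_self])
    rw [map_sub, h, zero_sub, neg_eq_zero] at h1
    exact h1
  obtain ⟨ε, hε, hball⟩ := Metric.eventually_nhds_iff.1 (hcline w)
  -- Half of `ε`, so that the closed segment `[0, r]` stays in the domain. Its endpoint is the
  -- reference point from which all shorter multiples are obtained by a scalar `t / r ≤ 1`.
  set r := ε / 2 with hr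
  have hr0 : 0 < r := half_pos hε
  have hmem : ∀ t ∈ Icc 0 r, z + t • w ∈ Ω := fun t ht => hball (by
    rw [Real.dist_eq, sub_zero, abs_of_nonneg ht.1]
    linarith [ht.2])
  have hA : 0 < Q (z + r • w) := hpos _ (hmem r ⟨hr0.le, le_rfl⟩) (by
    rw [map_add, hz0, map_smul, hPw, zero_add]
    exact smul_ne_zero hr0.ne' hw)
  set A := Q (z + r • w) / r ^ 2 with hAdef
  have hA0 : 0 < A := by positivity
  have hk : ∀ t ∈ Icc 0 r, Q (z + t • w) = A * t ^ 2 := by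
    intro t ht
    have h1 := hhom _ (hmem r ⟨hr0.le, le_rfl⟩) (t / r)
      ⟨div_nonneg ht.1 hr0.le, (div_le_one hr0).2 ht.2⟩
    have h2 : z + r • w + (t / r - 1) • P (z + r • w) = z + t • w := by
      rw [map_add, hz0, map_smul, hPw, zero_add, add_assoc, smul_smul, ← add_smul]
      congr 2
      field_simp
      ring
    rw [h2] at h1
    rw [h1, hAdef]
    field_simp
  have hud := uniqueDiffOn_Icc hr0
  have hk' : ∀ t ∈ Icc 0 r, fderiv ℝ Q (z + t • w) w = 2 * A * t := by
    intro t ht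
    have hl : HasDerivAt (fun t : ℝ => z + t • w) w t := by
      simpa using ((hasDerivAt_id t).smul_const w).const_add z
    have h1 : HasDerivWithinAt (fun t : ℝ => Q (z + t • w)) (fderiv ℝ Q (z + t • w) w) (Icc 0 r) t :=
      ((hd _ (hmem t ht)).hasFDerivAt.comp_hasDerivAt t hl).hasDerivWithinAt
    have h2 : HasDerivWithinAt (fun t : ℝ => A * t ^ 2) (A * (2 * t)) (Icc 0 r) t := by
      simpa using ((hasDerivAt_pow 2 t).const_mul A).hasDerivWithinAt
    rw [(hud t ht).eq_deriv _ h1 (h2.congr hk (hk t ht))]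
    ring
  have h0 : (0 : ℝ) ∈ Icc 0 r := ⟨le_rfl, hr0.le⟩
  have h3 : HasDerivWithinAt (fun t : ℝ => fderiv ℝ Q (z + t • w) w) 0 (Icc 0 r) 0 := by
    have := (hD w).clm_apply (hasDerivAt_const (0 : ℝ) w)
    simpa [hDw] using this.hasDerivWithinAt
  have h4 : HasDerivWithinAt (fun t : ℝ => 2 * A * t) (2 * A) (Icc 0 r) 0 := by
    simpa using ((hasDerivAt_id (0 : ℝ)).const_mul (2 * A)).hasDerivWithinAt
  have := (hud 0 h0).eq_deriv _ h3 (h4.congr hk' (hk' 0 h0))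
  linarith

end Homogeneous


/-! ### Definite functions on vector bundles -/

/-- Points of one fibre are separated inside a trivialization; points of different fibres are
separated by the projection to the base. -/
theorem t2Space_totalSpace {B F : Type*} [TopologicalSpace B] [T2Space B] [TopologicalSpace F]
    [T2Space F] {W : B → Type*} [∀ b, TopologicalSpace (W b)] [TopologicalSpace (TotalSpace F W)]
    [FiberBundle F W] : T2Space (TotalSpace F W) := by
  refine ⟨fun x y hxy => ?_⟩
  by_cases h : x.proj = y.proj
  · set e := (trivializationAt F W x.proj).toOpenPartialHomeomorph with he
    have hx : x ∈ e.source := (trivializationAt F W x.proj).mem_source.2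
      (FiberBundle.mem_baseSet_trivializationAt' _)
    have hy : y ∈ e.source := (trivializationAt F W x.proj).mem_source.2 (by
      rw [← h]
      exact FiberBundle.mem_baseSet_trivializationAt' _)
    have : T2Space e.source := e.toHomeomorphSourceTarget.isEmbedding.t2Space
    have hxy' : (⟨x, hx⟩ : e.source) ≠ ⟨y, hy⟩ := fun h => hxy (congrArg Subtype.val h)
    exact separated_by_isOpenEmbedding e.open_source.isOpenEmbedding_subtypeVal hxy'
  · exact separated_by_continuous (FiberBundle.continuous_proj F W) h

/-! ### Evenness and properness of definite functions -/

section Bundles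

variable {m : ℕ} {B : Type*} [TopologicalSpace B]
  {F : Type*} [NormedAddCommGroup F] [NormedSpace ℝ F]
  {W : B → Type*} [∀ b, AddCommGroup (W b)] [∀ b, Module ℝ (W b)]
  [∀ b, TopologicalSpace (W b)] [TopologicalSpace (TotalSpace F W)] [FiberBundle F W]
  [VectorBundle ℝ F W]

theorem trivializationAt_smulTot (b : B) {x : TotalSpace F W}
    (hx : x.proj ∈ (trivializationAt F W b).baseSet) (c : ℝ) :
    trivializationAt F W b (smulTot c x) = (x.proj, c • (trivializationAt F W b x).2) := by
  have h1 : (trivializationAt F W b (smulTot c x)).2 = c • (trivializationAt F W b x).2 :=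
    ((trivializationAt F W b).linear ℝ hx).map_smul c x.2
  rw [← h1]
  refine Prod.ext ?_ rfl
  exact (trivializationAt F W b).coe_fst' (x := smulTot c x) hx

theorem trivializationAt_snd_eq_zero_iff (b : B) {x : TotalSpace F W}
    (hx : x.proj ∈ (trivializationAt F W b).baseSet) :
    (trivializationAt F W b x).2 = 0 ↔ x.2 = 0 := by
  have h0 : (trivializationAt F W b (smulTot 0 x)).2 = 0 := by
    rw [trivializationAt_smulTot b hx, zero_smul]
  constructor
  · intro h
    have h1 : trivializationAt F W b x = trivializationAt F W b (smulTot 0 x) := by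
      rw [trivializationAt_smulTot b hx, zero_smul]
      exact Prod.ext ((trivializationAt F W b).coe_fst' hx) h
    have h2 : x = smulTot 0 x := (trivializationAt F W b).injOn
      ((trivializationAt F W b).mem_source.2 hx)
      ((trivializationAt F W b).mem_source.2 (by exact hx)) h1
    rw [h2]
    exact zero_smul ℝ x.2
  · intro h
    have h2 : smulTot 0 x = x := by
      obtain ⟨b', v⟩ := x
      simp only at h
      simp [smulTot, h]
    rwa [h2] at h0

variable [ChartedSpace (EuclideanSpace ℝ (Fin m)) B]

namespace DefiniteFun

variable (q : DefiniteFun m F W)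

omit [VectorBundle ℝ F W] in
theorem eq_zero_iff {x : TotalSpace F W} : q.toFun x = 0 ↔ x.2 = 0 :=
  ⟨fun h => by_contra fun h0 => (q.definite x h0).ne' h, q.map_zero⟩

/-- A definite homogeneous function is even, being twice differentiable at the zero section. -/
theorem map_smulTot (t : ℝ) (x : TotalSpace F W) : q.toFun (smulTot t x) = t ^ 2 * q.toFun x := by
  set g : ℝ → ℝ := fun t => q.toFun (smulTot t x) with hg
  have hgs : ContDiff ℝ ∞ g := by
    rw [← contMDiff_iff_contDiff]
    exact fun t => (q.contMDiff _).comp t (contMDiffAt_smulTot (m := m) contMDiffAt_id contMDiffAt_const)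
  have hp : ∀ t, 0 ≤ t → g t = t ^ 2 * g 1 := fun t ht => by
    rw [hg]
    simp only [smulTot_one]
    exact q.homog t ht x
  have hn : ∀ t, t ≤ 0 → g t = t ^ 2 * g (-1) := fun t ht => by
    have := q.homog (-t) (by linarith) (smulTot (-1) x)
    rw [smulTot_smulTot] at this
    simpa [hg] using this
  have hd : ∀ t, DifferentiableAt ℝ g t := fun t => (hgs.differentiable (by simp)) t
  have hd2 : DifferentiableAt ℝ (deriv g) 0 :=
    ((hgs.of_le (m := 2) (WithTop.coe_le_coe.2 le_top)).iterate_deriv' 1 1).differentiable (by simp) 0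
  -- The second derivative at 0 can be computed from either half-line: it is `2 g(1)` from the right
  -- and `2 g(-1)` from the left, so the two coefficients agree.
  have key : ∀ (s : Set ℝ) (A : ℝ), UniqueDiffOn ℝ s → (0 : ℝ) ∈ s → (∀ t ∈ s, g t = t ^ 2 * A) →
      deriv (deriv g) 0 = 2 * A := by
    intro s A hs h0 hA
    have h1 : ∀ t ∈ s, deriv g t = 2 * t * A := by
      intro t ht
      have h2 : HasDerivWithinAt (fun t : ℝ => t ^ 2 * A) (2 * t * A) s t := by
        simpa using ((hasDerivAt_pow 2 t).mul_const A).hasDerivWithinAt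
      exact (hs t ht).eq_deriv _ (hd t).hasDerivAt.hasDerivWithinAt (h2.congr hA (hA t ht))
    have h3 : HasDerivWithinAt (fun t : ℝ => 2 * t * A) (2 * A) s 0 := by
      simpa using (((hasDerivAt_id (0 : ℝ)).const_mul 2).mul_const A).hasDerivWithinAt
    exact (hs 0 h0).eq_deriv _ hd2.hasDerivAt.hasDerivWithinAt (h3.congr h1 (h1 0 h0))
  have h1 := key (Ici 0) (g 1) (uniqueDiffOn_Ici 0) (mem_Ici.2 le_rfl) fun t ht => hp t ht
  have h2 := key (Iic 0) (g (-1)) (uniqueDiffOn_Iic 0) (mem_Iic.2 le_rfl) fun t ht => hn t ht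
  have h3 : g (-1) = g 1 := by linarith
  have h4 : g t = t ^ 2 * g 1 := by
    rcases le_total 0 t with h | h
    · exact hp t h
    · rw [hn t h, h3]
  simpa [hg, smulTot_one] using h4

/-- Over a compact `K` inside a trivializing set, `q` has a positive lower bound `δ` on the unit
sphere of the model fibre. By homogeneity `δ ‖v‖² ≤ q ≤ c`, so the sublevel set over `K` lies in the
compact `K × closedBall 0 √(c/δ)`. Finitely many such `K` cover the base. -/
theorem isCompact_le [T2Space B] [CompactSpace B] [FiniteDimensional ℝ F] (c : ℝ) :
    IsCompact {x | q.toFun x ≤ c} := by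
  have : ProperSpace F := FiniteDimensional.proper ℝ F
  have hloc : ∀ b : B, ∃ K ∈ 𝓝 b, ∃ C : Set (TotalSpace F W), IsCompact C ∧
      ∀ x, x.proj ∈ K → q.toFun x ≤ c → x ∈ C := by
    intro b
    set e := trivializationAt F W b with he
    obtain ⟨K, hKn, hKb, hK⟩ := local_compact_nhds
      (e.open_baseSet.mem_nhds (FiberBundle.mem_baseSet_trivializationAt' b))
    have himg : ∀ D : Set F, IsCompact D →
        IsCompact (e.toOpenPartialHomeomorph.symm '' (K ×ˢ D)) := fun D hD =>
      (hK.prod hD).image_of_continuousOn (e.toOpenPartialHomeomorph.continuousOn_symm.mono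
        fun p hp => e.mem_target.2 (hKb hp.1))
    have hmem : ∀ (D : Set F) (x : TotalSpace F W), x.proj ∈ K → (e x).2 ∈ D →
        x ∈ e.toOpenPartialHomeomorph.symm '' (K ×ˢ D) := fun D x hx hxD => by
      refine ⟨e x, ⟨?_, hxD⟩, e.toOpenPartialHomeomorph.left_inv (e.mem_source.2 (hKb hx))⟩
      rwa [e.coe_fst' (hKb hx)]
    obtain ⟨δ, hδ, hδS⟩ : ∃ δ > 0, ∀ y ∈ e.toOpenPartialHomeomorph.symm ''
        (K ×ˢ Metric.sphere (0 : F) 1), δ ≤ q.toFun y := by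
      -- The sphere is empty for rank zero; any positive `δ` then serves.
      rcases (e.toOpenPartialHomeomorph.symm '' (K ×ˢ Metric.sphere (0 : F) 1)).eq_empty_or_nonempty
        with h | h
      · exact ⟨1, one_pos, by simp [h]⟩
      · obtain ⟨y, hy, hmin⟩ := (himg _ (isCompact_sphere _ _)).exists_isMinOn h
          q.continuous.continuousOn
        refine ⟨q.toFun y, ?_, fun z hz => hmin hz⟩
        obtain ⟨p, hp, rfl⟩ := hy
        have hpt : p ∈ e.target := e.mem_target.2 (hKb hp.1)
        have hep : e (e.toOpenPartialHomeomorph.symm p) = p :=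
          e.toOpenPartialHomeomorph.right_inv hpt
        refine q.definite _ fun h0 => ?_
        have hpb : (e.toOpenPartialHomeomorph.symm p).proj ∈ e.baseSet :=
          e.mem_source.1 (e.toOpenPartialHomeomorph.map_target hpt)
        have := (trivializationAt_snd_eq_zero_iff b hpb).2 h0
        rw [← he, hep] at this
        have h1 := hp.2
        rw [this] at h1
        simp at h1
    refine ⟨K, hKn, _, himg (Metric.closedBall 0 √(c / δ)) (isCompact_closedBall _ _),
      fun x hx hxc => hmem _ x hx ?_⟩
    rw [mem_closedBall_zero_iff]
    by_cases h0 : (e x).2 = 0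
    · rw [h0, norm_zero]
      positivity
    · have hv : 0 < ‖(e x).2‖ := norm_pos_iff.2 h0
      have h1 : δ ≤ q.toFun (smulTot ‖(e x).2‖⁻¹ x) := by
        refine hδS _ (hmem _ _ hx ?_)
        rw [he, trivializationAt_smulTot b (hKb hx), ← he]
        simp [norm_smul, hv.ne']
      rw [q.homog _ (by positivity)] at h1
      refine Real.le_sqrt_of_sq_le ?_
      rw [le_div_iff₀ hδ]
      have h2 : ‖(e x).2‖ ^ 2 * δ ≤ ‖(e x).2‖ ^ 2 * (‖(e x).2‖⁻¹ ^ 2 * q.toFun x) := by gcongr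
      have h3 : ‖(e x).2‖ ^ 2 * (‖(e x).2‖⁻¹ ^ 2 * q.toFun x) = q.toFun x := by
        field_simp
      linarith
  choose K hK C hC hKC using hloc
  obtain ⟨t, ht⟩ := CompactSpace.elim_nhds_subcover K hK
  refine (t.isCompact_biUnion fun b _ => hC b).of_isClosed_subset
    (isClosed_le q.continuous continuous_const) fun x hx => ?_
  have : x.proj ∈ ⋃ b ∈ t, K b := by rw [ht]; trivial
  obtain ⟨b, hb, hxb⟩ := mem_iUnion₂.1 this
  exact mem_iUnion₂.2 ⟨b, hb, hKC b x hxb hx⟩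

end DefiniteFun

end Bundles

/-! ### Disk bundles inside a manifold -/

section DiskPiece

variable {m : ℕ} {B : Type*} [TopologicalSpace B] [ChartedSpace (EuclideanSpace ℝ (Fin m)) B]
  {F : Type*} [NormedAddCommGroup F] [NormedSpace ℝ F]
  {W : B → Type*} [∀ b, AddCommGroup (W b)] [∀ b, Module ℝ (W b)]
  [∀ b, TopologicalSpace (W b)] [TopologicalSpace (TotalSpace F W)] [FiberBundle F W]
  {E : Type*} [NormedAddCommGroup E] [NormedSpace ℝ E]
  {G : Type*} [TopologicalSpace G] [ChartedSpace E G] {q : DefiniteFun m F W}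

/-- A linear chart of the disk bundle in the ambient space, along which multiplication of vectors
by scalars becomes an affine map. -/
theorem exists_scaleChart [VectorBundle ℝ F W] {j : q.disk → G} (hj : IsOpenEmbedding j)
    (L : (EuclideanSpace ℝ (Fin m) × F) ≃L[ℝ] E)
    (hatlas : ∀ x : q.disk, pieceChart (H := ModelProd (EuclideanSpace ℝ (Fin m)) F) hj
      L.toHomeomorph (chartAt (ModelProd (EuclideanSpace ℝ (Fin m)) F) x) ∈ atlas E G)
    (x : q.disk) : ∃ e ∈ atlas E G, ∃ P : E →L[ℝ] E, (∀ v, P (P v) = P v) ∧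
      j x ∈ e.source ∧ e.source ⊆ range j ∧
      ∀ y : q.disk, j y ∈ e.source → (P (e (j y)) = 0 ↔ (y : TotalSpace F W).2 = 0) ∧
        ∀ (c : ℝ) (hc : smulTot c (y : TotalSpace F W) ∈ q.disk), j ⟨_, hc⟩ ∈ e.source ∧
          e (j ⟨_, hc⟩) = e (j y) + (c - 1) • P (e (j y)) := by
  set c₀ := chartAt (ModelProd (EuclideanSpace ℝ (Fin m)) F) x with hc₀
  set τ := trivializationAt F W (x : TotalSpace F W).proj with hτ
  set χ := chartAt (EuclideanSpace ℝ (Fin m)) (x : TotalSpace F W).proj with hχ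
  have hsource : ∀ y : q.disk, y ∈ c₀.source ↔ (y : TotalSpace F W).proj ∈ τ.baseSet ∧
      (y : TotalSpace F W).proj ∈ χ.source := by
    intro y
    change y ∈ (OpenPartialHomeomorph.subtypeRestr _ ⟨x⟩).source ↔ _
    rw [OpenPartialHomeomorph.subtypeRestr_source, mem_preimage, FiberBundle.chartedSpace_chartAt]
    simp only [OpenPartialHomeomorph.trans_source, OpenPartialHomeomorph.prod_source, mem_inter_iff,
      mem_preimage, mem_prod, OpenPartialHomeomorph.refl_source, mem_univ, and_true]
    change _ ∈ τ.source ∧ (τ _).1 ∈ χ.source ↔ _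
    rw [τ.mem_source]
    refine and_congr_right fun h => ?_
    rw [τ.coe_fst' h]
  have happly : ∀ y : q.disk, c₀ y = (χ (τ y).1, (τ y).2) := by
    intro y
    change chartAt (ModelProd (EuclideanSpace ℝ (Fin m)) F) (x : TotalSpace F W) y = _
    rw [FiberBundle.chartedSpace_chartAt]
    rfl
  -- Scaling the fibre coordinate by `c` adds `(c - 1)` times the fibre component, so the projection
  -- onto that component is the required `P` before transport by `L`.
  set P₀ : (EuclideanSpace ℝ (Fin m) × F) →L[ℝ] (EuclideanSpace ℝ (Fin m) × F) :=
    (ContinuousLinearMap.inr ℝ _ F).comp (ContinuousLinearMap.snd ℝ _ F) with hP₀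
  set P : E →L[ℝ] E := (L : _ →L[ℝ] E).comp (P₀.comp (L.symm : E →L[ℝ] _)) with hP
  have hPL : ∀ p, P (L p) = L (0, p.2) := fun p => by simp [hP, hP₀]
  refine ⟨_, hatlas x, P, fun v => ?_, ?_, ?_, fun y hy => ?_⟩
  · obtain ⟨p, rfl⟩ := L.surjective v
    rw [hPL, hPL]
  · exact (mem_pieceChart_source _ _ _).2 (mem_chart_source _ _)
  · rw [pieceChart_source]
    exact image_subset_range _ _
  · rw [mem_pieceChart_source] at hy
    have hyb := (hsource y).1 hy
    have hey : ∀ z : q.disk, pieceChart (H := ModelProd (EuclideanSpace ℝ (Fin m)) F) hj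
        L.toHomeomorph c₀ (j z) = L (χ (τ z).1, (τ z).2) := fun z => by
      rw [pieceChart_apply, happly]
      rfl
    refine ⟨?_, fun c hc => ⟨?_, ?_⟩⟩
    · rw [hey, hPL, L.map_eq_zero_iff, ← trivializationAt_snd_eq_zero_iff _ hyb.1]
      simp [hτ]
    · exact (mem_pieceChart_source _ _ _).2 ((hsource _).2 hyb)
    · rw [hey, hey, hPL, ← map_smul, ← map_add]
      congr 1
      simp only
      rw [hτ, trivializationAt_smulTot _ hyb.1, ← hτ, τ.coe_fst' hyb.1]
      refine Prod.ext (by simp) ?_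
      change c • (τ y).2 = (τ y).2 + (c - 1) • (τ y).2
      rw [sub_smul, one_smul, add_sub_cancel]

end DiskPiece


/-! ### Linear models, local diffeomorphisms and derivatives in charts -/

section Models

variable {A F E : Type*} [NormedAddCommGroup A] [NormedSpace ℝ A] [NormedAddCommGroup F]
  [NormedSpace ℝ F] [NormedAddCommGroup E] [NormedSpace ℝ E] (L : (A × F) ≃L[ℝ] E)

theorem contMDiff_modelProd :
    ContMDiff (𝓘(ℝ, A).prod 𝓘(ℝ, F)) 𝓘(ℝ, E) ∞ (fun p : ModelProd A F => L p) := by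
  rw [← modelWithCornersSelf_prod]
  exact L.contDiff.contMDiff

theorem contMDiff_modelProd_symm :
    ContMDiff (M' := ModelProd A F) (H' := ModelProd A F) 𝓘(ℝ, E) (𝓘(ℝ, A).prod 𝓘(ℝ, F)) ∞
      (fun v => L.symm v) := by
  rw [← modelWithCornersSelf_prod]
  exact L.symm.contDiff.contMDiff

end Models

theorem contMDiffAt_of_comp_isLocalDiffeomorphAt {E₁ E₂ E₃ H₁ H₂ H₃ X Y Z : Type*}
    [NormedAddCommGroup E₁] [NormedSpace ℝ E₁] [TopologicalSpace H₁]
    [NormedAddCommGroup E₂] [NormedSpace ℝ E₂] [TopologicalSpace H₂]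
    [NormedAddCommGroup E₃] [NormedSpace ℝ E₃] [TopologicalSpace H₃]
    {I₁ : ModelWithCorners ℝ E₁ H₁} {I₂ : ModelWithCorners ℝ E₂ H₂} {I₃ : ModelWithCorners ℝ E₃ H₃}
    [TopologicalSpace X] [ChartedSpace H₁ X] [TopologicalSpace Y] [ChartedSpace H₂ Y]
    [TopologicalSpace Z] [ChartedSpace H₃ Z] {j : X → Y} {x : X}
    (hj : IsLocalDiffeomorphAt I₁ I₂ ∞ j x) {f : Y → Z}
    (hf : ContMDiffAt I₁ I₃ ∞ (fun x => f (j x)) x) : ContMDiffAt I₂ I₃ ∞ f (j x) := by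
  have h1 : hj.localInverse (j x) = x := hj.localInverse_left_inv hj.localInverse_mem_target
  have h2 : ContMDiffAt I₂ I₃ ∞ (fun y => f (j (hj.localInverse y))) (j x) := by
    refine ContMDiffAt.comp (g := fun x => f (j x)) (j x) ?_ hj.localInverse_contMDiffAt
    rwa [h1]
  refine h2.congr_of_eventuallyEq ?_
  filter_upwards [hj.localInverse_eventuallyEq_right] with y hy
  exact congrArg f hy.symm

/-! ### Critical points of functions read in a chart -/

section Charts

variable {E : Type*} [NormedAddCommGroup E] [NormedSpace ℝ E] {G : Type*} [TopologicalSpace G]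
  [ChartedSpace E G] {e : OpenPartialHomeomorph G E} {g : G → ℝ}

theorem contDiffOn_comp_chart_symm (he : e ∈ IsManifold.maximalAtlas 𝓘(ℝ, E) ∞ G)
    (hg : ContMDiff 𝓘(ℝ, E) 𝓘(ℝ) ∞ g) : ContDiffOn ℝ ∞ (g ∘ e.symm) e.target := fun z hz =>
  (ContMDiffAt.contDiffAt ((hg (e.symm z)).comp z
    (contMDiffAt_symm_of_mem_maximalAtlas he hz))).contDiffWithinAt

theorem mfderiv_eq_zero_iff_of_mem_maximalAtlas (he : e ∈ IsManifold.maximalAtlas 𝓘(ℝ, E) ∞ G)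
    (hg : ContMDiff 𝓘(ℝ, E) 𝓘(ℝ) ∞ g) {y : G} (hy : y ∈ e.source) :
    mfderiv 𝓘(ℝ, E) 𝓘(ℝ) g y = 0 ↔ fderiv ℝ (g ∘ e.symm) (e y) = 0 := by
  have h1 : MDifferentiableAt 𝓘(ℝ, E) 𝓘(ℝ, E) e y :=
    (contMDiffAt_of_mem_maximalAtlas he hy).mdifferentiableAt (by simp)
  have h2 : MDifferentiableAt 𝓘(ℝ, E) 𝓘(ℝ, E) e.symm (e y) :=
    (contMDiffAt_symm_of_mem_maximalAtlas he (e.map_source hy)).mdifferentiableAt (by simp)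
  have h3 : MDifferentiableAt 𝓘(ℝ, E) 𝓘(ℝ) g (e.symm (e y)) := (hg _).mdifferentiableAt (by simp)
  rw [← mfderiv_eq_fderiv]
  constructor
  · intro h
    rw [mfderiv_comp (e y) h3 h2]
    have h4 : mfderiv 𝓘(ℝ, E) 𝓘(ℝ) g (e.symm (e y)) = 0 := by
      rw [e.left_inv hy]
      exact h
    rw [h4]
    exact ContinuousLinearMap.zero_comp _
  · intro h
    have h5 : g =ᶠ[𝓝 y] (g ∘ e.symm) ∘ e := by
      filter_upwards [e.open_source.mem_nhds hy] with z hz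
      simp [e.left_inv hz]
    rw [h5.mfderiv_eq, mfderiv_comp y (h3.comp (e y) h2) h1, h]
    exact ContinuousLinearMap.zero_comp _

end Charts

/-! ### The glued space -/

namespace SphereDiffeo

variable {m₀ : ℕ} {B₀ : Type*} [TopologicalSpace B₀] [ChartedSpace (EuclideanSpace ℝ (Fin m₀)) B₀]
  {F₀ : Type*} [NormedAddCommGroup F₀] [NormedSpace ℝ F₀]
  {W₀ : B₀ → Type*} [∀ b, AddCommGroup (W₀ b)] [∀ b, Module ℝ (W₀ b)]
  [∀ b, TopologicalSpace (W₀ b)] [TopologicalSpace (TotalSpace F₀ W₀)] [FiberBundle F₀ W₀]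
  [VectorBundle ℝ F₀ W₀]
  {m₁ : ℕ} {B₁ : Type*} [TopologicalSpace B₁] [ChartedSpace (EuclideanSpace ℝ (Fin m₁)) B₁]
  {F₁ : Type*} [NormedAddCommGroup F₁] [NormedSpace ℝ F₁]
  {W₁ : B₁ → Type*} [∀ b, AddCommGroup (W₁ b)] [∀ b, Module ℝ (W₁ b)]
  [∀ b, TopologicalSpace (W₁ b)] [TopologicalSpace (TotalSpace F₁ W₁)] [FiberBundle F₁ W₁]
  [VectorBundle ℝ F₁ W₁]
  {q₀ : DefiniteFun m₀ F₀ W₀} {q₁ : DefiniteFun m₁ F₁ W₁} (ψ : SphereDiffeo q₀ q₁)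

theorem isOpenEmbedding_inl : IsOpenEmbedding ψ.inl :=
  isOpenEmbedding_glueInl ψ.gluingMap q₁.isOpen_punctured

theorem isOpenEmbedding_inr : IsOpenEmbedding ψ.inr :=
  isOpenEmbedding_glueInr ψ.gluingMap q₀.isOpen_punctured

theorem fn_inl (x : q₀.disk) : (ψ.fn (ψ.inl x) : ℝ) = q₀.toFun x := rfl

theorem fn_inr (y : q₁.disk) : (ψ.fn (ψ.inr y) : ℝ) = 1 - q₁.toFun y := rfl

theorem inl_eq_inr_gluingMap (x : q₀.punctured) : ψ.inl x = ψ.inr (ψ.gluingMap x) :=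
  (glueInl_eq_glueInr ψ.gluingMap.toEquiv).2 ⟨x, rfl, rfl⟩

theorem inl_eq_inr {x : q₀.disk} {y : q₁.disk} :
    ψ.inl x = ψ.inr y ↔ ∃ u : q₀.punctured, u = x ∧ ψ.gluingMap u = y :=
  glueInl_eq_glueInr ψ.gluingMap.toEquiv

theorem exists_inl_or_inr (z : ψ.Glued) : (∃ x, ψ.inl x = z) ∨ ∃ y, ψ.inr y = z :=
  exists_glue _ z

theorem exists_inl_eq {z : ψ.Glued} (hz : (ψ.fn z : ℝ) < 1) : ∃ x, ψ.inl x = z := by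
  obtain h | ⟨y, rfl⟩ := ψ.exists_inl_or_inr z
  · exact h
  · rw [fn_inr] at hz
    have hy : y ∈ q₁.punctured := q₁.mem_punctured_iff.2 (by linarith)
    refine ⟨ψ.gluingMap.symm ⟨y, hy⟩, ?_⟩
    rw [inl_eq_inr_gluingMap, Homeomorph.apply_symm_apply]

theorem exists_inr_eq {z : ψ.Glued} (hz : 0 < (ψ.fn z : ℝ)) : ∃ y, ψ.inr y = z := by
  obtain ⟨x, rfl⟩ | h := ψ.exists_inl_or_inr z
  · rw [fn_inl] at hz
    have hx : x ∈ q₀.punctured := q₀.mem_punctured_iff.2 hz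
    exact ⟨_, (ψ.inl_eq_inr_gluingMap ⟨x, hx⟩).symm⟩
  · exact h

theorem leaf_zero : leaf ψ.fn 0 = ψ.inl '' {x | (x : TotalSpace F₀ W₀).2 = 0} := by
  ext z
  constructor
  · intro hz
    have hz' : ψ.fn z = 0 := hz
    obtain ⟨x, rfl⟩ := ψ.exists_inl_eq (z := z) (by rw [hz']; exact zero_lt_one)
    refine ⟨x, q₀.eq_zero_iff.1 ?_, rfl⟩
    rw [← ψ.fn_inl, hz']
    rfl
  · rintro ⟨x, hx, rfl⟩
    exact Subtype.ext (q₀.map_zero hx)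

theorem leaf_one : leaf ψ.fn 1 = ψ.inr '' {x | (x : TotalSpace F₁ W₁).2 = 0} := by
  ext z
  constructor
  · intro hz
    have hz' : ψ.fn z = 1 := hz
    obtain ⟨x, rfl⟩ := ψ.exists_inr_eq (z := z) (by rw [hz']; exact zero_lt_one)
    refine ⟨x, q₁.eq_zero_iff.1 ?_, rfl⟩
    have := ψ.fn_inr x
    rw [hz', Icc.coe_one] at this
    linarith
  · rintro ⟨x, hx, rfl⟩
    refine Subtype.ext ?_
    rw [fn_inr, q₁.map_zero hx, sub_zero]
    rfl

theorem continuous_fn : Continuous ψ.fn := by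
  refine Continuous.subtype_mk (f := fun z => (ψ.fn z : ℝ)) ?_ (fun z => (ψ.fn z).2)
  rw [continuous_iff_continuousAt]
  intro z
  obtain ⟨x, rfl⟩ | ⟨y, rfl⟩ := ψ.exists_inl_or_inr z
  · rw [ψ.isOpenEmbedding_inl.continuousAt_iff.symm]
    exact (q₀.continuous.comp continuous_subtype_val).continuousAt
  · rw [ψ.isOpenEmbedding_inr.continuousAt_iff.symm]
    exact (continuous_const.sub (q₁.continuous.comp continuous_subtype_val)).continuousAt

theorem surjective_fn (hne : q₀.sphere.Nonempty) : Function.Surjective ψ.fn := by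
  intro t
  obtain ⟨v, hv⟩ := hne
  rcases t.2.2.lt_or_eq with ht | ht
  · have h : q₀.toFun (smulTot √(t : ℝ) v) = t := by
      rw [q₀.homog _ (Real.sqrt_nonneg _), show q₀.toFun v = 1 from hv, Real.sq_sqrt t.2.1, mul_one]
    exact ⟨ψ.inl ⟨smulTot √(t : ℝ) v, show _ < (1 : ℝ) by rwa [h]⟩, Subtype.ext h⟩
  -- The value 1 is not attained on the first disk bundle. A point of the second zero section is
  -- found in the fibre through `ψ(v)`, which also shows that `B₁` is not empty.
  · set w : TotalSpace F₁ W₁ := smulTot 0 (ψ.toEquiv ⟨v, hv⟩ : TotalSpace F₁ W₁)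
    have h : q₁.toFun w = 0 := q₁.map_zero (zero_smul ℝ _)
    refine ⟨ψ.inr ⟨w, show _ < (1 : ℝ) by rw [h]; exact one_pos⟩, Subtype.ext ?_⟩
    rw [fn_inr, h, ht, sub_zero]

/-- Points on different levels are separated by `f`. Points on the same level lie in a common open
disk bundle, which is Hausdorff. -/
theorem t2Space [T2Space B₀] [T2Space B₁] : T2Space ψ.Glued := by
  have : T2Space (TotalSpace F₀ W₀) := t2Space_totalSpace
  have : T2Space (TotalSpace F₁ W₁) := t2Space_totalSpace
  refine ⟨fun z z' hz => ?_⟩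
  by_cases h : ψ.fn z = ψ.fn z'
  · rcases (ψ.fn z).2.2.lt_or_eq with h1 | h1
    · obtain ⟨x, rfl⟩ := ψ.exists_inl_eq h1
      obtain ⟨x', rfl⟩ := ψ.exists_inl_eq (h ▸ h1)
      exact separated_by_isOpenEmbedding ψ.isOpenEmbedding_inl fun h => hz (congrArg _ h)
    · have h2 : 0 < (ψ.fn z : ℝ) := by rw [h1]; exact one_pos
      obtain ⟨x, rfl⟩ := ψ.exists_inr_eq h2
      obtain ⟨x', rfl⟩ := ψ.exists_inr_eq (h ▸ h2)
      exact separated_by_isOpenEmbedding ψ.isOpenEmbedding_inr fun h => hz (congrArg _ h)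
  · exact separated_by_continuous ψ.continuous_fn h

/-- The sets `f ≤ 1/2` and `f ≥ 1/2` are the images of the compact disk bundles `q₀ ≤ 1/2` and `q₁ ≤
1/2`. -/
theorem compactSpace [T2Space B₀] [CompactSpace B₀] [T2Space B₁] [CompactSpace B₁]
    [FiniteDimensional ℝ F₀] [FiniteDimensional ℝ F₁] : CompactSpace ψ.Glued := by
  have h0 : IsCompact {x : q₀.disk | q₀.toFun x ≤ 1 / 2} := by
    rw [Subtype.isCompact_iff]
    convert q₀.isCompact_le (1 / 2) using 1
    ext x
    refine ⟨?_, fun hx => ?_⟩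
    · rintro ⟨x, hx, rfl⟩
      exact hx
    · have hx' : q₀.toFun x ≤ 1 / 2 := hx
      exact ⟨⟨x, show _ < (1 : ℝ) by linarith⟩, hx, rfl⟩
  have h1 : IsCompact {x : q₁.disk | q₁.toFun x ≤ 1 / 2} := by
    rw [Subtype.isCompact_iff]
    convert q₁.isCompact_le (1 / 2) using 1
    ext x
    refine ⟨?_, fun hx => ?_⟩
    · rintro ⟨x, hx, rfl⟩
      exact hx
    · have hx' : q₁.toFun x ≤ 1 / 2 := hx
      exact ⟨⟨x, show _ < (1 : ℝ) by linarith⟩, hx, rfl⟩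
  refine ⟨((h0.image ψ.isOpenEmbedding_inl.continuous).union
    (h1.image ψ.isOpenEmbedding_inr.continuous)).of_isClosed_subset isClosed_univ fun z _ => ?_⟩
  rcases le_total (ψ.fn z : ℝ) (1 / 2) with hz | hz
  · obtain ⟨x, rfl⟩ := ψ.exists_inl_eq (z := z) (by linarith)
    exact Or.inl ⟨x, hz, rfl⟩
  · obtain ⟨x, rfl⟩ := ψ.exists_inr_eq (z := z) (by linarith)
    rw [fn_inr] at hz
    refine Or.inr ⟨x, ?_, rfl⟩
    change q₁.toFun x ≤ 1 / 2
    linarith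

theorem exists_germ_inl_inr {x : q₀.disk} {y : q₁.disk} (h : ψ.inl x = ψ.inr y) :
    ∃ g : q₀.disk → q₁.disk, ContMDiffAt ((𝓡 m₀).prod 𝓘(ℝ, F₀)) ((𝓡 m₁).prod 𝓘(ℝ, F₁)) ∞ g x ∧
      ∀ᶠ x' in 𝓝 x, ψ.inr (g x') = ψ.inl x' := by
  classical
  obtain ⟨u, rfl, hu⟩ := ψ.inl_eq_inr.1 h
  obtain ⟨g, hg, hgu⟩ := radialExt_local q₀ q₁ ψ.smooth u
  have hp : ∀ᶠ x' in 𝓝 (u : q₀.disk), x' ∈ q₀.punctured := q₀.isOpen_punctured.mem_nhds u.2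
  -- The gluing map lives only on the punctured disk; the value `y` elsewhere is arbitrary, since
  -- only the germ at a punctured point matters.
  refine ⟨fun x' => if h : x' ∈ q₀.punctured then ψ.gluingMap ⟨x', h⟩ else y, ?_, ?_⟩
  · rw [← ContMDiffAt.subtypeVal_comp_iff]
    refine (contMDiffAt_subtype_iff.2 hg).congr_of_eventuallyEq ?_
    have h1 := (continuous_subtype_val (p := (· ∈ q₀.disk))).continuousAt.eventually hgu
    filter_upwards [hp, h1] with x' h2 h3
    rw [Function.comp_apply, dif_pos h2]
    exact (h3 x'.2 h2).symm
  · filter_upwards [hp] with x' h2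
    rw [dif_pos h2]
    exact (ψ.inl_eq_inr_gluingMap ⟨x', h2⟩).symm

theorem exists_germ_inr_inl {x : q₀.disk} {y : q₁.disk} (h : ψ.inr y = ψ.inl x) :
    ∃ g : q₁.disk → q₀.disk, ContMDiffAt ((𝓡 m₁).prod 𝓘(ℝ, F₁)) ((𝓡 m₀).prod 𝓘(ℝ, F₀)) ∞ g y ∧
      ∀ᶠ y' in 𝓝 y, ψ.inl (g y') = ψ.inr y' := by
  classical
  obtain ⟨u, hu, rfl⟩ := ψ.inl_eq_inr.1 h.symm
  obtain ⟨g, hg, hgu⟩ := radialExt_local q₁ q₀ ψ.smooth_symm (ψ.gluingMap u)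
  have hp : ∀ᶠ y' in 𝓝 (ψ.gluingMap u : q₁.disk), y' ∈ q₁.punctured :=
    q₁.isOpen_punctured.mem_nhds (ψ.gluingMap u).2
  refine ⟨fun y' => if h : y' ∈ q₁.punctured then ψ.gluingMap.symm ⟨y', h⟩ else x, ?_, ?_⟩
  · rw [← ContMDiffAt.subtypeVal_comp_iff]
    refine (contMDiffAt_subtype_iff.2 hg).congr_of_eventuallyEq ?_
    have h1 := (continuous_subtype_val (p := (· ∈ q₁.disk))).continuousAt.eventually hgu
    filter_upwards [hp, h1] with y' h2 h3
    rw [Function.comp_apply, dif_pos h2]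
    exact (h3 y'.2 h2).symm
  · filter_upwards [hp] with y' h2
    rw [dif_pos h2, inl_eq_inr_gluingMap, Homeomorph.apply_symm_apply]

section Manifold

variable [FiniteDimensional ℝ F₀] [FiniteDimensional ℝ F₁] [hne : Nonempty q₀.sphere]

/-- The identification of the local model of the first disk bundle with that of the glued space. -/
def modelEquivLeft (_ψ : SphereDiffeo q₀ q₁) : (EuclideanSpace ℝ (Fin m₀) × F₀) ≃L[ℝ] _ψ.E :=
  ContinuousLinearEquiv.ofFinrankEq (𝕜 := ℝ) (by simp)

/-- The identification of the local model of the second disk bundle with that of the glued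
space. -/
def modelEquivRight : (EuclideanSpace ℝ (Fin m₁) × F₁) ≃L[ℝ] ψ.E :=
  ψ.modelEquiv Set.Nonempty.of_subtype

theorem mem_atlas_glued {e : OpenPartialHomeomorph ψ.Glued ψ.E} : e ∈ atlas ψ.E ψ.Glued ↔
    (∃ c ∈ atlas (ModelProd (EuclideanSpace ℝ (Fin m₀)) F₀) q₀.disk,
      e = pieceChart ψ.isOpenEmbedding_inl ψ.modelEquivLeft.toHomeomorph c) ∨
    ∃ c ∈ atlas (ModelProd (EuclideanSpace ℝ (Fin m₁)) F₁) q₁.disk,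
      e = pieceChart ψ.isOpenEmbedding_inr ψ.modelEquivRight.toHomeomorph c := by
  constructor
  · rintro (⟨_, ⟨c, hc, rfl⟩, rfl⟩ | ⟨_, ⟨c, hc, rfl⟩, rfl⟩)
    · exact Or.inl ⟨c, hc, rfl⟩
    · exact Or.inr ⟨c, hc, rfl⟩
  · rintro (⟨c, hc, rfl⟩ | ⟨c, hc, rfl⟩)
    · exact Or.inl ⟨_, ⟨c, hc, rfl⟩, rfl⟩
    · exact Or.inr ⟨_, ⟨c, hc, rfl⟩, rfl⟩

theorem exists_scaleChart_inl (x : q₀.disk) : ∃ e ∈ atlas ψ.E ψ.Glued, ∃ P : ψ.E →L[ℝ] ψ.E,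
    (∀ v, P (P v) = P v) ∧ ψ.inl x ∈ e.source ∧ e.source ⊆ range ψ.inl ∧
      ∀ y : q₀.disk, ψ.inl y ∈ e.source →
        (P (e (ψ.inl y)) = 0 ↔ (y : TotalSpace F₀ W₀).2 = 0) ∧
        ∀ (c : ℝ) (hc : smulTot c (y : TotalSpace F₀ W₀) ∈ q₀.disk), ψ.inl ⟨_, hc⟩ ∈ e.source ∧
          e (ψ.inl ⟨_, hc⟩) = e (ψ.inl y) + (c - 1) • P (e (ψ.inl y)) :=
  exists_scaleChart ψ.isOpenEmbedding_inl ψ.modelEquivLeft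
    (fun x => ψ.mem_atlas_glued.2 (Or.inl ⟨_, chart_mem_atlas _ x, rfl⟩)) x

theorem exists_scaleChart_inr (x : q₁.disk) : ∃ e ∈ atlas ψ.E ψ.Glued, ∃ P : ψ.E →L[ℝ] ψ.E,
    (∀ v, P (P v) = P v) ∧ ψ.inr x ∈ e.source ∧ e.source ⊆ range ψ.inr ∧
      ∀ y : q₁.disk, ψ.inr y ∈ e.source →
        (P (e (ψ.inr y)) = 0 ↔ (y : TotalSpace F₁ W₁).2 = 0) ∧
        ∀ (c : ℝ) (hc : smulTot c (y : TotalSpace F₁ W₁) ∈ q₁.disk), ψ.inr ⟨_, hc⟩ ∈ e.source ∧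
          e (ψ.inr ⟨_, hc⟩) = e (ψ.inr y) + (c - 1) • P (e (ψ.inr y)) :=
  exists_scaleChart ψ.isOpenEmbedding_inr ψ.modelEquivRight
    (fun x => ψ.mem_atlas_glued.2 (Or.inr ⟨_, chart_mem_atlas _ x, rfl⟩)) x

variable [IsManifold (𝓡 m₀) ∞ B₀] [ContMDiffVectorBundle ∞ F₀ W₀ (𝓡 m₀)]
  [IsManifold (𝓡 m₁) ∞ B₁] [ContMDiffVectorBundle ∞ F₁ W₁ (𝓡 m₁)]

instance isManifold : IsManifold 𝓘(ℝ, ψ.E) ∞ ψ.Glued :=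
  isManifold_of_pieces ψ.isOpenEmbedding_inl ψ.isOpenEmbedding_inr
    (L₁ := ψ.modelEquivLeft.toHomeomorph) (L₂ := ψ.modelEquivRight.toHomeomorph)
    (H₁ := ModelProd (EuclideanSpace ℝ (Fin m₀)) F₀)
    (H₂ := ModelProd (EuclideanSpace ℝ (Fin m₁)) F₁)
    (I₁ := (𝓡 m₀).prod 𝓘(ℝ, F₀)) (I₂ := (𝓡 m₁).prod 𝓘(ℝ, F₁))
    (contMDiff_modelProd _) (contMDiff_modelProd_symm _) (contMDiff_modelProd _)
    (contMDiff_modelProd_symm _) (fun _ _ => ψ.exists_germ_inl_inr)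
    (fun _ _ => ψ.exists_germ_inr_inl) fun _ he => ψ.mem_atlas_glued.1 he

theorem isLocalDiffeomorph_inl :
    IsLocalDiffeomorph ((𝓡 m₀).prod 𝓘(ℝ, F₀)) 𝓘(ℝ, ψ.E) ∞ ψ.inl :=
  isLocalDiffeomorph_of_pieceChart ψ.isOpenEmbedding_inl (L := ψ.modelEquivLeft.toHomeomorph)
    (H₁ := ModelProd (EuclideanSpace ℝ (Fin m₀)) F₀)
    (contMDiff_modelProd _) (contMDiff_modelProd_symm _)
    fun x => ψ.mem_atlas_glued.2 (Or.inl ⟨_, chart_mem_atlas _ x, rfl⟩)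

theorem isLocalDiffeomorph_inr :
    IsLocalDiffeomorph ((𝓡 m₁).prod 𝓘(ℝ, F₁)) 𝓘(ℝ, ψ.E) ∞ ψ.inr :=
  isLocalDiffeomorph_of_pieceChart ψ.isOpenEmbedding_inr (L := ψ.modelEquivRight.toHomeomorph)
    (H₁ := ModelProd (EuclideanSpace ℝ (Fin m₁)) F₁)
    (contMDiff_modelProd _) (contMDiff_modelProd_symm _)
    fun x => ψ.mem_atlas_glued.2 (Or.inr ⟨_, chart_mem_atlas _ x, rfl⟩)

theorem contMDiff_fn : ContMDiff 𝓘(ℝ, ψ.E) 𝓘(ℝ) ∞ fun z => (ψ.fn z : ℝ) := by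
  intro z
  obtain ⟨x, rfl⟩ | ⟨y, rfl⟩ := ψ.exists_inl_or_inr z
  · exact contMDiffAt_of_comp_isLocalDiffeomorphAt (ψ.isLocalDiffeomorph_inl x)
       (contMDiffAt_subtype_iff.2 (q₀.contMDiff _))
  · exact contMDiffAt_of_comp_isLocalDiffeomorphAt (ψ.isLocalDiffeomorph_inr y)
      (contMDiffAt_const.sub (contMDiffAt_subtype_iff.2 (q₁.contMDiff _)))

end Manifold

end SphereDiffeo


/-! ### Radial factors -/

section Radial

/-- The radial factor `√(w(s) / s)` of a function with `w(0) = 0`, extended to `s = 0`. -/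
def radial (w : ℝ → ℝ) (s : ℝ) : ℝ := √(∫ x in (0 : ℝ)..1, derivWithin w (Icc 0 1) (x * s))

variable {w : ℝ → ℝ}

theorem continuousOn_derivWithin_Icc (hw : ContDiffOn ℝ ∞ w (Icc 0 1)) :
    ContinuousOn (derivWithin w (Icc 0 1)) (Icc 0 1) :=
  hw.continuousOn_derivWithin (uniqueDiffOn_Icc zero_lt_one) (by simp)

theorem integral_derivWithin_pos (hw : ContDiffOn ℝ ∞ w (Icc 0 1))
    (hpos : ∀ s ∈ Icc (0 : ℝ) 1, 0 < derivWithin w (Icc 0 1) s) {s : ℝ} (hs : s ∈ Icc (0 : ℝ) 1) :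
    0 < ∫ x in (0 : ℝ)..1, derivWithin w (Icc 0 1) (x * s) := by
  refine intervalIntegral.intervalIntegral_pos_of_pos_on ?_
    (fun x hx => hpos _ (scale_mem_Icc hs ⟨hx.1.le, hx.2.le⟩)) zero_lt_one
  refine ContinuousOn.intervalIntegrable ?_
  rw [uIcc_of_le zero_le_one]
  exact (continuousOn_derivWithin_Icc hw).comp (by fun_prop) fun x hx => scale_mem_Icc hs hx

theorem radial_pos (hw : ContDiffOn ℝ ∞ w (Icc 0 1))
    (hpos : ∀ s ∈ Icc (0 : ℝ) 1, 0 < derivWithin w (Icc 0 1) s) {s : ℝ} (hs : s ∈ Icc (0 : ℝ) 1) :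
    0 < radial w s :=
  Real.sqrt_pos.2 (integral_derivWithin_pos hw hpos hs)

theorem radial_sq_mul (hw : ContDiffOn ℝ ∞ w (Icc 0 1)) (h0 : w 0 = 0)
    (hpos : ∀ s ∈ Icc (0 : ℝ) 1, 0 < derivWithin w (Icc 0 1) s) {s : ℝ} (hs : s ∈ Icc (0 : ℝ) 1) :
    radial w s ^ 2 * s = w s := by
  rw [radial, Real.sq_sqrt (integral_derivWithin_pos hw hpos hs).le, mul_comm,
    mul_integral_scale zero_le_one (fun s hs => ((hw.differentiableOn (by simp)) s
      hs).hasDerivWithinAt) (continuousOn_derivWithin_Icc hw) hs, h0, sub_zero]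

variable {T : Type*} [TopologicalSpace T]

/-- The averaged derivative is the order 0 term of the averaged tower of derivatives, and the square
root is smooth at its positive values. No division by `s` occurs, so `s = 0` is not exceptional. -/
theorem JetContOn.radial {u : T → ℝ → ℝ} (hu : JetContOn u (Icc 0 1))
    (hpos : ∀ t, ∀ s ∈ Icc (0 : ℝ) 1, 0 < _root_.derivWithin (u t) (Icc 0 1) s) :
    JetContOn (fun t => FolDiff.radial (u t)) (Icc 0 1) := by
  have h1 := (((hu.isJets zero_lt_one).tail 1).integral zero_le_one).jetContOn zero_lt_one
  simp only [pow_zero, one_mul, zero_add, iteratedDerivWithin_one] at h1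
  intro t s hs
  exact (h1 t s hs).comp_contDiffAt
    (Real.contDiffAt_sqrt (integral_derivWithin_pos (hu.contDiffOn t) (hpos t) hs).ne')
    (uniqueDiffOn_Icc zero_lt_one) hs

/-- On the second disk bundle the squared radius is `1 - f`, so a diffeomorphism of levels acts
there through its conjugate by the reflection. -/
theorem jetContOn_reflect {u : T → ℝ → ℝ} (hu : JetContOn u (Icc 0 1)) :
    JetContOn (fun t s => 1 - u t (1 - s)) (Icc 0 1) := by
  intro t s hs
  have hud := uniqueDiffOn_Icc (zero_lt_one (α := ℝ))
  have hm : ∀ s ∈ Icc (0 : ℝ) 1, 1 - s ∈ Icc (0 : ℝ) 1 := fun s hs =>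
    ⟨by linarith [hs.2], by linarith [hs.1]⟩
  have h1 : JetCont (fun (_ : T) (s : ℝ) => 1 - s) (Icc 0 1) t s :=
    .of_contDiffWithinAt hud hs (contDiffWithinAt_const.sub contDiffWithinAt_id)
  have h2 : JetCont (fun t s => u t (1 - s)) (Icc 0 1) t s :=
    (hu t (1 - s) (hm s hs)).comp h1 hud hud hs (eventually_mem_slice.mono fun p hp => hm _ hp)
  exact h2.comp_contDiffAt (g := fun y => 1 - y) (contDiffAt_const.sub contDiffAt_id) hud hs

theorem derivWithin_reflect {w : ℝ → ℝ} (hw : ContDiffOn ℝ ∞ w (Icc 0 1)) {s : ℝ}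
    (hs : s ∈ Icc (0 : ℝ) 1) : derivWithin (fun s => 1 - w (1 - s)) (Icc 0 1) s =
      derivWithin w (Icc 0 1) (1 - s) := by
  have hm : ∀ s ∈ Icc (0 : ℝ) 1, 1 - s ∈ Icc (0 : ℝ) 1 := fun s hs =>
    ⟨by linarith [hs.2], by linarith [hs.1]⟩
  have h1 : HasDerivWithinAt (fun s : ℝ => 1 - s) (-1) (Icc 0 1) s := by
    simpa using ((hasDerivAt_id s).const_sub 1).hasDerivWithinAt
  have h2 := ((hw.differentiableOn (by simp)) (1 - s) (hm s hs)).hasDerivWithinAt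
  have h3 := (HasDerivWithinAt.comp s h2 h1 hm).const_sub 1
  rw [mul_neg_one, neg_neg] at h3
  exact h3.derivWithin (uniqueDiffOn_Icc zero_lt_one s hs)

end Radial

/-! ### Families that are radial in a chart -/

section RadialFamilies

variable {T : Type*} [TopologicalSpace T] {E : Type*} [NormedAddCommGroup E] [NormedSpace ℝ E]
  {M : Type*} [TopologicalSpace M] [ChartedSpace E M] [IsManifold 𝓘(ℝ, E) ∞ M]
  {e : OpenPartialHomeomorph M E}

theorem famAt_of_jetCont {H : T → M → M} {v : T → E → E} {t₀ : T} {x₀ : M}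
    (he : e ∈ IsManifold.maximalAtlas 𝓘(ℝ, E) ∞ M) (hx : x₀ ∈ e.source)
    (hv : JetCont v univ t₀ (e x₀))
    (hH : ∀ t, ∀ y ∈ e.source, H t y ∈ e.source ∧ e (H t y) = v t (e y)) : FamAt E E H t₀ x₀ := by
  refine (famAt_iff he he hx (hH t₀ x₀ hx).1).2 ⟨?_, ?_⟩
  · have h1 : ContinuousAt (fun p : T × E => v p.1 p.2) (t₀, e x₀) := by
      simpa [continuousWithinAt_univ] using hv.continuousWithinAt
    have h2 : ContinuousAt (fun p : T × M => v p.1 (e p.2)) (t₀, x₀) :=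
      continuousAt_curry_comp h1 continuousAt_fst (continuousAt_comp_snd (e.continuousAt hx))
    have h3 : ContinuousAt (fun p : T × M => e.symm (v p.1 (e p.2))) (t₀, x₀) := by
      refine ContinuousAt.comp (g := e.symm) ?_ h2
      rw [← (hH t₀ x₀ hx).2]
      exact e.continuousAt_symm (e.map_source (hH t₀ x₀ hx).1)
    refine h3.congr ?_
    filter_upwards [continuousAt_snd.eventually (e.open_source.mem_nhds hx)] with p hp
    rw [← (hH p.1 p.2 hp).2, e.left_inv (hH p.1 p.2 hp).1]
  · refine hv.congr_univ ?_
    filter_upwards [continuousAt_snd.eventually (e.open_target.mem_nhds (e.map_source hx))] with p hp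
    rw [(hH p.1 _ (e.map_target hp)).2, e.right_inv hp]

/-- In a chart linear along the fibres, multiplication by a scalar is affine in that scalar. The
scalar is a smooth function of `g` up to the value 0, so the family is smooth across the zero
section as well. -/
theorem famAt_of_radial {H : T → M → M} {t₀ : T} {x₀ : M} {u : T → ℝ → ℝ} {g : M → ℝ}
    {P : E →L[ℝ] E} (he : e ∈ IsManifold.maximalAtlas 𝓘(ℝ, E) ∞ M) (hx : x₀ ∈ e.source)
    (hu : JetContOn u (Icc 0 1))
    (hpos : ∀ t, ∀ s ∈ Icc (0 : ℝ) 1, 0 < derivWithin (u t) (Icc 0 1) s)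
    (hg : ContMDiff 𝓘(ℝ, E) 𝓘(ℝ) ∞ g) (hg01 : ∀ x, g x ∈ Icc (0 : ℝ) 1)
    (hH : ∀ t, ∀ y ∈ e.source, H t y ∈ e.source ∧
      e (H t y) = e y + (radial (u t) (g y) - 1) • P (e y)) : FamAt E E H t₀ x₀ := by
  refine famAt_of_jetCont (v := fun t z => z + (radial (u t) (g (e.symm z)) - 1) • P z) he hx ?_ ?_
  · have hQ : JetCont (fun (_ : T) z => g (e.symm z)) univ t₀ (e x₀) :=
      .of_contDiffAt ((contDiffOn_comp_chart_symm he hg).contDiffAt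
        (e.open_target.mem_nhds (e.map_source hx)))
    have hr : JetCont (fun t z => radial (u t) (g (e.symm z))) univ t₀ (e x₀) :=
      (hu.radial hpos t₀ _ (hg01 _)).comp hQ uniqueDiffOn_univ (uniqueDiffOn_Icc zero_lt_one)
        (mem_univ _) (Filter.Eventually.of_forall fun p => hg01 _)
    have hr' : JetCont (fun t z => radial (u t) (g (e.symm z)) - 1) univ t₀ (e x₀) :=
      hr.comp_contDiffAt (g := fun y => y - 1) (contDiffAt_id.sub contDiffAt_const)
        uniqueDiffOn_univ (mem_univ _)
    exact (JetCont.of_contDiffAt contDiffAt_id).add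
      (hr'.smul (.of_contDiffAt P.contDiff.contDiffAt) uniqueDiffOn_univ (mem_univ _))
      uniqueDiffOn_univ (mem_univ _)
  · intro t y hy
    rw [e.left_inv hy]
    exact hH t y hy

end RadialFamilies

/-! ### Second order behaviour of definite functions in charts -/

section MorseBott

variable {m : ℕ} {B : Type*} [TopologicalSpace B] [ChartedSpace (EuclideanSpace ℝ (Fin m)) B]
  {F : Type*} [NormedAddCommGroup F] [NormedSpace ℝ F]
  {W : B → Type*} [∀ b, AddCommGroup (W b)] [∀ b, Module ℝ (W b)]
  [∀ b, TopologicalSpace (W b)] [TopologicalSpace (TotalSpace F W)] [FiberBundle F W]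
  {E : Type*} [NormedAddCommGroup E] [NormedSpace ℝ E]
  {G : Type*} [TopologicalSpace G] [ChartedSpace E G] {q : DefiniteFun m F W}

/-- The normalized function `Q = b⁻¹ (g ∘ e⁻¹ - a)` is `q` read in the chart, so the results on
homogeneous functions apply; an affine change of values with `b ≠ 0` alters neither the critical
points nor the kernel of the Hessian. The cases needed are `(a, b) = (0, 1)` and `(1, -1)`. -/
theorem mfderiv_and_hessian_of_scaleChart {j : q.disk → G} {g : G → ℝ} {a b : ℝ}
    {e : OpenPartialHomeomorph G E} {P : E →L[ℝ] E}
    (hg : ContMDiff 𝓘(ℝ, E) 𝓘(ℝ) ∞ g) (hb : b ≠ 0) (hgj : ∀ x : q.disk, g (j x) = a + b * q.toFun x)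
    (he : e ∈ IsManifold.maximalAtlas 𝓘(ℝ, E) ∞ G) (hP : ∀ v, P (P v) = P v)
    (hrange : e.source ⊆ range j)
    (hscale : ∀ y : q.disk, j y ∈ e.source → (P (e (j y)) = 0 ↔ (y : TotalSpace F W).2 = 0) ∧
        ∀ (c : ℝ) (hc : smulTot c (y : TotalSpace F W) ∈ q.disk), j ⟨_, hc⟩ ∈ e.source ∧
          e (j ⟨_, hc⟩) = e (j y) + (c - 1) • P (e (j y))) {y : G} (hy : y ∈ e.source) :
    (mfderiv 𝓘(ℝ, E) 𝓘(ℝ) g y = 0 ↔ P (e y) = 0) ∧ (P (e y) = 0 →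
      ∀ v, fderiv ℝ (fderiv ℝ (g ∘ e.symm)) (e y) v = 0 ↔ P v = 0) := by
  set Q : E → ℝ := fun z => b⁻¹ * (g (e.symm z) - a) with hQ
  have hQj : ∀ x : q.disk, j x ∈ e.source → Q (e (j x)) = q.toFun x := fun x hx => by
    rw [hQ]
    simp only [e.left_inv hx, hgj]
    field_simp
    ring
  have hgQ : g ∘ e.symm = fun z => a + b • Q z := by
    funext z
    simp only [Function.comp_apply, hQ, smul_eq_mul]
    field_simp
    ring
  have hQs : ContDiffOn ℝ ∞ Q e.target :=
    contDiffOn_const.mul ((contDiffOn_comp_chart_symm he hg).sub contDiffOn_const)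
  have hrep : ∀ z ∈ e.target, ∃ x : q.disk, j x ∈ e.source ∧ e (j x) = z := fun z hz => by
    obtain ⟨x, hx⟩ := hrange (e.map_target hz)
    exact ⟨x, hx ▸ e.map_target hz, by rw [hx, e.right_inv hz]⟩
  have hhom : ∀ z ∈ e.target, ∀ c ∈ Icc (0 : ℝ) 1, Q (z + (c - 1) • P z) = c ^ 2 * Q z := by
    intro z hz c hc
    obtain ⟨x, hx, rfl⟩ := hrep z hz
    have hq : q.toFun (smulTot c (x : TotalSpace F W)) = c ^ 2 * q.toFun x := q.homog c hc.1 x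
    have hcx : smulTot c (x : TotalSpace F W) ∈ q.disk := by
      change _ < (1 : ℝ)
      rw [hq]
      exact (mul_le_of_le_one_left (q.nonneg _) (pow_le_one₀ hc.1 hc.2)).trans_lt x.2
    obtain ⟨h1, h2⟩ := (hscale x hx).2 c hcx
    rw [← h2, hQj _ h1, hQj _ hx, hq]
  have hpos : ∀ z ∈ e.target, P z ≠ 0 → 0 < Q z := by
    intro z hz hPz
    obtain ⟨x, hx, rfl⟩ := hrep z hz
    rw [hQj x hx]
    exact q.definite _ fun h => hPz ((hscale x hx).1.2 h)
  have hfd : fderiv ℝ (g ∘ e.symm) = b • fderiv ℝ Q := by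
    rw [← fderiv_const_smul_field b]
    funext z
    rw [hgQ, fderiv_const_add]
    rfl
  refine ⟨?_, fun h0 v => ?_⟩
  · rw [mfderiv_eq_zero_iff_of_mem_maximalAtlas he hg hy, hfd, Pi.smul_apply,
      smul_eq_zero_iff_right hb]
    exact fderiv_eq_zero_iff_of_homogeneous e.open_target hQs hhom hpos (e.map_source hy)
  · have h2 : fderiv ℝ (fun z => b • fderiv ℝ Q z) (e y) = b • fderiv ℝ (fderiv ℝ Q) (e y) :=
      fderiv_fun_const_smul (((hQs.contDiffAt (e.open_target.mem_nhds
        (e.map_source hy))).fderiv_right (m := ∞) (by norm_num)).differentiableAt (by simp)) b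
    rw [hfd, show b • fderiv ℝ Q = fun z => b • fderiv ℝ Q z from rfl, h2, smul_apply, smul_eq_zero_iff_right hb]
    exact fderiv_fderiv_eq_zero_iff_of_homogeneous e.open_target hQs hP hhom hpos (e.map_source hy)
      h0 v

end MorseBott

/-! ### The Morse–Bott property of the glued function -/

namespace SphereDiffeo

variable {m₀ : ℕ} {B₀ : Type*} [TopologicalSpace B₀] [ChartedSpace (EuclideanSpace ℝ (Fin m₀)) B₀]
  {F₀ : Type*} [NormedAddCommGroup F₀] [NormedSpace ℝ F₀]
  {W₀ : B₀ → Type*} [∀ b, AddCommGroup (W₀ b)] [∀ b, Module ℝ (W₀ b)]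
  [∀ b, TopologicalSpace (W₀ b)] [TopologicalSpace (TotalSpace F₀ W₀)] [FiberBundle F₀ W₀]
  [VectorBundle ℝ F₀ W₀]
  {m₁ : ℕ} {B₁ : Type*} [TopologicalSpace B₁] [ChartedSpace (EuclideanSpace ℝ (Fin m₁)) B₁]
  {F₁ : Type*} [NormedAddCommGroup F₁] [NormedSpace ℝ F₁]
  {W₁ : B₁ → Type*} [∀ b, AddCommGroup (W₁ b)] [∀ b, Module ℝ (W₁ b)]
  [∀ b, TopologicalSpace (W₁ b)] [TopologicalSpace (TotalSpace F₁ W₁)] [FiberBundle F₁ W₁]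
  [VectorBundle ℝ F₁ W₁]
  {q₀ : DefiniteFun m₀ F₀ W₀} {q₁ : DefiniteFun m₁ F₁ W₁} (ψ : SphereDiffeo q₀ q₁)
  [FiniteDimensional ℝ F₀] [FiniteDimensional ℝ F₁] [hne : Nonempty q₀.sphere]
  [IsManifold (𝓡 m₀) ∞ B₀] [ContMDiffVectorBundle ∞ F₀ W₀ (𝓡 m₀)]
  [IsManifold (𝓡 m₁) ∞ B₁] [ContMDiffVectorBundle ∞ F₁ W₁ (𝓡 m₁)]

theorem isMorseBott_fn : IsMorseBott ψ.E fun z => (ψ.fn z : ℝ) := by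
  refine ⟨ψ.contMDiff_fn, fun z hz => ?_⟩
  obtain ⟨e, he, P, hP, hze, hC⟩ : ∃ e ∈ IsManifold.maximalAtlas 𝓘(ℝ, ψ.E) ∞ ψ.Glued,
      ∃ P : ψ.E →L[ℝ] ψ.E, (∀ v, P (P v) = P v) ∧ z ∈ e.source ∧ ∀ y ∈ e.source,
        (mfderiv 𝓘(ℝ, ψ.E) 𝓘(ℝ) (fun z => (ψ.fn z : ℝ)) y = 0 ↔ P (e y) = 0) ∧ (P (e y) = 0 →
        ∀ v, fderiv ℝ (fderiv ℝ ((fun z => (ψ.fn z : ℝ)) ∘ e.symm)) (e y) v = 0 ↔ P v = 0) := by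
    obtain ⟨x, rfl⟩ | ⟨x, rfl⟩ := ψ.exists_inl_or_inr z
    · obtain ⟨e, he, P, hP, hxe, hr, hs⟩ := ψ.exists_scaleChart_inl x
      have he' := IsManifold.subset_maximalAtlas (I := 𝓘(ℝ, ψ.E)) (n := ∞) he
      exact ⟨e, he', P, hP, hxe, fun y hy => mfderiv_and_hessian_of_scaleChart (a := 0) (b := 1)
        ψ.contMDiff_fn one_ne_zero (fun x => by rw [fn_inl]; ring) he' hP hr hs hy⟩
    · obtain ⟨e, he, P, hP, hxe, hr, hs⟩ := ψ.exists_scaleChart_inr x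
      have he' := IsManifold.subset_maximalAtlas (I := 𝓘(ℝ, ψ.E)) (n := ∞) he
      exact ⟨e, he', P, hP, hxe, fun y hy => mfderiv_and_hessian_of_scaleChart (a := 1) (b := -1)
        ψ.contMDiff_fn (by norm_num) (fun x => by rw [fn_inr]; ring) he' hP hr hs hy⟩
  have hz0 : P (e z) = 0 := (hC z hze).1.1 hz
  -- The critical set in this chart is the zero set of `P`, which contains `e z`; hence it is `e z +
  -- ker P`.
  refine ⟨e, he, hze, LinearMap.ker (P : ψ.E →ₗ[ℝ] ψ.E), fun y hy => ?_, fun y hy h v => ?_⟩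
  · rw [(hC y hy).1, LinearMap.mem_ker, ContinuousLinearMap.coe_coe, map_sub, hz0, sub_zero]
  · rw [(hC y hy).2 ((hC y hy).1.1 h) v]
    rfl

theorem setOf_mfderiv_fn_eq_zero :
    {z | mfderiv 𝓘(ℝ, ψ.E) 𝓘(ℝ) (fun z => (ψ.fn z : ℝ)) z = 0} = leaf ψ.fn 0 ∪ leaf ψ.fn 1 := by
  ext z
  change _ ↔ ψ.fn z = 0 ∨ ψ.fn z = 1
  obtain ⟨x, rfl⟩ | ⟨x, rfl⟩ := ψ.exists_inl_or_inr z
  · obtain ⟨e, he, P, hP, hxe, hr, hs⟩ := ψ.exists_scaleChart_inl x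
    have h1 := (mfderiv_and_hessian_of_scaleChart (a := 0) (b := 1)
        ψ.contMDiff_fn one_ne_zero (fun x => by rw [fn_inl]; ring)
        (IsManifold.subset_maximalAtlas he) hP hr hs hxe).1
    have h2 : ¬ ψ.fn (ψ.inl x) = 1 := fun h => (show q₀.toFun x < 1 from x.2).ne (by
      rw [← ψ.fn_inl, h]
      rfl)
    rw [mem_ofPred_eq, h1, (hs x hxe).1, ← q₀.eq_zero_iff, ← ψ.fn_inl, Subtype.ext_iff]
    simp only [h2, or_false]
    rfl
  · obtain ⟨e, he, P, hP, hxe, hr, hs⟩ := ψ.exists_scaleChart_inr x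
    have h1 := (mfderiv_and_hessian_of_scaleChart (a := 1) (b := -1)
        ψ.contMDiff_fn (by norm_num) (fun x => by rw [fn_inr]; ring)
        (IsManifold.subset_maximalAtlas he) hP hr hs hxe).1
    have h2 : ¬ ψ.fn (ψ.inr x) = 0 := fun h => (show q₁.toFun x < 1 from x.2).ne (by
      have := ψ.fn_inr x
      rw [h, Icc.coe_zero] at this
      linarith)
    rw [mem_ofPred_eq, h1, (hs x hxe).1, ← q₁.eq_zero_iff, Subtype.ext_iff (a1 := ψ.fn (ψ.inr x)) (a2 := 1),
      fn_inr]
    simp only [h2, false_or, Icc.coe_one]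
    rw [sub_eq_self]

end SphereDiffeo


/-! ### Rays -/

section Rays

variable {m₀ : ℕ} {B₀ : Type*} [TopologicalSpace B₀] [ChartedSpace (EuclideanSpace ℝ (Fin m₀)) B₀]
  {F₀ : Type*} [NormedAddCommGroup F₀] [NormedSpace ℝ F₀]
  {W₀ : B₀ → Type*} [∀ b, AddCommGroup (W₀ b)] [∀ b, Module ℝ (W₀ b)]
  [∀ b, TopologicalSpace (W₀ b)] [TopologicalSpace (TotalSpace F₀ W₀)] [FiberBundle F₀ W₀]
  {m₁ : ℕ} {B₁ : Type*} [TopologicalSpace B₁] [ChartedSpace (EuclideanSpace ℝ (Fin m₁)) B₁]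
  {F₁ : Type*} [NormedAddCommGroup F₁] [NormedSpace ℝ F₁]
  {W₁ : B₁ → Type*} [∀ b, AddCommGroup (W₁ b)] [∀ b, Module ℝ (W₁ b)]
  [∀ b, TopologicalSpace (W₁ b)] [TopologicalSpace (TotalSpace F₁ W₁)] [FiberBundle F₁ W₁]

theorem DefiniteFun.smulTot_eq (q : DefiniteFun m₀ F₀ W₀) {c d : ℝ} (hc : 0 < c) (hd : 0 < d)
    {x : TotalSpace F₀ W₀} (h : q.toFun (smulTot c x) = q.toFun (smulTot d x)) :
    smulTot c x = smulTot d x := by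
  by_cases hx : x.2 = 0
  · simp only [smulTot, hx, smul_zero]
  · rw [q.homog c hc.le, q.homog d hd.le] at h
    rw [(pow_left_inj₀ hc.le hd.le two_ne_zero).1 (mul_right_cancel₀ (q.definite x hx).ne' h)]

/-- The radial projection to the sphere bundle is constant along a ray, so the images of both points
are positive multiples of one vector of the other sphere bundle. -/
theorem radialExt_smulTot (q₀ : DefiniteFun m₀ F₀ W₀) (q₁ : DefiniteFun m₁ F₁ W₁)
    (u : q₀.sphere → q₁.sphere) {x x' : q₀.punctured} {c : ℝ} (hc : 0 < c)
    (h : ((x' : q₀.disk) : TotalSpace F₀ W₀) = smulTot c (x : q₀.disk)) : ∃ d : ℝ, 0 < d ∧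
      ((radialExt q₀ q₁ u x' : q₁.disk) : TotalSpace F₁ W₁) =
        smulTot d (radialExt q₀ q₁ u x : q₁.disk) := by
  have hn : q₀.normalize x' = q₀.normalize x := by
    refine Subtype.ext ?_
    change smulTot (√(q₀.toFun (x' : q₀.disk)))⁻¹ ((x' : q₀.disk) : TotalSpace F₀ W₀) =
      smulTot (√(q₀.toFun (x : q₀.disk)))⁻¹ ((x : q₀.disk) : TotalSpace F₀ W₀)
    rw [h, smulTot_smulTot, q₀.homog c hc.le, Real.sqrt_mul (sq_nonneg c), Real.sqrt_sq hc.le,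
      mul_inv, mul_right_comm, inv_mul_cancel₀ hc.ne', one_mul]
  have h1 : 0 < √(1 - q₀.toFun (x : q₀.disk)) := Real.sqrt_pos.2 (by linarith [q₀.toFun_lt_one x])
  have h1' : 0 < √(1 - q₀.toFun (x' : q₀.disk)) := Real.sqrt_pos.2 (by linarith [q₀.toFun_lt_one x'])
  refine ⟨√(1 - q₀.toFun (x' : q₀.disk)) / √(1 - q₀.toFun (x : q₀.disk)), by positivity, ?_⟩
  change smulTot √(1 - q₀.toFun (x' : q₀.disk)) (u (q₀.normalize x') : TotalSpace F₁ W₁) =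
    smulTot _ (smulTot √(1 - q₀.toFun (x : q₀.disk)) (u (q₀.normalize x) : TotalSpace F₁ W₁))
  rw [hn, smulTot_smulTot, div_mul_cancel₀ _ h1.ne']

theorem mem_punctured_of_smulTot {q : DefiniteFun m₀ F₀ W₀} {x x' : q.disk} {c : ℝ} (hc : 0 < c)
    (h : (x' : TotalSpace F₀ W₀) = smulTot c (x : TotalSpace F₀ W₀)) (hx : x ∈ q.punctured) :
    x' ∈ q.punctured := by
  rw [q.mem_punctured_iff] at hx ⊢
  rw [h, q.homog c hc.le]
  positivity

end Rays

/-! ### Rays of the glued space -/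

namespace SphereDiffeo

variable {m₀ : ℕ} {B₀ : Type*} [TopologicalSpace B₀] [ChartedSpace (EuclideanSpace ℝ (Fin m₀)) B₀]
  {F₀ : Type*} [NormedAddCommGroup F₀] [NormedSpace ℝ F₀]
  {W₀ : B₀ → Type*} [∀ b, AddCommGroup (W₀ b)] [∀ b, Module ℝ (W₀ b)]
  [∀ b, TopologicalSpace (W₀ b)] [TopologicalSpace (TotalSpace F₀ W₀)] [FiberBundle F₀ W₀]
  [VectorBundle ℝ F₀ W₀]
  {m₁ : ℕ} {B₁ : Type*} [TopologicalSpace B₁] [ChartedSpace (EuclideanSpace ℝ (Fin m₁)) B₁]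
  {F₁ : Type*} [NormedAddCommGroup F₁] [NormedSpace ℝ F₁]
  {W₁ : B₁ → Type*} [∀ b, AddCommGroup (W₁ b)] [∀ b, Module ℝ (W₁ b)]
  [∀ b, TopologicalSpace (W₁ b)] [TopologicalSpace (TotalSpace F₁ W₁)] [FiberBundle F₁ W₁]
  [VectorBundle ℝ F₁ W₁]
  {q₀ : DefiniteFun m₀ F₀ W₀} {q₁ : DefiniteFun m₁ F₁ W₁} (ψ : SphereDiffeo q₀ q₁)

/-- `z` and `z'` are positive multiples of each other in one of the disk bundles. -/
def Ray (z z' : ψ.Glued) : Prop :=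
  (∃ (x x' : q₀.disk) (c : ℝ), 0 < c ∧ (x' : TotalSpace F₀ W₀) = smulTot c (x : TotalSpace F₀ W₀) ∧
    ψ.inl x = z ∧ ψ.inl x' = z') ∨
  ∃ (y y' : q₁.disk) (c : ℝ), 0 < c ∧ (y' : TotalSpace F₁ W₁) = smulTot c (y : TotalSpace F₁ W₁) ∧
    ψ.inr y = z ∧ ψ.inr y' = z'

/-- A ray witnessed in the second disk bundle and passing through a point of the first consists of
nonzero vectors, so the inverse gluing map carries it to a ray of the first. Either piece containing
the starting point therefore suffices for testing. -/
theorem ray_inl_iff {x : q₀.disk} {z : ψ.Glued} : ψ.Ray (ψ.inl x) z ↔ ∃ (x' : q₀.disk) (c : ℝ),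
    0 < c ∧ (x' : TotalSpace F₀ W₀) = smulTot c (x : TotalSpace F₀ W₀) ∧ ψ.inl x' = z := by
  constructor
  · rintro (⟨a, a', c, hc, h, ha, ha'⟩ | ⟨y, y', c, hc, h, hy, hy'⟩)
    · obtain rfl := ψ.isOpenEmbedding_inl.injective ha
      exact ⟨a', c, hc, h, ha'⟩
    · obtain ⟨u, rfl, rfl⟩ := ψ.inl_eq_inr.1 hy.symm
      have hp := mem_punctured_of_smulTot hc h (ψ.gluingMap u).2
      obtain ⟨d, hd, h1⟩ := radialExt_smulTot q₁ q₀ ψ.toEquiv.symm (x := ψ.gluingMap u)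
        (x' := ⟨y', hp⟩) hc h
      refine ⟨ψ.gluingMap.symm ⟨y', hp⟩, d, hd, ?_, ?_⟩
      · have h2 : radialExt q₁ q₀ ψ.toEquiv.symm (ψ.gluingMap u) = u :=
          ψ.gluingMap.symm_apply_apply u
        rw [h2] at h1
        exact h1
      · rw [inl_eq_inr_gluingMap, Homeomorph.apply_symm_apply, hy']
  · rintro ⟨x', c, hc, h, hz⟩
    exact Or.inl ⟨x, x', c, hc, h, rfl, hz⟩

theorem ray_inr_iff {y : q₁.disk} {z : ψ.Glued} : ψ.Ray (ψ.inr y) z ↔ ∃ (y' : q₁.disk) (c : ℝ),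
    0 < c ∧ (y' : TotalSpace F₁ W₁) = smulTot c (y : TotalSpace F₁ W₁) ∧ ψ.inr y' = z := by
  constructor
  · rintro (⟨x, x', c, hc, h, hx, hx'⟩ | ⟨a, a', c, hc, h, ha, ha'⟩)
    · obtain ⟨u, rfl, rfl⟩ := ψ.inl_eq_inr.1 hx
      have hp := mem_punctured_of_smulTot hc h u.2
      obtain ⟨d, hd, h1⟩ := radialExt_smulTot q₀ q₁ ψ.toEquiv (x := u) (x' := ⟨x', hp⟩) hc h
      exact ⟨ψ.gluingMap ⟨x', hp⟩, d, hd, h1, by rw [← inl_eq_inr_gluingMap, hx']⟩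
    · obtain rfl := ψ.isOpenEmbedding_inr.injective ha
      exact ⟨a', c, hc, h, ha'⟩
  · rintro ⟨y', c, hc, h, hz⟩
    exact Or.inr ⟨y, y', c, hc, h, rfl, hz⟩

theorem Ray.refl (z : ψ.Glued) : ψ.Ray z z := by
  obtain ⟨x, rfl⟩ | ⟨y, rfl⟩ := ψ.exists_inl_or_inr z
  · exact ψ.ray_inl_iff.2 ⟨x, 1, one_pos, (smulTot_one _).symm, rfl⟩
  · exact ψ.ray_inr_iff.2 ⟨y, 1, one_pos, (smulTot_one _).symm, rfl⟩

variable {ψ} in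
theorem Ray.trans {z z' z'' : ψ.Glued} (h : ψ.Ray z z') (h' : ψ.Ray z' z'') : ψ.Ray z z'' := by
  obtain ⟨x, rfl⟩ | ⟨y, rfl⟩ := ψ.exists_inl_or_inr z
  · obtain ⟨x', c, hc, hx', rfl⟩ := ψ.ray_inl_iff.1 h
    obtain ⟨x'', d, hd, hx'', rfl⟩ := ψ.ray_inl_iff.1 h'
    exact ψ.ray_inl_iff.2 ⟨x'', d * c, mul_pos hd hc, by rw [hx'', hx', smulTot_smulTot], rfl⟩
  · obtain ⟨x', c, hc, hx', rfl⟩ := ψ.ray_inr_iff.1 h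
    obtain ⟨x'', d, hd, hx'', rfl⟩ := ψ.ray_inr_iff.1 h'
    exact ψ.ray_inr_iff.2 ⟨x'', d * c, mul_pos hd hc, by rw [hx'', hx', smulTot_smulTot], rfl⟩

variable {ψ} in
-- The value of a definite function at `c x` is `c²` times its value at `x`, so the level determines
-- `c > 0` unless `x = 0`, in which case the ray is a single point. This uniqueness makes formulas
-- in the two pieces agree without computing with the gluing map.
theorem Ray.eq {z z' z'' : ψ.Glued} (h : ψ.Ray z z') (h' : ψ.Ray z z'')
    (hf : ψ.fn z' = ψ.fn z'') : z' = z'' := by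
  have hf' : (ψ.fn z' : ℝ) = ψ.fn z'' := congrArg _ hf
  obtain ⟨x, rfl⟩ | ⟨y, rfl⟩ := ψ.exists_inl_or_inr z
  · obtain ⟨x', c, hc, hx', rfl⟩ := ψ.ray_inl_iff.1 h
    obtain ⟨x'', d, hd, hx'', rfl⟩ := ψ.ray_inl_iff.1 h'
    rw [fn_inl, fn_inl, hx', hx''] at hf'
    exact congrArg _ (Subtype.ext (by rw [hx', hx'', q₀.smulTot_eq hc hd hf']))
  · obtain ⟨x', c, hc, hx', rfl⟩ := ψ.ray_inr_iff.1 h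
    obtain ⟨x'', d, hd, hx'', rfl⟩ := ψ.ray_inr_iff.1 h'
    rw [fn_inr, fn_inr, hx', hx'', sub_right_inj] at hf'
    exact congrArg _ (Subtype.ext (by rw [hx', hx'', q₁.smulTot_eq hc hd hf']))

end SphereDiffeo

/-! ### Lifting diffeomorphisms of the segment -/

section Reflect

variable (φ : diffIPlus)

theorem extend_zero_of_plus : φ.1.extend 0 = 0 := by
  have := φ.1.extend_coe 0
  rw [diffIPlus_zero φ.2] at this
  exact this

theorem extend_one_of_plus : φ.1.extend 1 = 1 := by
  have := φ.1.extend_coe 1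
  rw [diffIPlus_one φ.2] at this
  exact this

theorem extend_lt_one_of_plus {s : ℝ} (hs : s ∈ Icc (0 : ℝ) 1) (h1 : s < 1) : φ.1.extend s < 1 := by
  rw [φ.1.extend_of_mem hs]
  refine lt_of_lt_of_eq (b := ((φ.1 1 : unitInterval) : ℝ)) ?_ (by rw [diffIPlus_one φ.2]; rfl)
  exact (show StrictMono φ.1 from φ.2) (show (⟨s, hs⟩ : unitInterval) < 1 from h1)

theorem extend_pos_of_plus {s : ℝ} (hs : s ∈ Icc (0 : ℝ) 1) (h1 : 0 < s) : 0 < φ.1.extend s := by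
  rw [φ.1.extend_of_mem hs]
  refine lt_of_eq_of_lt (b := ((φ.1 0 : unitInterval) : ℝ)) (by rw [diffIPlus_zero φ.2]; rfl) ?_
  exact (show StrictMono φ.1 from φ.2) (show (0 : unitInterval) < ⟨s, hs⟩ from h1)

/-- The conjugate of a diffeomorphism of `[0,1]` by the reflection. -/
def reflectFun (s : ℝ) : ℝ := 1 - φ.1.extend (1 - s)

theorem jetContOn_extend : JetContOn (fun φ : diffIPlus => φ.1.extend) (Icc 0 1) :=
  continuous_diffI_iff.1 continuous_subtype_val

theorem jetContOn_reflectFun : JetContOn reflectFun (Icc 0 1) :=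
  jetContOn_reflect jetContOn_extend

theorem derivWithin_reflectFun_pos {s : ℝ} (hs : s ∈ Icc (0 : ℝ) 1) :
    0 < derivWithin (reflectFun φ) (Icc 0 1) s := by
  have h := derivWithin_reflect φ.1.contDiffOn_extend hs
  have h1 : (1 : ℝ) - s ∈ Icc (0 : ℝ) 1 := ⟨by linarith [hs.2], by linarith [hs.1]⟩
  exact (DiffI.derivWithin_pos φ.2 h1).trans_eq h.symm

theorem radial_extend_sq_mul {s : ℝ} (hs : s ∈ Icc (0 : ℝ) 1) :
    radial φ.1.extend s ^ 2 * s = φ.1.extend s :=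
  radial_sq_mul φ.1.contDiffOn_extend (extend_zero_of_plus φ)
    (fun _ => DiffI.derivWithin_pos φ.2) hs

theorem radial_reflectFun_sq_mul {s : ℝ} (hs : s ∈ Icc (0 : ℝ) 1) :
    radial (reflectFun φ) s ^ 2 * s = 1 - φ.1.extend (1 - s) :=
  radial_sq_mul (jetContOn_reflectFun.contDiffOn φ)
    (by rw [reflectFun, sub_zero, extend_one_of_plus, sub_self])
    (fun _ => derivWithin_reflectFun_pos φ) hs

theorem radial_extend_pos {s : ℝ} (hs : s ∈ Icc (0 : ℝ) 1) : 0 < radial φ.1.extend s :=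
  radial_pos φ.1.contDiffOn_extend (fun _ => DiffI.derivWithin_pos φ.2) hs

theorem radial_reflectFun_pos {s : ℝ} (hs : s ∈ Icc (0 : ℝ) 1) : 0 < radial (reflectFun φ) s :=
  radial_pos (jetContOn_reflectFun.contDiffOn φ) (fun _ => derivWithin_reflectFun_pos φ) hs

end Reflect

/-! ### Radial rescaling of the open disk bundles -/

namespace DefiniteFun

variable {m : ℕ} {B : Type*} [TopologicalSpace B] [ChartedSpace (EuclideanSpace ℝ (Fin m)) B]
  {F : Type*} [NormedAddCommGroup F] [NormedSpace ℝ F]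
  {W : B → Type*} [∀ b, AddCommGroup (W b)] [∀ b, Module ℝ (W b)]
  [∀ b, TopologicalSpace (W b)] [TopologicalSpace (TotalSpace F W)] [FiberBundle F W]
  {q : DefiniteFun m F W} (φ : diffIPlus) (x : q.disk)

theorem mem_Icc : q.toFun x ∈ Icc (0 : ℝ) 1 := ⟨q.nonneg _, (show q.toFun x < 1 from x.2).le⟩

theorem map_radial_smulTot :
    q.toFun (smulTot (radial φ.1.extend (q.toFun x)) (x : TotalSpace F W)) =
      φ.1.extend (q.toFun x) := by
  rw [q.homog _ (radial_extend_pos φ (mem_Icc x)).le, radial_extend_sq_mul φ (mem_Icc x)]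

theorem map_radial_reflectFun_smulTot :
    q.toFun (smulTot (radial (reflectFun φ) (q.toFun x)) (x : TotalSpace F W)) =
      1 - φ.1.extend (1 - q.toFun x) := by
  rw [q.homog _ (radial_reflectFun_pos φ (mem_Icc x)).le, radial_reflectFun_sq_mul φ (mem_Icc x)]

theorem radial_smulTot_mem :
    smulTot (radial φ.1.extend (q.toFun x)) (x : TotalSpace F W) ∈ q.disk := by
  change _ < (1 : ℝ)
  rw [map_radial_smulTot]
  exact extend_lt_one_of_plus φ (mem_Icc x) x.2

theorem radial_reflectFun_smulTot_mem :
    smulTot (radial (reflectFun φ) (q.toFun x)) (x : TotalSpace F W) ∈ q.disk := by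
  change _ < (1 : ℝ)
  rw [map_radial_reflectFun_smulTot]
  have hx : q.toFun x < 1 := x.2
  have := extend_pos_of_plus φ (s := 1 - q.toFun x) ⟨by linarith, by linarith [q.nonneg x]⟩
    (by linarith)
  linarith

end DefiniteFun

/-! ### The lift of increasing diffeomorphisms -/

namespace SphereDiffeo

variable {m₀ : ℕ} {B₀ : Type*} [TopologicalSpace B₀] [ChartedSpace (EuclideanSpace ℝ (Fin m₀)) B₀]
  {F₀ : Type*} [NormedAddCommGroup F₀] [NormedSpace ℝ F₀]
  {W₀ : B₀ → Type*} [∀ b, AddCommGroup (W₀ b)] [∀ b, Module ℝ (W₀ b)]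
  [∀ b, TopologicalSpace (W₀ b)] [TopologicalSpace (TotalSpace F₀ W₀)] [FiberBundle F₀ W₀]
  [VectorBundle ℝ F₀ W₀]
  {m₁ : ℕ} {B₁ : Type*} [TopologicalSpace B₁] [ChartedSpace (EuclideanSpace ℝ (Fin m₁)) B₁]
  {F₁ : Type*} [NormedAddCommGroup F₁] [NormedSpace ℝ F₁]
  {W₁ : B₁ → Type*} [∀ b, AddCommGroup (W₁ b)] [∀ b, Module ℝ (W₁ b)]
  [∀ b, TopologicalSpace (W₁ b)] [TopologicalSpace (TotalSpace F₁ W₁)] [FiberBundle F₁ W₁]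
  [VectorBundle ℝ F₁ W₁]
  {q₀ : DefiniteFun m₀ F₀ W₀} {q₁ : DefiniteFun m₁ F₁ W₁} (ψ : SphereDiffeo q₀ q₁)

theorem ray_radial_left (φ : diffIPlus) (x : q₀.disk) :
    ψ.Ray (ψ.inl x) (ψ.inl ⟨_, DefiniteFun.radial_smulTot_mem φ x⟩) ∧
      ψ.fn (ψ.inl ⟨_, DefiniteFun.radial_smulTot_mem φ x⟩) = φ.1 (ψ.fn (ψ.inl x)) := by
  refine ⟨ψ.ray_inl_iff.2 ⟨_, _, radial_extend_pos φ (DefiniteFun.mem_Icc x), rfl, rfl⟩, Subtype.ext ?_⟩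
  rw [fn_inl, DefiniteFun.map_radial_smulTot, ← φ.1.extend_coe, fn_inl]

theorem ray_radial_right (φ : diffIPlus) (y : q₁.disk) :
    ψ.Ray (ψ.inr y) (ψ.inr ⟨_, DefiniteFun.radial_reflectFun_smulTot_mem φ y⟩) ∧
      ψ.fn (ψ.inr ⟨_, DefiniteFun.radial_reflectFun_smulTot_mem φ y⟩) = φ.1 (ψ.fn (ψ.inr y)) := by
  refine ⟨ψ.ray_inr_iff.2 ⟨_, _, radial_reflectFun_pos φ (DefiniteFun.mem_Icc y), rfl, rfl⟩, Subtype.ext ?_⟩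
  rw [fn_inr, DefiniteFun.map_radial_reflectFun_smulTot, ← φ.1.extend_coe, fn_inr, sub_sub_cancel]

theorem exists_ray (φ : diffIPlus) (z : ψ.Glued) :
    ∃ z', ψ.Ray z z' ∧ ψ.fn z' = φ.1 (ψ.fn z) := by
  obtain ⟨x, rfl⟩ | ⟨y, rfl⟩ := ψ.exists_inl_or_inr z
  · exact ⟨_, ψ.ray_radial_left φ x⟩
  · exact ⟨_, ψ.ray_radial_right φ y⟩

/-- The map of the glued space that preserves all rays and covers `φ`. -/
def lift (φ : diffIPlus) (z : ψ.Glued) : ψ.Glued := (ψ.exists_ray φ z).choose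

theorem ray_lift (φ : diffIPlus) (z : ψ.Glued) : ψ.Ray z (ψ.lift φ z) :=
  (ψ.exists_ray φ z).choose_spec.1

theorem fn_lift (φ : diffIPlus) (z : ψ.Glued) : ψ.fn (ψ.lift φ z) = φ.1 (ψ.fn z) :=
  (ψ.exists_ray φ z).choose_spec.2

/-- The lift is characterized by its ray and its level. Hence it is given by the radial formula in
each piece, and it respects composition. -/
theorem lift_eq {φ : diffIPlus} {z z' : ψ.Glued} (h : ψ.Ray z z') (hf : ψ.fn z' = φ.1 (ψ.fn z)) :
    ψ.lift φ z = z' :=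
  (ψ.ray_lift φ z).eq h ((ψ.fn_lift φ z).trans hf.symm)

theorem lift_mul (φ χ : diffIPlus) (z : ψ.Glued) :
    ψ.lift (φ * χ) z = ψ.lift φ (ψ.lift χ z) :=
  ψ.lift_eq ((ψ.ray_lift χ z).trans (ψ.ray_lift φ _)) (by rw [fn_lift, fn_lift]; rfl)

theorem lift_one (z : ψ.Glued) : ψ.lift 1 z = z := ψ.lift_eq (Ray.refl ψ z) rfl

variable [FiniteDimensional ℝ F₀] [FiniteDimensional ℝ F₁] [hne : Nonempty q₀.sphere]
  [IsManifold (𝓡 m₀) ∞ B₀] [ContMDiffVectorBundle ∞ F₀ W₀ (𝓡 m₀)]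
  [IsManifold (𝓡 m₁) ∞ B₁] [ContMDiffVectorBundle ∞ F₁ W₁ (𝓡 m₁)]

/-- Taking the group of increasing diffeomorphisms as the parameter space gives at once the
smoothness of each lift and the continuity of the lifting homomorphism. -/
theorem famAt_lift (φ : diffIPlus) (z : ψ.Glued) : FamAt ψ.E ψ.E ψ.lift φ z := by
  obtain ⟨x, rfl⟩ | ⟨x, rfl⟩ := ψ.exists_inl_or_inr z
  · obtain ⟨e, he, P, hP, hxe, hr, hs⟩ := ψ.exists_scaleChart_inl x
    refine famAt_of_radial (g := fun z => (ψ.fn z : ℝ)) (u := fun φ : diffIPlus => φ.1.extend)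
      (P := P) (IsManifold.subset_maximalAtlas he) hxe jetContOn_extend
      (fun φ s => DiffI.derivWithin_pos φ.2) ψ.contMDiff_fn (fun z => (ψ.fn z).2) ?_
    intro χ y hy
    obtain ⟨y, rfl⟩ := hr hy
    rw [ψ.lift_eq (ψ.ray_radial_left χ y).1 (ψ.ray_radial_left χ y).2]
    exact (hs y hy).2 _ _
  · obtain ⟨e, he, P, hP, hxe, hr, hs⟩ := ψ.exists_scaleChart_inr x
    refine famAt_of_radial (g := fun z => 1 - (ψ.fn z : ℝ)) (u := reflectFun)
      (P := P) (IsManifold.subset_maximalAtlas he) hxe jetContOn_reflectFun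
      (fun φ s => derivWithin_reflectFun_pos φ) (contMDiff_const.sub ψ.contMDiff_fn)
      (fun z => ⟨sub_nonneg.2 (ψ.fn z).2.2, sub_le_self _ (ψ.fn z).2.1⟩) ?_
    intro χ y hy
    obtain ⟨y, rfl⟩ := hr hy
    rw [ψ.lift_eq (ψ.ray_radial_right χ y).1 (ψ.ray_radial_right χ y).2, fn_inr, sub_sub_cancel]
    exact (hs y hy).2 _ _

/-- The diffeomorphisms of the glued space that preserve all rays and cover diffeomorphisms of the
segment. -/
def liftHom : diffIPlus →* DiffM ψ.E ψ.Glued where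
  toFun φ :=
    { toFun := ψ.lift φ
      invFun := ψ.lift φ⁻¹
      left_inv := fun z => by rw [← lift_mul, inv_mul_cancel, lift_one]
      right_inv := fun z => by rw [← lift_mul, mul_inv_cancel, lift_one]
      contMDiff_toFun := fun z => (ψ.famAt_lift φ z).contMDiffAt
      contMDiff_invFun := fun z => (ψ.famAt_lift φ⁻¹ z).contMDiffAt }
  map_one' := Diffeomorph.ext ψ.lift_one
  map_mul' φ χ := Diffeomorph.ext (ψ.lift_mul φ χ)

theorem fn_liftHom (φ : diffIPlus) (z : ψ.Glued) : ψ.fn (ψ.liftHom φ z) = φ.1 (ψ.fn z) :=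
  ψ.fn_lift φ z

theorem continuous_liftHom : Continuous ψ.liftHom :=
  continuous_diffM_iff.2 fun φ z => ψ.famAt_lift φ z

end SphereDiffeo


/-! ### Functions of squares -/

section Even

variable {T : Type*} [TopologicalSpace T]

theorem JetCont.mono_univ {E F : Type*} [NormedAddCommGroup E] [NormedSpace ℝ E]
    [NormedAddCommGroup F] [NormedSpace ℝ F] {u : T → E → F} {s : Set E} {t₀ : T} {x₀ : E}
    (h : JetCont u univ t₀ x₀) (hs : UniqueDiffOn ℝ s) (hx : x₀ ∈ s) : JetCont u s t₀ x₀ :=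
  h.comp (u := fun _ x => x) (.of_contDiffWithinAt hs hx contDiffWithinAt_id) hs uniqueDiffOn_univ
    hx (by simp)

theorem iteratedDeriv_eq_zero_of_even {g : ℝ → ℝ} (hg : ∀ᶠ s in 𝓝 0, g (-s) = g s) {k : ℕ}
    (hk : Odd k) : iteratedDeriv k g 0 = 0 := by
  have h1 : iteratedDeriv k (fun s => g (-s)) 0 = iteratedDeriv k g 0 :=
    Filter.EventuallyEq.iteratedDeriv_eq k hg
  rw [iteratedDeriv_comp_neg, hk.neg_one_pow, neg_zero, neg_one_smul] at h1
  linarith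

/-- A family whose composition with the square is smooth is smooth up to the boundary. -/
theorem jetContOn_of_sq {u g : T → ℝ → ℝ} {a : ℝ} (ha : 0 < a) (ha1 : a < 1)
    (hg : ∀ t, ∀ s ∈ Ioo (-1 : ℝ) 1, JetCont g univ t s)
    (hgu : ∀ t, ∀ s ∈ Ioo (-1 : ℝ) 1, g t s = u t (s ^ 2)) : JetContOn u (Icc 0 (a ^ 2)) := by
  have hsub : ∀ s ∈ Icc 0 a, s ∈ Ioo (-1 : ℝ) 1 := fun s hs => ⟨by linarith [hs.1], by linarith [hs.2]⟩
  have hud := uniqueDiffOn_Icc ha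
  have h0 : (0 : ℝ) ∈ Icc 0 a := ⟨le_rfl, ha.le⟩
  have h1 : JetContOn g (Icc 0 a) := fun t s hs => (hg t s (hsub s hs)).mono_univ hud hs
  have hodd : ∀ k, Odd k → ∀ t, iteratedDerivWithin k (g t) (Icc 0 a) 0 = 0 := by
    intro k hk t
    have hs : ContDiffAt ℝ ∞ (g t) 0 := by
      simpa [contDiffWithinAt_univ] using (hg t 0 (hsub 0 h0)).contDiffWithinAt (mem_univ _)
    rw [iteratedDerivWithin_eq_iteratedDeriv hud (hs.of_le (by exact_mod_cast le_top)) h0]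
    -- The function depends on `s` only through `s²`, hence is even near 0.
    refine iteratedDeriv_eq_zero_of_even ?_ hk
    filter_upwards [Ioo_mem_nhds (show (-1 : ℝ) < 0 by norm_num) one_pos] with s hs
    rw [hgu t s hs, hgu t (-s) ⟨by linarith [hs.2], by linarith [hs.1]⟩, neg_sq]
  refine (((h1.isJets ha).comp_sqrt ha hodd).jetContOn (by positivity)).congr fun t τ hτ => ?_
  simp only [Function.iterate_zero, id, iteratedDerivWithin_zero]
  rw [hgu t _ (hsub _ (sqrt_mem_Icc ha.le hτ)), Real.sq_sqrt hτ.1]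

/-- The substitution `s²` controls `u` near 0 and `1 - s²` controls it near 1. The bound `(3/4)² =
9/16` exceeds `1/2`, so the ranges `s < 9/16` and `1 - s < 9/16` cover the segment. -/
theorem jetContOn_of_sq_of_one_sub_sq {u g₀ g₁ : T → ℝ → ℝ}
    (hg₀ : ∀ t, ∀ s ∈ Ioo (-1 : ℝ) 1, JetCont g₀ univ t s)
    (hu₀ : ∀ t, ∀ s ∈ Ioo (-1 : ℝ) 1, g₀ t s = u t (s ^ 2))
    (hg₁ : ∀ t, ∀ s ∈ Ioo (-1 : ℝ) 1, JetCont g₁ univ t s)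
    (hu₁ : ∀ t, ∀ s ∈ Ioo (-1 : ℝ) 1, g₁ t s = u t (1 - s ^ 2)) : JetContOn u (Icc 0 1) := by
  have hud := uniqueDiffOn_Icc (zero_lt_one (α := ℝ))
  have hset : ∀ s < (3 / 4 : ℝ) ^ 2, Icc 0 ((3 / 4 : ℝ) ^ 2) =ᶠ[𝓝 s] Icc 0 1 := by
    intro s hs
    filter_upwards [Iio_mem_nhds hs] with y hy
    refine propext ⟨fun h => ⟨h.1, h.2.trans (by norm_num)⟩, fun h => ⟨h.1, le_of_lt hy⟩⟩
  have key : ∀ {u g : T → ℝ → ℝ}, (∀ t, ∀ s ∈ Ioo (-1 : ℝ) 1, JetCont g univ t s) →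
      (∀ t, ∀ s ∈ Ioo (-1 : ℝ) 1, g t s = u t (s ^ 2)) → ∀ t, ∀ s ∈ Icc (0 : ℝ) 1,
      s < (3 / 4 : ℝ) ^ 2 → JetCont u (Icc 0 1) t s := fun h1 h2 t s hs hs' =>
    (jetContOn_of_sq (by norm_num) (by norm_num) h1 h2 t s ⟨hs.1, hs'.le⟩).congr_set (hset s hs')
  intro t s hs
  rcases lt_or_ge s ((3 / 4 : ℝ) ^ 2) with h | h
  · exact key hg₀ hu₀ t s hs h
  · have hm : ∀ s ∈ Icc (0 : ℝ) 1, 1 - s ∈ Icc (0 : ℝ) 1 := fun s hs =>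
      ⟨by linarith [hs.2], by linarith [hs.1]⟩
    have h1 := key (u := fun t s => u t (1 - s)) hg₁ hu₁ t (1 - s) (hm s hs) (by linarith)
    have h2 : JetCont (fun (_ : T) (s : ℝ) => 1 - s) (Icc 0 1) t s :=
      .of_contDiffWithinAt hud hs (contDiffWithinAt_const.sub contDiffWithinAt_id)
    have h3 := h1.comp h2 hud hud hs (eventually_mem_slice.mono fun p hp => hm _ hp)
    simpa only [sub_sub_cancel] using h3

end Even

/-! ### The action of foliated diffeomorphisms on the leaf space -/

section Paths

variable {m : ℕ} {B : Type*} [TopologicalSpace B] [ChartedSpace (EuclideanSpace ℝ (Fin m)) B]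
  {F : Type*} [NormedAddCommGroup F] [NormedSpace ℝ F]
  {W : B → Type*} [∀ b, AddCommGroup (W b)] [∀ b, Module ℝ (W b)]
  [∀ b, TopologicalSpace (W b)] [TopologicalSpace (TotalSpace F W)] [FiberBundle F W]
  [VectorBundle ℝ F W]
  {E : Type*} [NormedAddCommGroup E] [NormedSpace ℝ E]
  {G : Type*} [TopologicalSpace G] [ChartedSpace E G]

/-- The diameter of the disk bundle through a point of the sphere bundle. -/
theorem DefiniteFun.exists_path (q : DefiniteFun m F W) {j : q.disk → G}
    (hj : ContMDiff ((𝓡 m).prod 𝓘(ℝ, F)) 𝓘(ℝ, E) ∞ j) (v : q.sphere) :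
    ∃ γ : ℝ → G, ∀ s ∈ Ioo (-1 : ℝ) 1, ContMDiffAt 𝓘(ℝ) 𝓘(ℝ, E) ∞ γ s ∧
      ∃ x : q.disk, j x = γ s ∧ q.toFun x = s ^ 2 := by
  classical
  have hq : ∀ s : ℝ, q.toFun (smulTot s (v : TotalSpace F W)) = s ^ 2 := fun s => by
    rw [q.map_smulTot, show q.toFun v = 1 from v.2, mul_one]
  have hm : ∀ s ∈ Ioo (-1 : ℝ) 1, smulTot s (v : TotalSpace F W) ∈ q.disk := fun s hs => by
    change _ < (1 : ℝ)
    rw [hq]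
    nlinarith [hs.1, hs.2]
  let p : ℝ → q.disk := fun s => if h : s ∈ Ioo (-1 : ℝ) 1 then ⟨_, hm s h⟩ else
    ⟨_, hm 0 ⟨by norm_num, one_pos⟩⟩
  have hp : ∀ s ∈ Ioo (-1 : ℝ) 1, (p s : TotalSpace F W) = smulTot s (v : TotalSpace F W) :=
    fun s hs => by simp only [p, dif_pos hs]
  refine ⟨fun s => j (p s), fun s hs => ⟨?_, p s, rfl, by rw [hp s hs, hq]⟩⟩
  refine (hj (p s)).comp s ?_
  rw [← ContMDiffAt.subtypeVal_comp_iff]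
  refine (contMDiffAt_smulTot (m := m) contMDiffAt_id
    (contMDiffAt_const (c := (v : TotalSpace F W)))).congr_of_eventuallyEq ?_
  filter_upwards [Ioo_mem_nhds hs.1 hs.2] with y hy using hp y hy

end Paths

/-! ### The homomorphism to the diffeomorphisms of the leaf space -/

namespace SphereDiffeo

variable {m₀ : ℕ} {B₀ : Type*} [TopologicalSpace B₀] [ChartedSpace (EuclideanSpace ℝ (Fin m₀)) B₀]
  {F₀ : Type*} [NormedAddCommGroup F₀] [NormedSpace ℝ F₀]
  {W₀ : B₀ → Type*} [∀ b, AddCommGroup (W₀ b)] [∀ b, Module ℝ (W₀ b)]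
  [∀ b, TopologicalSpace (W₀ b)] [TopologicalSpace (TotalSpace F₀ W₀)] [FiberBundle F₀ W₀]
  [VectorBundle ℝ F₀ W₀]
  {m₁ : ℕ} {B₁ : Type*} [TopologicalSpace B₁] [ChartedSpace (EuclideanSpace ℝ (Fin m₁)) B₁]
  {F₁ : Type*} [NormedAddCommGroup F₁] [NormedSpace ℝ F₁]
  {W₁ : B₁ → Type*} [∀ b, AddCommGroup (W₁ b)] [∀ b, Module ℝ (W₁ b)]
  [∀ b, TopologicalSpace (W₁ b)] [TopologicalSpace (TotalSpace F₁ W₁)] [FiberBundle F₁ W₁]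
  [VectorBundle ℝ F₁ W₁]
  {q₀ : DefiniteFun m₀ F₀ W₀} {q₁ : DefiniteFun m₁ F₁ W₁} (ψ : SphereDiffeo q₀ q₁)

variable [hne : Nonempty q₀.sphere]

theorem fn_surjective : Function.Surjective ψ.fn := ψ.surjective_fn Set.Nonempty.of_subtype

variable [FiniteDimensional ℝ F₀] [FiniteDimensional ℝ F₁]

/-- The map of the leaf space `[0,1]` induced by a foliated diffeomorphism. -/
def leafMap (h : diffFol ψ.E ψ.fn) (t : unitInterval) : unitInterval := (h.2 t).choose

theorem leafMap_fn (h : diffFol ψ.E ψ.fn) (z : ψ.Glued) :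
    ψ.leafMap h (ψ.fn z) = ψ.fn (h.1 z) := by
  have h1 : h.1 z ∈ leaf ψ.fn (ψ.leafMap h (ψ.fn z)) := by
    rw [leafMap, ← (h.2 (ψ.fn z)).choose_spec]
    exact ⟨z, rfl, rfl⟩
  exact (show ψ.fn (h.1 z) = _ from h1).symm

theorem leafMap_mul (g h : diffFol ψ.E ψ.fn) (t : unitInterval) :
    ψ.leafMap (g * h) t = ψ.leafMap g (ψ.leafMap h t) := by
  obtain ⟨z, rfl⟩ := ψ.fn_surjective t
  rw [leafMap_fn, leafMap_fn, leafMap_fn]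
  rfl

theorem leafMap_one (t : unitInterval) : ψ.leafMap 1 t = t := by
  obtain ⟨z, rfl⟩ := ψ.fn_surjective t
  rw [leafMap_fn]
  rfl

variable [IsManifold (𝓡 m₀) ∞ B₀] [ContMDiffVectorBundle ∞ F₀ W₀ (𝓡 m₀)]
  [IsManifold (𝓡 m₁) ∞ B₁] [ContMDiffVectorBundle ∞ F₁ W₁ (𝓡 m₁)]

theorem jetCont_fn_comp_path {γ : ℝ → ψ.Glued} {s : ℝ}
    (hγ : ContMDiffAt 𝓘(ℝ) 𝓘(ℝ, ψ.E) ∞ γ s) (h : diffFol ψ.E ψ.fn) :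
    JetCont (fun (h : diffFol ψ.E ψ.fn) s => (ψ.fn (h.1 (γ s)) : ℝ)) univ h s := by
  rw [← famAt_self_iff]
  have h1 : FamAt ℝ ψ.E (fun (_ : diffFol ψ.E ψ.fn) => γ) h s := .of_contMDiffAt hγ
  have h2 : FamAt ψ.E ψ.E (fun (h : diffFol ψ.E ψ.fn) z => h.1 z) h (γ s) :=
    (famAt_diffM_apply h.1 (γ s)).comp_param continuous_subtype_val.continuousAt rfl
  have h3 : FamAt ψ.E ℝ (fun (_ : diffFol ψ.E ψ.fn) z => (ψ.fn z : ℝ)) h (h.1 (γ s)) :=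
    .of_contMDiffAt (ψ.contMDiff_fn _)
  have h4 : FamAt ψ.E ℝ (fun (h : diffFol ψ.E ψ.fn) z => (ψ.fn (h.1 z) : ℝ)) h (γ s) :=
    FamAt.comp (K := fun (_ : diffFol ψ.E ψ.fn) z => (ψ.fn z : ℝ))
      (H := fun (h : diffFol ψ.E ψ.fn) z => h.1 z) h3 h2
  exact FamAt.comp (K := fun (h : diffFol ψ.E ψ.fn) z => (ψ.fn (h.1 z) : ℝ))
    (H := fun (_ : diffFol ψ.E ψ.fn) => γ) h4 h1

/-- Along a diameter of the first disk bundle `f = s²`, so the induced map at `s²` is `f(h(γ₀ s))`,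
which is smooth in `s` with jets continuous in `(h, s)`; a diameter of the second gives `1 - s²`.
With the foliated group as parameter space, this one statement yields both the smoothness of each
induced map and the continuity of `σ`. -/
theorem jetContOn_leafMap : JetContOn
    (fun h s => (ψ.leafMap h (projIcc (0 : ℝ) 1 zero_le_one s) : ℝ)) (Icc 0 1) := by
  have v : q₀.sphere := hne.some
  obtain ⟨γ₀, hγ₀⟩ := q₀.exists_path ψ.isLocalDiffeomorph_inl.contMDiff v
  obtain ⟨γ₁, hγ₁⟩ := q₁.exists_path ψ.isLocalDiffeomorph_inr.contMDiff (ψ.toEquiv v)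
  have hval : ∀ (h : diffFol ψ.E ψ.fn) (z : ψ.Glued) (s : ℝ), (ψ.fn z : ℝ) = s →
      (ψ.fn (h.1 z) : ℝ) = ψ.leafMap h (projIcc (0 : ℝ) 1 zero_le_one s) := by
    rintro h z s rfl
    rw [projIcc_val, leafMap_fn]
  refine jetContOn_of_sq_of_one_sub_sq (g₀ := fun h s => (ψ.fn (h.1 (γ₀ s)) : ℝ))
    (g₁ := fun h s => (ψ.fn (h.1 (γ₁ s)) : ℝ))
    (fun h s hs => ψ.jetCont_fn_comp_path (hγ₀ s hs).1 h) (fun h s hs => ?_)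
    (fun h s hs => ψ.jetCont_fn_comp_path (hγ₁ s hs).1 h) (fun h s hs => ?_)
  · obtain ⟨x, hx, hqx⟩ := (hγ₀ s hs).2
    exact hval h _ _ (by rw [← hx, fn_inl, hqx])
  · obtain ⟨x, hx, hqx⟩ := (hγ₁ s hs).2
    exact hval h _ _ (by rw [← hx, fn_inr, hqx])

/-- The homomorphism sending a foliated diffeomorphism to the induced diffeomorphism of the leaf
space `[0,1]`. -/
def leafHom : diffFol ψ.E ψ.fn →* DiffI where
  toFun h := diffIMk (ψ.leafMap h) (ψ.leafMap h⁻¹)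
    (fun t => by rw [← leafMap_mul, inv_mul_cancel, leafMap_one])
    (fun t => by rw [← leafMap_mul, mul_inv_cancel, leafMap_one])
    (ψ.jetContOn_leafMap.contDiffOn h) (ψ.jetContOn_leafMap.contDiffOn h⁻¹)
  map_one' := Diffeomorph.ext ψ.leafMap_one
  map_mul' g h := Diffeomorph.ext (ψ.leafMap_mul g h)

theorem leafHom_fn (h : diffFol ψ.E ψ.fn) (z : ψ.Glued) :
    ψ.leafHom h (ψ.fn z) = ψ.fn (h.1 z) := ψ.leafMap_fn h z

theorem continuous_leafHom : Continuous ψ.leafHom := continuous_diffI_iff.2 ψ.jetContOn_leafMap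

end SphereDiffeo


/-! ### Foliated diffeomorphisms and stabilizers: exact sequences -/

section Exactness

variable {E : Type*} [NormedAddCommGroup E] [NormedSpace ℝ E]
  {M : Type*} [TopologicalSpace M] [ChartedSpace E M] {f : M → unitInterval}

theorem stabR_eq_diffLp : stabR E f = diffLp E f := by
  ext h
  refine ⟨fun hh t => image_leaf_of_mem (stabIncl E f ⟨h, hh⟩).2 t, fun hh => funext fun x => ?_⟩
  have hx : x ∈ h '' leaf f (f x) := by
    rw [hh (f x)]
    rfl
  obtain ⟨y, hy, hyx⟩ := hx
  rw [Function.comp_apply, ← hyx, h.symm_apply_apply, hyx]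
  exact hy

theorem Continuous.diffM_mul [IsManifold 𝓘(ℝ, E) ∞ M] [FiniteDimensional ℝ E] {T : Type*}
    [TopologicalSpace T] {a b : T → DiffM E M} (ha : Continuous a) (hb : Continuous b) :
    Continuous fun t => a t * b t := by
  rw [continuous_diffM_iff] at ha hb ⊢
  exact fun t x => FamAt.comp (K := fun t x => a t x) (H := fun t x => b t x) (ha t _) (hb t x)

theorem isEmbedding_subgroupInclusion {H K : Subgroup (DiffM E M)} (h : H ≤ K) :
    IsEmbedding (Subgroup.inclusion h) :=
  .of_comp (continuous_subtype_val.subtype_mk _) continuous_subtype_val IsEmbedding.subtypeVal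

theorem isEmbedding_stabIncl : IsEmbedding (stabIncl E f) := by
  refine .of_comp (g := fun p : stabLR E f => p.1.2)
    ((continuous_const.prodMk continuous_subtype_val).subtype_mk _)
    (continuous_snd.comp continuous_subtype_val) ?_
  exact IsEmbedding.subtypeVal

theorem isEmbedding_stabInclPlus : IsEmbedding (stabInclPlus E f) := by
  refine .of_comp (g := fun p : stabLRPlus E f => p.1.2)
    ((continuous_const.prodMk continuous_subtype_val).subtype_mk _)
    (continuous_snd.comp continuous_subtype_val) ?_
  exact IsEmbedding.subtypeVal

theorem continuous_projI : Continuous (projI E f) := continuous_fst.comp continuous_subtype_val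

theorem continuous_projIPlus : Continuous (projIPlus E f) :=
  (continuous_fst.comp continuous_subtype_val).subtype_mk _

theorem continuous_projM : Continuous (projM E f) :=
  (continuous_snd.comp continuous_subtype_val).subtype_mk _

theorem continuous_projMPlus : Continuous (projMPlus E f) :=
  (continuous_snd.comp continuous_subtype_val).subtype_mk _

theorem mem_stabR_of_one_mem {h : DiffM E M} (hh : ((1 : DiffI), h) ∈ stabLR E f) :
    h ∈ stabR E f := by
  have h1 : h⁻¹ ∈ stabR E f := (show (1 : DiffI) ∘ f = f ∘ h from hh).symm
  simpa using (stabR E f).inv_mem h1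

theorem range_stabIncl : (stabIncl E f).range = (projI E f).ker := by
  ext p
  constructor
  · rintro ⟨h, rfl⟩
    rfl
  · intro hp
    have hp1 : p.1.1 = 1 := hp
    refine ⟨⟨p.1.2, mem_stabR_of_one_mem ?_⟩, Subtype.ext (Prod.ext hp1.symm rfl)⟩
    rw [← hp1]
    exact p.2

theorem range_stabInclPlus : (stabInclPlus E f).range = (projIPlus E f).ker := by
  ext p
  constructor
  · rintro ⟨h, rfl⟩
    rfl
  · intro hp
    have hp1 : p.1.1 = 1 := congrArg Subtype.val (show projIPlus E f p = 1 from hp)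
    refine ⟨⟨p.1.2, mem_stabR_of_one_mem ?_⟩, Subtype.ext (Prod.ext hp1.symm rfl)⟩
    rw [← hp1]
    exact p.2.1

variable (hf : Function.Surjective f) (σ : diffFol E f →* DiffI) (hσc : Continuous σ)
  (hσ : ∀ h x, σ h (f x) = f (h.1 x))

include hσ in
theorem leafSpace_pair_mem (h : diffFol E f) : (σ h, h.1) ∈ stabLR E f := funext (hσ h)

include hf hσ

/-- As `f` is onto, `φ ∘ f = f ∘ h` determines `φ` from `h`. This is the injectivity of the
projection `(φ, h) ↦ h`. -/
theorem leafSpace_projM (p : stabLR E f) : σ (projM E f p) = projI E f p := by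
  refine Diffeomorph.ext fun t => ?_
  obtain ⟨x, rfl⟩ := hf t
  rw [hσ]
  exact (congrFun (show p.1.1 ∘ f = f ∘ p.1.2 from p.2) x).symm

theorem leafSpace_eq_one_iff (h : diffFol E f) : σ h = 1 ↔ h.1 ∈ diffLp E f := by
  rw [← stabR_eq_diffLp]
  refine ⟨fun h1 => mem_stabR_of_one_mem ?_, fun h1 => ?_⟩
  · rw [← h1]
    exact leafSpace_pair_mem σ hσ h
  · exact leafSpace_projM hf σ hσ (stabIncl E f ⟨h.1, h1⟩)

theorem leafSpace_mem_diffIPlus_iff (h : diffFol E f) : σ h ∈ diffIPlus ↔ h.1 ∈ diffFolPlus E f := by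
  constructor
  · intro h1
    exact (projMPlus E f ⟨(σ h, h.1), leafSpace_pair_mem σ hσ h, h1⟩).2
  · intro h1
    obtain ⟨x, hx⟩ := hf 0
    rw [mem_diffIPlus_iff]
    conv_lhs => rw [← hx, hσ]
    have h2 : h.1 x ∈ h.1 '' leaf f 0 := ⟨x, hx, rfl⟩
    rw [h1.2.1] at h2
    exact h2

include hσc

/-- The exact sequences of a function whose foliated diffeomorphisms act continuously on the leaf
space, and that admits a continuous lift of the orientation preserving diffeomorphisms of
`[0,1]`. -/
theorem exists_leafSpace_sequences (τ : diffIPlus →* DiffM E M) (hτc : Continuous τ)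
    (hτ : ∀ φ x, f (τ φ x) = φ.1 (f x)) :
    ∃ (σp : diffFolPlus E f →* diffIPlus) (θ : diffIPlus →* diffFolPlus E f)
        (θhat : diffIPlus →* stabLRPlus E f) (Φ : stabLRPlus E f ≃ₜ* diffFolPlus E f),
      (∀ h, (σp h).1 = σ (Subgroup.inclusion (diffFolPlus_le E f) h)) ∧
      IsShortExact (stabInclPlus E f) (projIPlus E f) ∧
      IsShortExact (Subgroup.inclusion (diffLp_le_plus E f)) σp ∧
      (∀ p, Φ p = projMPlus E f p) ∧
      (∀ h, (Φ.symm h).1 = ((σp h).1, h.1)) ∧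
      (∀ h (h₁ : h ∈ stabR E f) (h₂ : h ∈ diffLp E f),
        Φ (stabInclPlus E f ⟨h, h₁⟩) = Subgroup.inclusion (diffLp_le_plus E f) ⟨h, h₂⟩) ∧
      (∀ p, σp (Φ p) = projIPlus E f p) ∧
      Continuous θ ∧ Continuous θhat ∧
      (∀ φ x, φ.1 (f x) = f ((θ φ).1 x)) ∧
      (∀ φ, (θhat φ).1 = (φ.1, (θ φ).1)) ∧
      (∀ φ, σp (θ φ) = φ) ∧ (∀ φ, projIPlus E f (θhat φ) = φ) ∧ ∀ φ, Φ (θhat φ) = θ φ := by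
  let ι := Subgroup.inclusion (diffFolPlus_le E f)
  have hι : Continuous ι := (isEmbedding_subgroupInclusion (diffFolPlus_le E f)).continuous
  let σp : diffFolPlus E f →* diffIPlus := (σ.comp ι).codRestrict diffIPlus fun h =>
    (leafSpace_mem_diffIPlus_iff hf σ hσ (ι h)).2 h.2
  have hσp : Continuous σp := (hσc.comp hι).subtype_mk _
  let θhat : diffIPlus →* stabLRPlus E f := (diffIPlus.subtype.prod τ).codRestrict _ fun φ =>
    ⟨funext fun x => (hτ φ x).symm, φ.2⟩
  have hθhat : Continuous θhat := (continuous_subtype_val.prodMk hτc).subtype_mk _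
  have hΦ : ∀ p, σp (projMPlus E f p) = projIPlus E f p := fun p =>
    Subtype.ext (leafSpace_projM hf σ hσ ⟨p.1, p.2.1⟩)
  let Φ : stabLRPlus E f ≃ₜ* diffFolPlus E f :=
    { projMPlus E f with
      invFun := fun h => ⟨((σp h).1, h.1), leafSpace_pair_mem σ hσ (ι h), (σp h).2⟩
      left_inv := fun p => Subtype.ext (Prod.ext (congrArg Subtype.val (hΦ p)) rfl)
      right_inv := fun h => rfl
      continuous_toFun := continuous_projMPlus
      continuous_invFun := ((continuous_subtype_val.comp hσp).prodMk
        continuous_subtype_val).subtype_mk _ }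
  refine ⟨σp, (projMPlus E f).comp θhat, θhat, Φ, fun h => rfl,
    ⟨isEmbedding_stabInclPlus, continuous_projIPlus, range_stabInclPlus, fun φ => ⟨θhat φ, rfl⟩⟩,
    ⟨isEmbedding_subgroupInclusion _, hσp, ?_, fun φ => ⟨projMPlus E f (θhat φ), hΦ _⟩⟩,
    fun p => rfl, fun h => rfl, fun h h₁ h₂ => rfl, hΦ, continuous_projMPlus.comp hθhat, hθhat,
    fun φ x => (hτ φ x).symm, fun φ => rfl, fun φ => hΦ _, fun φ => rfl, fun φ => rfl⟩
  ext h
  have h1 : h ∈ σp.ker ↔ σ (ι h) = 1 := Subtype.ext_iff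
  rw [h1, leafSpace_eq_one_iff hf σ hσ]
  exact ⟨fun ⟨g, hg⟩ => hg ▸ g.2, fun hh => ⟨⟨h.1, hh⟩, rfl⟩⟩

/-- The deformation is `h · θ(Λ(σ(h)⁻¹, t))`. At `t = 1` its image under `σ` is `σ(h) σ(h)⁻¹ = 1`,
which puts it in the kernel; for `σ(h) = 1` the segment `Λ` is constant, so leaf preserving `h` do
not move. -/
theorem isStrongDeformationRetract_diffLp [IsManifold 𝓘(ℝ, E) ∞ M] [FiniteDimensional ℝ E]
    (τ : diffIPlus →* DiffM E M) (hτc : Continuous τ) (hτ : ∀ φ x, f (τ φ x) = φ.1 (f x)) :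
    IsStrongDeformationRetract {h : diffFolPlus E f | h.1 ∈ diffLp E f} := by
  obtain ⟨σp, θ, -, -, hσp, -, hex, -, -, -, -, hθ, -, -, -, hσθ, -, -⟩ :=
    exists_leafSpace_sequences hf σ hσc hσ τ hτc hτ
  obtain ⟨Λ, hΛ, hΛ0, hΛ1, hΛone⟩ := exists_diffI_segment
  have hker : ∀ h : diffFolPlus E f, σp h = 1 ↔ h.1 ∈ diffLp E f := fun h => by
    rw [Subtype.ext_iff, hσp]
    exact leafSpace_eq_one_iff hf σ hσ _
  have hinv : Continuous fun h : diffFolPlus E f => (σp h)⁻¹ :=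
    (continuous_diffI_inv.comp (continuous_subtype_val.comp hex.continuous)).subtype_mk _
  have hG : Continuous fun p : diffFolPlus E f × unitInterval => p.1 * θ (Λ ((σp p.1)⁻¹, p.2)) := by
    refine Continuous.subtype_mk (f := fun p : diffFolPlus E f × unitInterval =>
      p.1.1 * (θ (Λ ((σp p.1)⁻¹, p.2))).1) (Continuous.diffM_mul
        (continuous_subtype_val.comp continuous_fst) (continuous_subtype_val.comp (hθ.comp
        (hΛ.comp ((hinv.comp continuous_fst).prodMk continuous_snd))))) _
  refine ⟨⟨_, hG⟩, fun h => ?_, fun h => ?_, fun h hh t => ?_⟩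
  · simp only [ContinuousMap.coe_mk, hΛ0, map_one, mul_one]
  · simp only [ContinuousMap.coe_mk, hΛ1]
    exact (hker _).1 (by rw [map_mul, hσθ, mul_inv_cancel])
  · simp only [ContinuousMap.coe_mk]
    rw [(hker h).2 hh, inv_one, hΛone, map_one, mul_one]

/-- Only surjectivity onto the decreasing diffeomorphisms is new. A foliated `h` outside `D^fol_+`
induces a decreasing `σ(h)`, and any decreasing `φ` is the product of the increasing, hence
liftable, `φ σ(h)⁻¹` with `σ(h)`. -/
theorem exists_leafSpace_sequences_of_ne (τ : diffIPlus →* DiffM E M)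
    (hτ : ∀ φ x, f (τ φ x) = φ.1 (f x)) (hne : diffFolPlus E f ≠ diffFol E f) :
    ∃ Φ : stabLR E f ≃ₜ* diffFol E f,
      IsShortExact (stabIncl E f) (projI E f) ∧
      IsShortExact (Subgroup.inclusion (diffLp_le E f)) σ ∧
      (∀ p, Φ p = projM E f p) ∧
      (∀ h, (Φ.symm h).1 = (σ h, h.1)) ∧
      (∀ h (h₁ : h ∈ stabR E f) (h₂ : h ∈ diffLp E f),
        Φ (stabIncl E f ⟨h, h₁⟩) = Subgroup.inclusion (diffLp_le E f) ⟨h, h₂⟩) ∧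
      ∀ p, σ (Φ p) = projI E f p := by
  have hΦ := leafSpace_projM hf σ hσ
  have hτm : ∀ φ : diffIPlus, (φ.1, τ φ) ∈ stabLR E f := fun φ => funext fun x => (hτ φ x).symm
  have hsurj : Function.Surjective σ := by
    obtain ⟨h, hh, hh'⟩ := SetLike.exists_of_lt ((diffFolPlus_le E f).lt_of_ne hne)
    have hrev : σ ⟨h, hh⟩ ∉ diffIPlus := fun h1 =>
      hh' ((leafSpace_mem_diffIPlus_iff hf σ hσ ⟨h, hh⟩).1 h1)
    have hplus : ∀ φ : diffIPlus, ∃ g, σ g = φ.1 := fun φ =>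
      ⟨projM E f ⟨(φ.1, τ φ), hτm φ⟩, hΦ _⟩
    intro φ
    by_cases hφ : φ ∈ diffIPlus
    · exact hplus ⟨φ, hφ⟩
    · have h0 : (σ ⟨h, hh⟩)⁻¹ 0 = 1 := by
        rw [← diffI_apply_one_of_not_mem hrev]
        exact (σ ⟨h, hh⟩).symm_apply_apply 1
      have hmem : φ * (σ ⟨h, hh⟩)⁻¹ ∈ diffIPlus := by
        rw [mem_diffIPlus_iff]
        change φ ((σ ⟨h, hh⟩)⁻¹ 0) = 0
        rw [h0, diffI_apply_one_of_not_mem hφ]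
      obtain ⟨g, hg⟩ := hplus ⟨_, hmem⟩
      exact ⟨g * ⟨h, hh⟩, by rw [map_mul, hg, inv_mul_cancel_right]⟩
  let Φ : stabLR E f ≃ₜ* diffFol E f :=
    { projM E f with
      invFun := fun h => ⟨(σ h, h.1), leafSpace_pair_mem σ hσ h⟩
      left_inv := fun p => Subtype.ext (Prod.ext (hΦ p) rfl)
      right_inv := fun h => rfl
      continuous_toFun := continuous_projM
      continuous_invFun := (hσc.prodMk continuous_subtype_val).subtype_mk _ }
  refine ⟨Φ, ⟨isEmbedding_stabIncl, continuous_projI, range_stabIncl, fun φ => ?_⟩,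
    ⟨isEmbedding_subgroupInclusion _, hσc, ?_, hsurj⟩, fun p => rfl, fun h => rfl,
    fun h h₁ h₂ => rfl, hΦ⟩
  · obtain ⟨h, rfl⟩ := hsurj φ
    exact ⟨⟨(σ h, h.1), leafSpace_pair_mem σ hσ h⟩, rfl⟩
  · ext h
    rw [MonoidHom.mem_ker, leafSpace_eq_one_iff hf σ hσ]
    exact ⟨fun ⟨g, hg⟩ => hg ▸ g.2, fun hh => ⟨⟨h.1, hh⟩, rfl⟩⟩

end Exactness

end FolDiff

end

/-! ### The main theorem -/

theorem mainTheorem6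
    {m₀ : ℕ} {B₀ : Type*} [TopologicalSpace B₀] [ChartedSpace (EuclideanSpace ℝ (Fin m₀)) B₀]
    [IsManifold (𝓡 m₀) ∞ B₀] [T2Space B₀] [CompactSpace B₀]
    {F₀ : Type*} [NormedAddCommGroup F₀] [NormedSpace ℝ F₀] [FiniteDimensional ℝ F₀]
    {W₀ : B₀ → Type*} [∀ b, AddCommGroup (W₀ b)] [∀ b, Module ℝ (W₀ b)]
    [∀ b, TopologicalSpace (W₀ b)] [TopologicalSpace (TotalSpace F₀ W₀)] [FiberBundle F₀ W₀]
    [VectorBundle ℝ F₀ W₀] [ContMDiffVectorBundle ∞ F₀ W₀ (𝓡 m₀)]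
    {m₁ : ℕ} {B₁ : Type*} [TopologicalSpace B₁] [ChartedSpace (EuclideanSpace ℝ (Fin m₁)) B₁]
    [IsManifold (𝓡 m₁) ∞ B₁] [T2Space B₁] [CompactSpace B₁]
    {F₁ : Type*} [NormedAddCommGroup F₁] [NormedSpace ℝ F₁] [FiniteDimensional ℝ F₁]
    {W₁ : B₁ → Type*} [∀ b, AddCommGroup (W₁ b)] [∀ b, Module ℝ (W₁ b)]
    [∀ b, TopologicalSpace (W₁ b)] [TopologicalSpace (TotalSpace F₁ W₁)] [FiberBundle F₁ W₁]
    [VectorBundle ℝ F₁ W₁] [ContMDiffVectorBundle ∞ F₁ W₁ (𝓡 m₁)]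
    (q₀ : DefiniteFun m₀ F₀ W₀) (q₁ : DefiniteFun m₁ F₁ W₁) [Nonempty q₀.sphere]
    (ψ : SphereDiffeo q₀ q₁) :
    -- the glued space is a closed manifold containing both open disk bundles as open submanifolds
    (CompactSpace ψ.Glued ∧ T2Space ψ.Glued ∧ SecondCountableTopology ψ.Glued ∧
      IsManifold 𝓘(ℝ, ψ.E) ∞ ψ.Glued) ∧
    (IsOpenEmbedding ψ.inl ∧ IsLocalDiffeomorph ((𝓡 m₀).prod 𝓘(ℝ, F₀)) 𝓘(ℝ, ψ.E) ∞ ψ.inl ∧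
      IsOpenEmbedding ψ.inr ∧ IsLocalDiffeomorph ((𝓡 m₁).prod 𝓘(ℝ, F₁)) 𝓘(ℝ, ψ.E) ∞ ψ.inr) ∧
    -- the function is Morse-Bott, onto `[0,1]`, and its critical set is the union of the two
    -- singular leaves, which are the zero sections
    (IsMorseBott ψ.E (fun x => (ψ.fn x : ℝ)) ∧ Function.Surjective ψ.fn ∧
      {x | mfderiv 𝓘(ℝ, ψ.E) 𝓘(ℝ) (fun x => (ψ.fn x : ℝ)) x = 0} = leaf ψ.fn 0 ∪ leaf ψ.fn 1 ∧
      leaf ψ.fn 0 = ψ.inl '' {x | (x : TotalSpace F₀ W₀).2 = 0} ∧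
      leaf ψ.fn 1 = ψ.inr '' {x | (x : TotalSpace F₁ W₁).2 = 0}) ∧
    stabR ψ.E ψ.fn = diffLp ψ.E ψ.fn ∧
    ∃ σ : diffFol ψ.E ψ.fn →* DiffI,
      (Continuous σ ∧ ∀ h x, σ h (ψ.fn x) = ψ.fn (h.1 x)) ∧
      -- the isomorphism of split exact sequences
      (∃ (σp : diffFolPlus ψ.E ψ.fn →* diffIPlus) (θ : diffIPlus →* diffFolPlus ψ.E ψ.fn)
          (θhat : diffIPlus →* stabLRPlus ψ.E ψ.fn) (Φ : stabLRPlus ψ.E ψ.fn ≃ₜ* diffFolPlus ψ.E ψ.fn),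
        (∀ h, (σp h).1 = σ (Subgroup.inclusion (diffFolPlus_le ψ.E ψ.fn) h)) ∧
        IsShortExact (stabInclPlus ψ.E ψ.fn) (projIPlus ψ.E ψ.fn) ∧
        IsShortExact (Subgroup.inclusion (diffLp_le_plus ψ.E ψ.fn)) σp ∧
        (∀ p, Φ p = projMPlus ψ.E ψ.fn p) ∧
        (∀ h, (Φ.symm h).1 = ((σp h).1, h.1)) ∧
        (∀ h (h₁ : h ∈ stabR ψ.E ψ.fn) (h₂ : h ∈ diffLp ψ.E ψ.fn),
          Φ (stabInclPlus ψ.E ψ.fn ⟨h, h₁⟩) = Subgroup.inclusion (diffLp_le_plus ψ.E ψ.fn) ⟨h, h₂⟩) ∧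
        (∀ p, σp (Φ p) = projIPlus ψ.E ψ.fn p) ∧
        Continuous θ ∧ Continuous θhat ∧
        (∀ φ x, φ.1 (ψ.fn x) = ψ.fn ((θ φ).1 x)) ∧
        (∀ φ, (θhat φ).1 = (φ.1, (θ φ).1)) ∧
        (∀ φ, σp (θ φ) = φ) ∧ (∀ φ, projIPlus ψ.E ψ.fn (θhat φ) = φ) ∧ ∀ φ, Φ (θhat φ) = θ φ) ∧
      IsStrongDeformationRetract {h : diffFolPlus ψ.E ψ.fn | h.1 ∈ diffLp ψ.E ψ.fn} ∧
      -- the isomorphism of extensions of the whole group of diffeomorphisms of `[0,1]`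
      (diffFolPlus ψ.E ψ.fn ≠ diffFol ψ.E ψ.fn →
        ∃ Φ : stabLR ψ.E ψ.fn ≃ₜ* diffFol ψ.E ψ.fn,
          IsShortExact (stabIncl ψ.E ψ.fn) (projI ψ.E ψ.fn) ∧
          IsShortExact (Subgroup.inclusion (diffLp_le ψ.E ψ.fn)) σ ∧
          (∀ p, Φ p = projM ψ.E ψ.fn p) ∧
          (∀ h, (Φ.symm h).1 = (σ h, h.1)) ∧
          (∀ h (h₁ : h ∈ stabR ψ.E ψ.fn) (h₂ : h ∈ diffLp ψ.E ψ.fn),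
            Φ (stabIncl ψ.E ψ.fn ⟨h, h₁⟩) = Subgroup.inclusion (diffLp_le ψ.E ψ.fn) ⟨h, h₂⟩) ∧
          ∀ p, σ (Φ p) = projI ψ.E ψ.fn p) := by
  refine ⟨⟨ψ.compactSpace, ψ.t2Space, ?_, ψ.isManifold⟩,
    ⟨ψ.isOpenEmbedding_inl, ψ.isLocalDiffeomorph_inl, ψ.isOpenEmbedding_inr,
      ψ.isLocalDiffeomorph_inr⟩,
    ⟨ψ.isMorseBott_fn, ψ.fn_surjective, ψ.setOf_mfderiv_fn_eq_zero, ψ.leaf_zero, ψ.leaf_one⟩,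
    stabR_eq_diffLp, ψ.leafHom, ⟨ψ.continuous_leafHom, ψ.leafHom_fn⟩,
    exists_leafSpace_sequences ψ.fn_surjective ψ.leafHom ψ.continuous_leafHom ψ.leafHom_fn
      ψ.liftHom ψ.continuous_liftHom ψ.fn_liftHom,
    isStrongDeformationRetract_diffLp ψ.fn_surjective ψ.leafHom ψ.continuous_leafHom
      ψ.leafHom_fn ψ.liftHom ψ.continuous_liftHom ψ.fn_liftHom,
    exists_leafSpace_sequences_of_ne ψ.fn_surjective ψ.leafHom ψ.continuous_leafHom
      ψ.leafHom_fn ψ.liftHom ψ.fn_liftHom⟩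
  have : CompactSpace ψ.Glued := ψ.compactSpace
  exact ChartedSpace.secondCountable_of_sigmaCompact ψ.E ψ.Glued
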